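/- Let $H^{2,2}(\mathbb{R})$ be the completion of the Schwartz space $\mathcal{S}(\mathbb{R})$ of complex-valued functions in the norm $$\|q\|_{H^{2,2}} = \|(1+x^2)\,q\|_{L^2} + \|q''\|_{L^2}.$$ By a (global strong) solution of the derivative nonlinear Schrödinger equation $$ i u_t + u_{xx} = i\,(|u|^2u)_x, \qquad u(\cdot,0)=u_0, \tag{DNLS}$$ we mean a function $u\in C(\mathbb{R};H^{2,2}(\mathbb{R}))$ with $u(\cdot,0)=u_0$ such that, at every time $t\in\mathbb{R}$, the derivative $u_t$ exists in $L^2(\mathbb{R})$, the weak derivative $(|u|^2u)_x$ belongs to $L^2(\mathbb{R})$, and the equation holds in $L^2(\mathbb{R})$. **Corollary.** There is an open subset $U$ of $H^{2,2}(\mathbb{R})$ containing a neighbourhood of $0$ such that for every $u_0\in U$ there is a unique solution $u$ of (DNLS), and the solution map $$ U\times\mathbb{R}\to H^{2,2}(\mathbb{R}),\qquad (u_0,t)\mapsto u(\cdot,t) $$ is continuous, and is Lipschitz continuous in $u_0\in U$ for each $t\in\mathbb{R}$: for every $t\in\mathbb{R}$ there is a constant $K_t$ such that any two solutions $u,\tilde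 u$ with initial data $u_0,\tilde u_0\in U$ satisfy $$\|u(\cdot,t)-\tilde u(\cdot,t)\|_{H^{2,2}}\le K_t\,\|u_0-\tilde u_0\|_{H^{2,2}}.$$ -/

import Mathlib

open MeasureTheory
open scoped SchwartzMap ContDiff

noncomputable section

/-- The complex Hilbert space `L²(ℝ)`. -/
abbrev L2R : Type := Lp ℂ 2 (volume : Measure ℝ)

/-- The linear map `q ↦ ((1 + x²) q, q'')` from `𝓢(ℝ)` to `L²(ℝ) × L²(ℝ)`. The product carries the
norm `‖f‖₂ + ‖g‖₂`, so the norm of the image of `q` is `‖(1 + x²) q‖₂ + ‖q''‖₂`. -/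
def weightedJet : 𝓢(ℝ, ℂ) →ₗ[ℂ] WithLp 1 (L2R × L2R) :=
  (WithLp.linearEquiv 1 ℂ (L2R × L2R)).symm.toLinearMap ∘ₗ
    LinearMap.prod
      ((SchwartzMap.toLpCLM ℂ ℂ 2 (volume : Measure ℝ) ∘L
        SchwartzMap.smulLeftCLM ℂ (fun x : ℝ => (1 + (x : ℂ) ^ 2))).toLinearMap)
      ((SchwartzMap.toLpCLM ℂ ℂ 2 (volume : Measure ℝ) ∘L
        SchwartzMap.derivCLM ℂ ℂ ∘L SchwartzMap.derivCLM ℂ ℂ).toLinearMap)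

/-- The components of `weightedJet φ` are the functions `(1 + x²) φ` and `φ''`. -/
theorem weightedJet_spec (φ : 𝓢(ℝ, ℂ)) :
    ((weightedJet φ).fst =ᵐ[volume] fun x : ℝ => (1 + (x : ℂ) ^ 2) * φ x) ∧
      ((weightedJet φ).snd =ᵐ[volume] fun x : ℝ => deriv (deriv φ) x) := by
  have hg : Function.HasTemperateGrowth (fun x : ℝ => (1 + (x : ℂ) ^ 2)) := by
    have h : Function.HasTemperateGrowth (fun x : ℝ => (x : ℂ)) :=
      Complex.ofRealCLM.hasTemperateGrowth
    fun_prop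
  constructor
  · refine (SchwartzMap.coeFn_toLp
      (SchwartzMap.smulLeftCLM ℂ (fun x : ℝ => (1 + (x : ℂ) ^ 2)) φ) 2).trans ?_
    refine Filter.Eventually.of_forall fun x => ?_
    simp [SchwartzMap.smulLeftCLM_apply_apply hg]
  · refine (SchwartzMap.coeFn_toLp
      (SchwartzMap.derivCLM ℂ ℂ (SchwartzMap.derivCLM ℂ ℂ φ)) 2).trans ?_
    refine Filter.Eventually.of_forall fun x => ?_
    have h : ((SchwartzMap.derivCLM ℂ ℂ φ : 𝓢(ℝ, ℂ)) : ℝ → ℂ) = deriv φ := by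
      ext y; simp [SchwartzMap.derivCLM_apply]
    simp [SchwartzMap.derivCLM_apply, h]

/-- The closure of the image of `𝓢(ℝ)` under `q ↦ ((1 + x²) q, q'')`, as a subspace of the Banach
space `L²(ℝ) × L²(ℝ)`. -/
def H22Submodule : Submodule ℂ (WithLp 1 (L2R × L2R)) :=
  (LinearMap.range weightedJet).topologicalClosure

/-- The space `H^{2,2}(ℝ)`: the completion of `𝓢(ℝ)` in the norm `‖(1 + x²) q‖₂ + ‖q''‖₂`.
An element is recorded as the pair `((1 + x²) q, q'')` and carries the norm of that pair. -/
abbrev H22 : Type := ↥H22Submodule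

namespace H22

/-- The function `q` underlying an element of `H^{2,2}(ℝ)` (determined almost everywhere). -/
def toFun (q : H22) : ℝ → ℂ := fun x => (1 + (x : ℂ) ^ 2)⁻¹ * q.1.fst x

theorem memLp_toFun (q : H22) : MemLp q.toFun 2 (volume : Measure ℝ) := by
  have hq : MemLp (q.1.fst : ℝ → ℂ) 2 (volume : Measure ℝ) := Lp.memLp _
  refine hq.of_le (by unfold toFun; exact (by fun_prop : Measurable fun x : ℝ =>
    (1 + (x : ℂ) ^ 2)⁻¹).aestronglyMeasurable.mul hq.1) ?_
  refine Filter.Eventually.of_forall fun x => ?_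
  have h1 : ‖(1 + (x : ℂ) ^ 2)⁻¹‖ ≤ 1 := by
    have h2 : (1 + (x : ℂ) ^ 2) = ((1 + x ^ 2 : ℝ) : ℂ) := by push_cast; ring
    rw [norm_inv, h2, Complex.norm_real, Real.norm_of_nonneg (by positivity)]
    exact inv_le_one_of_one_le₀ (by nlinarith [sq_nonneg x])
  simpa [toFun] using mul_le_mul_of_nonneg_right h1 (norm_nonneg (q.1.fst x))

/-- An element of `H^{2,2}(ℝ)` as an element of `L²(ℝ)`. -/
def toL2 (q : H22) : L2R := q.memLp_toFun.toLp q.toFun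

/-- The second derivative `q''` of an element of `H^{2,2}(ℝ)`, an element of `L²(ℝ)`. -/
def deriv2 (q : H22) : L2R := q.1.snd

end H22

/-- `g` is the weak derivative of `f` on `ℝ`, tested against smooth functions of compact support. -/
def IsWeakDeriv (f g : ℝ → ℂ) : Prop :=
  ∀ φ : ℝ → ℂ, ContDiff ℝ ∞ φ → HasCompactSupport φ →
    ∫ x, f x * deriv φ x = -∫ x, g x * φ x

/-- `u ∈ C(ℝ, H^{2,2}(ℝ))` is a global strong solution of `i u_t + u_xx = i (|u|² u)_x` with
`u(·, 0) = u₀`: the derivative `u_t` exists in `L²(ℝ)` at every time, `(|u|² u)_x` belongs to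
`L²(ℝ)`, and the equation holds in `L²(ℝ)`. -/
structure IsDNLSSolution (u₀ : H22) (u : ℝ → H22) : Prop where
  continuous : Continuous u
  initial : u 0 = u₀
  equation : ∀ t : ℝ, ∃ ut N : L2R,
    HasDerivAt (fun s => (u s).toL2) ut t ∧
    IsWeakDeriv (fun x => ((‖(u t).toFun x‖ ^ 2 : ℝ) : ℂ) * (u t).toFun x) N ∧
    Complex.I • ut + (u t).deriv2 = Complex.I • N

end

open MeasureTheory
open scoped SchwartzMap ContDiff

noncomputable section

/-! ### Algebra of Schwartz functions -/

/-! The derivative in the nonlinearity blocks a direct Picard iteration. It is removed by a gauge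
transformation together with a doubling of the unknowns. Put φ = u exp(-i∫_{-∞}^x |u|²) and ψ = φ_x
+ (i/2)|φ|²φ. Then DNLS becomes φ_t = iφ_xx - φ²ψ̄, ψ_t = iψ_xx + ψ²φ̄, whose nonlinearity is a
product. Since `H22` is an algebra on which the free Schrödinger group acts with polynomially
growing norm, undoing the free evolution leaves an ordinary differential equation with a field that
is Lipschitz on bounded sets.

Global existence (`exists_system`) comes from a priori bounds. The relation φ_x = ψ - (i/2)|φ|²φ is
propagated, because its defect satisfies a linear homogeneous equation (`re_inner_defect`). On this
constraint ‖φ‖², ∫ψ̄_x φ and `energy` are conserved. For small data they bound φ and ψ in H¹ and in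
the sup norm (`lowBound_of_energy`). The cubic terms are linear in the `H22` norm with coefficients
depending on these low norms only (`norm_cub_le`), so Gronwall's inequality excludes blow-up.

For general φ in `H22` the function ψ has one derivative and one moment too few to lie in `H22`. The
system is therefore solved for Schwartz data only. Two solutions are compared in norms that ask of ψ
just what φ in `H22` supplies; the constraint then recovers φ_xx and xφ_x from ψ. The resulting
estimate (`IsFlow.norm_sub_le`) is Lipschitz in the `H22` norm of the data of φ alone. The gauge
maps are Lipschitz on bounded sets, so the estimate passes to u, and the flow extends by density to
a ball of `H22` (`exists_flow`).

Uniqueness needs no gauge. In the L² energy identity for the difference of two solutions the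
derivatives of the difference integrate away (`re_inner_dnlsRate_sub`), and Gronwall's inequality
applies again. -/

instance schwartzMul : Mul 𝓢(ℝ, ℂ) :=
  ⟨fun f g => SchwartzMap.pairing (ContinuousLinearMap.mul ℂ ℂ) f g⟩

instance schwartzStar : Star 𝓢(ℝ, ℂ) :=
  ⟨fun f => SchwartzMap.postcompCLM (Complex.conjCLE : ℂ →L[ℝ] ℂ) f⟩

namespace Sch

/-- Differentiation of Schwartz functions. -/
def D : 𝓢(ℝ, ℂ) →L[ℂ] 𝓢(ℝ, ℂ) := SchwartzMap.derivCLM ℂ ℂ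

/-- Multiplication of Schwartz functions by the coordinate. -/
def X : 𝓢(ℝ, ℂ) →L[ℂ] 𝓢(ℝ, ℂ) := SchwartzMap.smulLeftCLM ℂ (fun x : ℝ => (x : ℂ))

/-- The embedding of Schwartz functions into `L²`. -/
def toL2 : 𝓢(ℝ, ℂ) →L[ℂ] L2R := SchwartzMap.toLpCLM ℂ ℂ 2 (volume : Measure ℝ)

/-- The integral of a Schwartz function. -/
def int : 𝓢(ℝ, ℂ) →L[ℂ] ℂ := SchwartzMap.integralCLM ℂ (volume : Measure ℝ)

@[simp] theorem mul_apply (f g : 𝓢(ℝ, ℂ)) (x : ℝ) : (f * g) x = f x * g x := rfl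

@[simp] theorem star_apply (f : 𝓢(ℝ, ℂ)) (x : ℝ) : (star f) x = star (f x) := rfl

theorem D_apply (f : 𝓢(ℝ, ℂ)) (x : ℝ) : D f x = deriv f x := rfl

theorem hasDerivAt (f : 𝓢(ℝ, ℂ)) (x : ℝ) : HasDerivAt f (D f x) x := f.hasDerivAt x

theorem hasTemperateGrowth_ofReal : Function.HasTemperateGrowth (fun x : ℝ => (x : ℂ)) :=
  Complex.ofRealCLM.hasTemperateGrowth

@[simp] theorem X_apply (f : 𝓢(ℝ, ℂ)) (x : ℝ) : X f x = (x : ℂ) * f x := by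
  simp [X, SchwartzMap.smulLeftCLM_apply_apply hasTemperateGrowth_ofReal]

@[simp] theorem D_mul (f g : 𝓢(ℝ, ℂ)) : D (f * g) = D f * g + f * D g := by
  ext x
  exact ((hasDerivAt f x).mul (hasDerivAt g x)).deriv

@[simp] theorem D_star (f : 𝓢(ℝ, ℂ)) : D (star f) = star (D f) := by
  ext x
  exact ((hasDerivAt f x).star).deriv

@[simp] theorem D_X (f : 𝓢(ℝ, ℂ)) : D (X f) = f + X (D f) := by
  ext x
  have h : HasDerivAt (fun x : ℝ => (x : ℂ) * f x) (1 * f x + (x : ℂ) * D f x) x :=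
    (Complex.ofRealCLM.hasDerivAt (x := x)).mul (hasDerivAt f x)
  have h2 : (X f : ℝ → ℂ) = fun x : ℝ => (x : ℂ) * f x := by ext y; simp
  rw [D_apply, h2, h.deriv]
  simp

theorem int_apply (f : 𝓢(ℝ, ℂ)) : int f = ∫ x, f x := rfl

@[simp] theorem int_D (f : 𝓢(ℝ, ℂ)) : int (D f) = 0 := by
  rw [int_apply]
  exact integral_eq_zero_of_hasDerivAt_of_integrable (fun x => hasDerivAt f x)
    (D f).integrable f.integrable

theorem coeFn_toL2 (f : 𝓢(ℝ, ℂ)) : (toL2 f : ℝ → ℂ) =ᵐ[volume] f := f.coeFn_toLp 2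

theorem inner_toL2 (f g : 𝓢(ℝ, ℂ)) : inner ℂ (toL2 f) (toL2 g) = int (star f * g) := by
  refine (SchwartzMap.inner_toL2_toL2_eq f g).trans ?_
  rw [int_apply]
  congr 1
  ext x
  simp [mul_comm]

theorem denseRange_toL2 : DenseRange toL2 :=
  SchwartzMap.denseRange_toLpCLM (E := ℝ) (F := ℂ) (p := 2) (by simp)

theorem norm_toL2_le {f g : 𝓢(ℝ, ℂ)} (h : ∀ x, ‖f x‖ ≤ ‖g x‖) : ‖toL2 f‖ ≤ ‖toL2 g‖ := by
  apply Lp.norm_le_norm_of_ae_le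
  filter_upwards [coeFn_toL2 f, coeFn_toL2 g] with x hf hg
  rw [hf, hg]
  exact h x

theorem norm_toL2_star (f : 𝓢(ℝ, ℂ)) : ‖toL2 (star f)‖ = ‖toL2 f‖ :=
  le_antisymm (norm_toL2_le fun x => by simp) (norm_toL2_le fun x => by simp)

theorem norm_sq_toL2 (f : 𝓢(ℝ, ℂ)) : ((‖toL2 f‖ ^ 2 : ℝ) : ℂ) = int (star f * f) := by
  rw [← inner_toL2, inner_self_eq_norm_sq_to_K]
  simp

theorem norm_int_mul_le (f g : 𝓢(ℝ, ℂ)) : ‖int (f * g)‖ ≤ ‖toL2 f‖ * ‖toL2 g‖ := by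
  have h := norm_inner_le_norm (𝕜 := ℂ) (toL2 (star f)) (toL2 g)
  rw [inner_toL2, norm_toL2_star] at h
  have e : star (star f) = f := by ext x; simp
  rwa [e] at h

/-- Integration by parts and the Cauchy–Schwarz inequality. -/
theorem norm_D_sq_le (f : 𝓢(ℝ, ℂ)) : ‖toL2 (D f)‖ ^ 2 ≤ ‖toL2 f‖ * ‖toL2 (D (D f))‖ := by
  have h1 : int (star (D f) * D f) = -int (star f * D (D f)) := by
    rw [eq_neg_iff_add_eq_zero, ← map_add, ← int_D (star f * D f)]
    congr 1
    ext x
    simp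
  have h2 : ‖((‖toL2 (D f)‖ ^ 2 : ℝ) : ℂ)‖ ≤ ‖toL2 f‖ * ‖toL2 (D (D f))‖ := by
    rw [norm_sq_toL2, h1, norm_neg, ← norm_toL2_star f]
    exact norm_int_mul_le _ _
  rwa [Complex.norm_real, Real.norm_of_nonneg (by positivity)] at h2

/-- The integral of (x² f̄ f')' vanishes; its three terms are |xf'|², 2 f̄ · xf' and x² f̄ · f''.
The unknown ‖xf'‖ stays on the right to first order and is absorbed in `norm_mom1jet1_of_le`. -/
theorem norm_X_D_sq_le (f : 𝓢(ℝ, ℂ)) : ‖toL2 (X (D f))‖ ^ 2 ≤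
    2 * (‖toL2 f‖ * ‖toL2 (X (D f))‖) + ‖toL2 (X (X f))‖ * ‖toL2 (D (D f))‖ := by
  have h1 : int (star (X (D f)) * X (D f)) =
      -((2 : ℂ) * int (star f * X (D f)) + int (star (X (X f)) * D (D f))) := by
    have h : D (star (X (X f)) * D f) = star (X (D f)) * X (D f) +
        ((2 : ℂ) • (star f * X (D f)) + star (X (X f)) * D (D f)) := by
      ext x
      simp
      ring
    have h' := int_D (star (X (X f)) * D f)
    rw [h, map_add, map_add, int.map_smul, smul_eq_mul] at h'
    exact eq_neg_of_add_eq_zero_left h'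
  have h2 : ‖((‖toL2 (X (D f))‖ ^ 2 : ℝ) : ℂ)‖ ≤
      2 * (‖toL2 f‖ * ‖toL2 (X (D f))‖) + ‖toL2 (X (X f))‖ * ‖toL2 (D (D f))‖ := by
    rw [norm_sq_toL2, h1, norm_neg, ← norm_toL2_star f, ← norm_toL2_star (X (X f))]
    refine (norm_add_le _ _).trans (add_le_add ?_ (norm_int_mul_le _ _))
    rw [norm_mul]
    simpa using norm_int_mul_le (star f) (X (D f))
  rwa [Complex.norm_real, Real.norm_of_nonneg (by positivity)] at h2

/-- Agmon's inequality: |f(x)|² is the integral of (|f|²)' over (-∞, x], and |(|f|²)'| ≤ 2|f||f'|.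
-/
theorem norm_apply_sq_le (f : 𝓢(ℝ, ℂ)) (x : ℝ) :
    ‖f x‖ ^ 2 ≤ 2 * (‖toL2 f‖ * ‖toL2 (D f)‖) := by
  have hd : ∀ y, HasDerivAt (star f * f : 𝓢(ℝ, ℂ)) (D (star f * f) y) y := hasDerivAt _
  have h0 : Filter.Tendsto (star f * f : 𝓢(ℝ, ℂ)) Filter.atBot (nhds 0) :=
    ((star f * f).tendsto_cocompact).mono_left atBot_le_cocompact
  have h1 : ∫ y in Set.Iic x, D (star f * f) y = (star f * f) x := by
    rw [integral_Iic_of_hasDerivAt_of_tendsto' (fun y _ => hd y)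
      (D (star f * f)).integrable.integrableOn h0, sub_zero]
  have hF : MemLp (fun y => ‖f y‖) 2 (volume : Measure ℝ) := (f.memLp 2).norm
  have hG : MemLp (fun y => ‖D f y‖) 2 (volume : Measure ℝ) := ((D f).memLp 2).norm
  have hi : Integrable (fun y => ‖f y‖ * ‖D f y‖) := hF.integrable_mul hG
  have h2 : ∫ y, ‖f y‖ * ‖D f y‖ ≤ ‖toL2 f‖ * ‖toL2 (D f)‖ := by
    have := integral_mul_norm_le_Lp_mul_Lq (μ := (volume : Measure ℝ)) (f := f) (g := D f)
      (p := 2) (q := 2) (by constructor <;> norm_num) (by simpa using f.memLp 2)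
      (by simpa using (D f).memLp 2)
    refine this.trans (le_of_eq ?_)
    have e : ∀ g : 𝓢(ℝ, ℂ), ‖toL2 g‖ = (∫ a, ‖g a‖ ^ (2 : ℝ)) ^ (1 / (2 : ℝ)) := fun g => by
      have := SchwartzMap.norm_toLp' (f := g) (p := 2) (μ := (volume : Measure ℝ))
        (by simp) (by simp)
      simpa [toL2] using this
    rw [e, e]
  have h3 : ‖f x‖ ^ 2 = ‖(star f * f) x‖ := by simp [sq]
  rw [h3, ← h1]
  calc ‖∫ y in Set.Iic x, D (star f * f) y‖ ≤ ∫ y in Set.Iic x, ‖D (star f * f) y‖ :=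
        norm_integral_le_integral_norm _
    _ ≤ ∫ y, ‖D (star f * f) y‖ :=
        setIntegral_le_integral (D (star f * f)).integrable.norm
          (Filter.Eventually.of_forall fun y => norm_nonneg _)
    _ ≤ ∫ y, 2 * (‖f y‖ * ‖D f y‖) := by
        refine integral_mono (D (star f * f)).integrable.norm (hi.const_mul 2) fun y => ?_
        rw [D_mul, D_star]
        refine (norm_add_le _ _).trans (le_of_eq ?_)
        simp
        ring
    _ ≤ 2 * (‖toL2 f‖ * ‖toL2 (D f)‖) := by
        rw [integral_const_mul]
        linarith

end Sch
end

open MeasureTheory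
open scoped SchwartzMap ContDiff

noncomputable section

open scoped BoundedContinuousFunction

/-! ### The space `H^{2,2}` as a completion of the Schwartz space -/

namespace H22

instance : CompleteSpace H22 :=
  IsClosed.completeSpace_coe (s := (H22Submodule : Set (WithLp 1 (L2R × L2R))))
    (hs := (LinearMap.range weightedJet).isClosed_topologicalClosure)

/-- A Schwartz function as an element of `H^{2,2}`. -/
def of : 𝓢(ℝ, ℂ) →ₗ[ℂ] H22 :=
  weightedJet.codRestrict H22Submodule fun f =>
    Submodule.le_topologicalClosure _ (LinearMap.mem_range_self _ f)

theorem denseRange_of : DenseRange of := by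
  intro q
  rw [Topology.IsInducing.subtypeVal.closure_eq_preimage_closure_image]
  have h : (Subtype.val '' Set.range of) = (LinearMap.range weightedJet : Set _) := by
    ext y
    constructor
    · rintro ⟨_, ⟨f, rfl⟩, rfl⟩
      exact ⟨f, rfl⟩
    · rintro ⟨f, rfl⟩
      exact ⟨of f, ⟨f, rfl⟩, rfl⟩
  rw [Set.mem_preimage]
  exact h ▸ q.2

theorem norm_eq (q : H22) : ‖q‖ = ‖q.1.fst‖ + ‖q.1.snd‖ :=
  WithLp.prod_norm_eq_of_L1 q.1

theorem of_fst (f : 𝓢(ℝ, ℂ)) : (of f).1.fst = Sch.toL2 (f + Sch.X (Sch.X f)) := by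
  have hg : Function.HasTemperateGrowth (fun x : ℝ => (1 + (x : ℂ) ^ 2)) := by
    have h := Sch.hasTemperateGrowth_ofReal
    fun_prop
  change Sch.toL2 (SchwartzMap.smulLeftCLM ℂ (fun x : ℝ => (1 + (x : ℂ) ^ 2)) f) = _
  congr 1
  ext x
  simp [SchwartzMap.smulLeftCLM_apply_apply hg]
  ring

theorem of_snd (f : 𝓢(ℝ, ℂ)) : (of f).1.snd = Sch.toL2 (Sch.D (Sch.D f)) := rfl

theorem norm_of (f : 𝓢(ℝ, ℂ)) :
    ‖of f‖ = ‖Sch.toL2 (f + Sch.X (Sch.X f))‖ + ‖Sch.toL2 (Sch.D (Sch.D f))‖ := by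
  rw [norm_eq, of_fst, of_snd]

theorem norm_one_add_sq (x : ℝ) : ‖(1 + (x : ℂ) ^ 2)‖ = 1 + x ^ 2 := by
  have h2 : (1 + (x : ℂ) ^ 2) = ((1 + x ^ 2 : ℝ) : ℂ) := by push_cast; ring
  rw [h2, Complex.norm_real, Real.norm_of_nonneg (by positivity)]

theorem norm_toL2_le_of_le {f g : 𝓢(ℝ, ℂ)} (h : ∀ x, ‖g x‖ ≤ (1 + x ^ 2) * ‖f x‖) :
    ‖Sch.toL2 g‖ ≤ ‖of f‖ := by
  refine (Sch.norm_toL2_le (g := f + Sch.X (Sch.X f)) fun x => ?_).trans ?_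
  · refine (h x).trans (le_of_eq ?_)
    rw [← norm_one_add_sq, ← norm_mul]
    congr 1
    simp
    ring
  · rw [norm_of]
    exact le_add_of_nonneg_right (norm_nonneg _)

theorem norm_jet0_of_le (f : 𝓢(ℝ, ℂ)) : ‖Sch.toL2 f‖ ≤ ‖of f‖ :=
  norm_toL2_le_of_le fun x => by nlinarith [norm_nonneg (f x), sq_nonneg x]

theorem norm_mom1_of_le (f : 𝓢(ℝ, ℂ)) : ‖Sch.toL2 (Sch.X f)‖ ≤ ‖of f‖ :=
  norm_toL2_le_of_le fun x => by
    have h : |x| ≤ 1 + x ^ 2 := by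
      nlinarith [sq_abs x, sq_nonneg (|x| - 1), abs_nonneg x]
    simpa using mul_le_mul_of_nonneg_right h (norm_nonneg (f x))

theorem norm_mom2_of_le (f : 𝓢(ℝ, ℂ)) : ‖Sch.toL2 (Sch.X (Sch.X f))‖ ≤ ‖of f‖ :=
  norm_toL2_le_of_le fun x => by
    have h : |x| * |x| ≤ 1 + x ^ 2 := by nlinarith [sq_abs x]
    simpa only [Sch.X_apply, norm_mul, Complex.norm_real, Real.norm_eq_abs, mul_assoc] using mul_le_mul_of_nonneg_right h (norm_nonneg (f x))

theorem norm_jet2_of_le (f : 𝓢(ℝ, ℂ)) : ‖Sch.toL2 (Sch.D (Sch.D f))‖ ≤ ‖of f‖ := by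
  rw [norm_of]
  exact le_add_of_nonneg_left (norm_nonneg _)

theorem norm_jet1_of_le (f : 𝓢(ℝ, ℂ)) : ‖Sch.toL2 (Sch.D f)‖ ≤ ‖of f‖ := by
  have h := Sch.norm_D_sq_le f
  have h2 := mul_le_mul (norm_jet0_of_le f) (norm_jet2_of_le f) (norm_nonneg _) (norm_nonneg _)
  exact abs_le_of_sq_le_sq' (by nlinarith) (norm_nonneg _) |>.2

/-- With N = ‖of f‖ and y = ‖xf'‖ the previous bounds give y² ≤ 2Ny + N², hence y ≤ (1 + √2)N. -/
theorem norm_mom1jet1_of_le (f : 𝓢(ℝ, ℂ)) : ‖Sch.toL2 (Sch.X (Sch.D f))‖ ≤ 3 * ‖of f‖ := by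
  have h := Sch.norm_X_D_sq_le f
  have h2 := mul_le_mul (norm_mom2_of_le f) (norm_jet2_of_le f) (norm_nonneg _) (norm_nonneg _)
  have h3 := mul_le_mul_of_nonneg_right (norm_jet0_of_le f) (norm_nonneg (Sch.toL2 (Sch.X (Sch.D f))))
  by_contra! hc
  nlinarith [norm_nonneg (of f), norm_nonneg (Sch.toL2 (Sch.X (Sch.D f)))]

/-- The extension to `H^{2,2}` of a bounded linear map on Schwartz functions. -/
def ext {F : Type*} [NormedAddCommGroup F] [NormedSpace ℂ F] [CompleteSpace F]
    (T : 𝓢(ℝ, ℂ) →ₗ[ℂ] F) : H22 →L[ℂ] F := T.extendOfNorm of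

/-- The definition of `ext` asks for no bound on `T`. The bound enters here, and each concrete
operator below is identified on Schwartz functions through it. -/
theorem ext_of {F : Type*} [NormedAddCommGroup F] [NormedSpace ℂ F] [CompleteSpace F]
    {T : 𝓢(ℝ, ℂ) →ₗ[ℂ] F} {C : ℝ} (h : ∀ f, ‖T f‖ ≤ C * ‖of f‖) (f : 𝓢(ℝ, ℂ)) :
    ext T (of f) = T f :=
  LinearMap.extendOfNorm_eq denseRange_of ⟨C, h⟩ f

/-- The element `q` of `L²`. -/
def jet0 : H22 →L[ℂ] L2R := ext Sch.toL2.toLinearMap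
/-- The element `q'` of `L²`. -/
def jet1 : H22 →L[ℂ] L2R := ext (Sch.toL2.comp Sch.D).toLinearMap
/-- The element `q''` of `L²`. -/
def jet2 : H22 →L[ℂ] L2R := ext (Sch.toL2.comp (Sch.D.comp Sch.D)).toLinearMap
/-- The element `x q` of `L²`. -/
def mom1 : H22 →L[ℂ] L2R := ext (Sch.toL2.comp Sch.X).toLinearMap
/-- The element `x² q` of `L²`. -/
def mom2 : H22 →L[ℂ] L2R := ext (Sch.toL2.comp (Sch.X.comp Sch.X)).toLinearMap
/-- The element `x q'` of `L²`. -/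
def mom1jet1 : H22 →L[ℂ] L2R := ext (Sch.toL2.comp (Sch.X.comp Sch.D)).toLinearMap

variable (f g : 𝓢(ℝ, ℂ))

@[simp] theorem jet0_of : jet0 (of f) = Sch.toL2 f :=
  ext_of (C := 1) (fun f => by simpa using norm_jet0_of_le f) f
@[simp] theorem jet1_of : jet1 (of f) = Sch.toL2 (Sch.D f) :=
  ext_of (C := 1) (fun f => by simpa using norm_jet1_of_le f) f
@[simp] theorem jet2_of : jet2 (of f) = Sch.toL2 (Sch.D (Sch.D f)) :=
  ext_of (C := 1) (fun f => by simpa using norm_jet2_of_le f) f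
@[simp] theorem mom1_of : mom1 (of f) = Sch.toL2 (Sch.X f) :=
  ext_of (C := 1) (fun f => by simpa using norm_mom1_of_le f) f
@[simp] theorem mom2_of : mom2 (of f) = Sch.toL2 (Sch.X (Sch.X f)) :=
  ext_of (C := 1) (fun f => by simpa using norm_mom2_of_le f) f
@[simp] theorem mom1jet1_of : mom1jet1 (of f) = Sch.toL2 (Sch.X (Sch.D f)) :=
  ext_of (C := 3) (fun f => norm_mom1jet1_of_le f) f

/-- The bounded continuous function underlying a Schwartz function. -/
def _root_.Sch.toB : 𝓢(ℝ, ℂ) →L[ℂ] (ℝ →ᵇ ℂ) :=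
  SchwartzMap.toBoundedContinuousFunctionCLM ℂ ℝ ℂ

@[simp] theorem _root_.Sch.toB_apply (f : 𝓢(ℝ, ℂ)) (x : ℝ) : Sch.toB f x = f x := rfl

theorem _root_.Sch.norm_toB_sq_le (f : 𝓢(ℝ, ℂ)) :
    ‖Sch.toB f‖ ^ 2 ≤ 2 * (‖Sch.toL2 f‖ * ‖Sch.toL2 (Sch.D f)‖) := by
  have h : ‖Sch.toB f‖ ≤ √(2 * (‖Sch.toL2 f‖ * ‖Sch.toL2 (Sch.D f)‖)) :=
    (BoundedContinuousFunction.norm_le (Real.sqrt_nonneg _)).2 fun x =>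
      Real.le_sqrt_of_sq_le (Sch.norm_apply_sq_le f x)
  calc ‖Sch.toB f‖ ^ 2 ≤ √(2 * (‖Sch.toL2 f‖ * ‖Sch.toL2 (Sch.D f)‖)) ^ 2 := by gcongr
    _ = _ := Real.sq_sqrt (by positivity)

theorem norm_bdd0_of_le : ‖Sch.toB f‖ ≤ 2 * ‖of f‖ := by
  have h := Sch.norm_toB_sq_le f
  have h2 := mul_le_mul (norm_jet0_of_le f) (norm_jet1_of_le f) (norm_nonneg _) (norm_nonneg _)
  exact abs_le_of_sq_le_sq' (by nlinarith [norm_nonneg (of f)]) (by positivity) |>.2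

theorem norm_bdd1_of_le : ‖Sch.toB (Sch.D f)‖ ≤ 2 * ‖of f‖ := by
  have h := Sch.norm_toB_sq_le (Sch.D f)
  have h2 := mul_le_mul (norm_jet1_of_le f) (norm_jet2_of_le f) (norm_nonneg _) (norm_nonneg _)
  exact abs_le_of_sq_le_sq' (by nlinarith [norm_nonneg (of f)]) (by positivity) |>.2

/-- The bounded continuous function `q`. -/
def bdd0 : H22 →L[ℂ] (ℝ →ᵇ ℂ) := ext Sch.toB.toLinearMap
/-- The bounded continuous function `q'`. -/
def bdd1 : H22 →L[ℂ] (ℝ →ᵇ ℂ) := ext (Sch.toB.comp Sch.D).toLinearMap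

@[simp] theorem bdd0_of : bdd0 (of f) = Sch.toB f :=
  ext_of (C := 2) (fun f => norm_bdd0_of_le f) f
@[simp] theorem bdd1_of : bdd1 (of f) = Sch.toB (Sch.D f) :=
  ext_of (C := 2) (fun f => norm_bdd1_of_le f) f

/-- Closed properties of elements of `H^{2,2}` follow from the case of Schwartz functions. -/
theorem eq_of_schwartz {Y : Type*} [TopologicalSpace Y] [T2Space Y] {F G : H22 → Y}
    (hF : Continuous F) (hG : Continuous G) (h : ∀ f, F (of f) = G (of f)) :
    ∀ a, F a = G a := fun a =>
  denseRange_of.induction_on (p := fun a => F a = G a) a (isClosed_eq hF hG) h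

theorem eq_of_schwartz₂ {Y : Type*} [TopologicalSpace Y] [T2Space Y] {F G : H22 → H22 → Y}
    (hF : Continuous fun p : H22 × H22 => F p.1 p.2)
    (hG : Continuous fun p : H22 × H22 => G p.1 p.2)
    (h : ∀ f g, F (of f) (of g) = G (of f) (of g)) : ∀ a b, F a b = G a b := fun a b =>
  denseRange_of.induction_on₂ (p := fun a b => F a b = G a b) (isClosed_eq hF hG) h a b

theorem eq_of_schwartz₃ {Y : Type*} [TopologicalSpace Y] [T2Space Y] {F G : H22 → H22 → H22 → Y}
    (hF : Continuous fun p : H22 × H22 × H22 => F p.1 p.2.1 p.2.2)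
    (hG : Continuous fun p : H22 × H22 × H22 => G p.1 p.2.1 p.2.2)
    (h : ∀ f g k, F (of f) (of g) (of k) = G (of f) (of g) (of k)) :
    ∀ a b c, F a b c = G a b c := fun a b c =>
  denseRange_of.induction_on₃ (p := fun a b c => F a b c = G a b c) (isClosed_eq hF hG) h a b c

theorem le_of_schwartz {F G : H22 → ℝ} (hF : Continuous F) (hG : Continuous G)
    (h : ∀ f, F (of f) ≤ G (of f)) : ∀ a, F a ≤ G a := fun a =>
  denseRange_of.induction_on (p := fun a => F a ≤ G a) a (isClosed_le hF hG) h

theorem fst_eq : ∀ q : H22, q.1.fst = jet0 q + mom2 q := by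
  refine eq_of_schwartz ?_ (by fun_prop) fun f => ?_
  · exact continuous_fst.comp ((WithLp.prod_continuous_ofLp 1 _ _).comp continuous_subtype_val)
  · rw [of_fst, jet0_of, mom2_of, map_add]

theorem snd_eq : ∀ q : H22, q.1.snd = jet2 q := by
  refine eq_of_schwartz ?_ (by fun_prop) fun f => ?_
  · exact continuous_snd.comp ((WithLp.prod_continuous_ofLp 1 _ _).comp continuous_subtype_val)
  · rw [of_snd, jet2_of]

theorem norm_le (q : H22) : ‖q‖ ≤ ‖jet0 q‖ + ‖mom2 q‖ + ‖jet2 q‖ := by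
  rw [norm_eq, fst_eq, snd_eq]
  gcongr
  exact norm_add_le _ _

theorem norm_jet0_le : ∀ q, ‖jet0 q‖ ≤ ‖q‖ :=
  le_of_schwartz (by fun_prop) (by fun_prop) (fun f => by simpa using norm_jet0_of_le f)
theorem norm_jet1_le : ∀ q, ‖jet1 q‖ ≤ ‖q‖ :=
  le_of_schwartz (by fun_prop) (by fun_prop) (fun f => by simpa using norm_jet1_of_le f)
theorem norm_jet2_le : ∀ q, ‖jet2 q‖ ≤ ‖q‖ :=
  le_of_schwartz (by fun_prop) (by fun_prop) (fun f => by simpa using norm_jet2_of_le f)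
theorem norm_mom1_le : ∀ q, ‖mom1 q‖ ≤ ‖q‖ :=
  le_of_schwartz (by fun_prop) (by fun_prop) (fun f => by simpa using norm_mom1_of_le f)
theorem norm_mom2_le : ∀ q, ‖mom2 q‖ ≤ ‖q‖ :=
  le_of_schwartz (by fun_prop) (by fun_prop) (fun f => by simpa using norm_mom2_of_le f)
theorem norm_bdd0_le : ∀ q, ‖bdd0 q‖ ≤ 2 * ‖q‖ :=
  le_of_schwartz (by fun_prop) (by fun_prop) (fun f => by simpa using norm_bdd0_of_le f)
theorem norm_bdd1_le : ∀ q, ‖bdd1 q‖ ≤ 2 * ‖q‖ :=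
  le_of_schwartz (by fun_prop) (by fun_prop) (fun f => by simpa using norm_bdd1_of_le f)

theorem norm_bdd0_sq_le : ∀ q, ‖bdd0 q‖ ^ 2 ≤ 2 * (‖jet0 q‖ * ‖jet1 q‖) :=
  le_of_schwartz (by fun_prop) (by fun_prop)
    (fun f => by simpa using Sch.norm_toB_sq_le f)

end H22
end

open MeasureTheory
open scoped SchwartzMap ContDiff

noncomputable section

open scoped BoundedContinuousFunction

/-! ### Multiplication by bounded continuous functions and complex conjugation -/

theorem memLp_bcf_mul (b : ℝ →ᵇ ℂ) (g : L2R) :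
    MemLp (fun x => b x * g x) 2 (volume : Measure ℝ) := by
  refine MemLp.of_le_mul (c := ‖b‖) (Lp.memLp g)
    (b.continuous.aestronglyMeasurable.mul (Lp.memLp g).1) (Filter.Eventually.of_forall fun x => ?_)
  rw [norm_mul]
  exact mul_le_mul_of_nonneg_right (b.norm_coe_le_norm x) (norm_nonneg _)

/-- Multiplication of `L²` functions by bounded continuous functions. -/
def bcfMul : (ℝ →ᵇ ℂ) →L[ℂ] L2R →L[ℂ] L2R :=
  LinearMap.mkContinuous₂
    (LinearMap.mk₂ ℂ (fun (b : ℝ →ᵇ ℂ) (g : L2R) => (memLp_bcf_mul b g).toLp _)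
      (fun b c g => by
        rw [← MemLp.toLp_add, MemLp.toLp_eq_toLp_iff]
        exact Filter.Eventually.of_forall fun x => by simp [add_mul])
      (fun c b g => by
        rw [← MemLp.toLp_const_smul, MemLp.toLp_eq_toLp_iff]
        exact Filter.Eventually.of_forall fun x => by simp [mul_assoc])
      (fun b g k => by
        rw [← MemLp.toLp_add, MemLp.toLp_eq_toLp_iff]
        filter_upwards [Lp.coeFn_add g k] with x hx
        change b x * (g + k : L2R) x = b x * g x + b x * k x
        rw [hx, Pi.add_apply, mul_add])
      (fun c b g => by
        rw [← MemLp.toLp_const_smul, MemLp.toLp_eq_toLp_iff]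
        filter_upwards [Lp.coeFn_smul c g] with x hx
        change b x * (c • g : L2R) x = c * (b x * g x)
        rw [hx, Pi.smul_apply, smul_eq_mul]
        ring))
    1 (fun b g => by
      rw [one_mul]
      refine Lp.norm_le_mul_norm_of_ae_le_mul ?_
      filter_upwards [(memLp_bcf_mul b g).coeFn_toLp] with x hx
      simp only [LinearMap.mk₂_apply]
      rw [hx, norm_mul]
      exact mul_le_mul_of_nonneg_right (b.norm_coe_le_norm x) (norm_nonneg _))

theorem coeFn_bcfMul (b : ℝ →ᵇ ℂ) (g : L2R) :
    (bcfMul b g : ℝ → ℂ) =ᵐ[volume] fun x => b x * g x :=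
  (memLp_bcf_mul b g).coeFn_toLp

theorem norm_bcfMul_le (b : ℝ →ᵇ ℂ) (g : L2R) : ‖bcfMul b g‖ ≤ ‖b‖ * ‖g‖ := by
  refine Lp.norm_le_mul_norm_of_ae_le_mul ?_
  filter_upwards [coeFn_bcfMul b g] with x hx
  rw [hx, norm_mul]
  exact mul_le_mul_of_nonneg_right (b.norm_coe_le_norm x) (norm_nonneg _)

@[simp] theorem bcfMul_mul (a b : ℝ →ᵇ ℂ) (g : L2R) :
    bcfMul (a * b) g = bcfMul a (bcfMul b g) := by
  apply Lp.ext
  filter_upwards [coeFn_bcfMul (a * b) g, coeFn_bcfMul a (bcfMul b g), coeFn_bcfMul b g]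
    with x h1 h2 h3
  rw [h1, h2, h3]
  simp [mul_assoc]

/-- Complex conjugation on `L²`. -/
def conjL2 : L2R →L[ℝ] L2R := (Complex.conjCLE : ℂ →L[ℝ] ℂ).compLpL 2 volume

theorem coeFn_conjL2 (g : L2R) : (conjL2 g : ℝ → ℂ) =ᵐ[volume] fun x => star (g x) :=
  ContinuousLinearMap.coeFn_compLpL _ g

@[simp] theorem norm_conjL2 (g : L2R) : ‖conjL2 g‖ = ‖g‖ := by
  refine le_antisymm (Lp.norm_le_norm_of_ae_le ?_) (Lp.norm_le_norm_of_ae_le ?_) <;>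
  · filter_upwards [coeFn_conjL2 g] with x hx
    simp [hx]

@[simp] theorem conjL2_toL2 (f : 𝓢(ℝ, ℂ)) : conjL2 (Sch.toL2 f) = Sch.toL2 (star f) := by
  apply Lp.ext
  filter_upwards [coeFn_conjL2 (Sch.toL2 f), Sch.coeFn_toL2 f, Sch.coeFn_toL2 (star f)]
    with x h1 h2 h3
  rw [h1, h2, h3]
  rfl

@[simp] theorem bcfMul_toB (f g : 𝓢(ℝ, ℂ)) :
    bcfMul (Sch.toB f) (Sch.toL2 g) = Sch.toL2 (f * g) := by
  apply Lp.ext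
  filter_upwards [coeFn_bcfMul (Sch.toB f) (Sch.toL2 g), Sch.coeFn_toL2 g, Sch.coeFn_toL2 (f * g)]
    with x h1 h2 h3
  rw [h1, h2, h3]
  rfl

@[simp] theorem Sch.toB_mul (f g : 𝓢(ℝ, ℂ)) : Sch.toB f * Sch.toB g = Sch.toB (f * g) := rfl

@[simp] theorem Sch.star_toB (f : 𝓢(ℝ, ℂ)) : star (Sch.toB f) = Sch.toB (star f) := rfl

@[fun_prop]
theorem Continuous.bcfMul {Z : Type*} [TopologicalSpace Z] {b : Z → ℝ →ᵇ ℂ} {g : Z → L2R}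
    (hb : Continuous b) (hg : Continuous g) : Continuous fun z => bcfMul (b z) (g z) :=
  (_root_.bcfMul.continuous.comp hb).clm_apply hg

/-! ### Products and conjugates in `H^{2,2}` -/

namespace H22

/-- The pair `((1 + x²) q, q'')` with given components. -/
def pair : L2R × L2R →L[ℂ] WithLp 1 (L2R × L2R) :=
  (WithLp.prodContinuousLinearEquiv 1 ℂ L2R L2R).symm.toContinuousLinearMap

theorem pair_of (f : 𝓢(ℝ, ℂ)) :
    pair (Sch.toL2 f + Sch.toL2 (Sch.X (Sch.X f)), Sch.toL2 (Sch.D (Sch.D f))) = (of f).1 := by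
  rw [← map_add, ← of_fst, ← of_snd]
  rfl

theorem eq_iff_jet {q r : H22} :
    q = r ↔ jet0 q = jet0 r ∧ mom2 q = mom2 r ∧ jet2 q = jet2 r := by
  refine ⟨fun h => by simp [h], fun ⟨h0, h1, h2⟩ => ?_⟩
  have h := norm_le (q - r)
  simp only [map_sub, h0, h1, h2, sub_self, norm_zero, add_zero] at h
  exact sub_eq_zero.1 (norm_le_zero_iff.1 h)

theorem isClosed_submodule : IsClosed (H22Submodule : Set (WithLp 1 (L2R × L2R))) :=
  (LinearMap.range weightedJet).isClosed_topologicalClosure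

theorem conj_mem (q : H22) : pair (conjL2 q.1.fst, conjL2 q.1.snd) ∈ H22Submodule := by
  have hc : Continuous fun q : H22 => pair (conjL2 q.1.fst, conjL2 q.1.snd) := by
    simp only [fst_eq, snd_eq]
    fun_prop
  refine denseRange_of.induction_on (p := fun q : H22 =>
    pair (conjL2 q.1.fst, conjL2 q.1.snd) ∈ H22Submodule) q (isClosed_submodule.preimage hc) ?_
  intro f
  rw [of_fst, of_snd, conjL2_toL2, conjL2_toL2]
  convert (of (star f)).2 using 1
  rw [← pair_of, ← map_add]
  congr 4
  · ext x
    simp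
  · simp

/-- Complex conjugation on `H^{2,2}`. -/
def conj (q : H22) : H22 := ⟨_, conj_mem q⟩

theorem conj_sub (q r : H22) : conj (q - r) = conj q - conj r := by
  apply Subtype.ext
  change pair (conjL2 (q.1.fst - r.1.fst), conjL2 (q.1.snd - r.1.snd)) =
    pair (conjL2 q.1.fst, conjL2 q.1.snd) - pair (conjL2 r.1.fst, conjL2 r.1.snd)
  rw [← map_sub, map_sub, map_sub]
  rfl

@[simp] theorem conj_zero : conj 0 = 0 := by
  have := conj_sub 0 0
  simpa using this

@[simp] theorem norm_conj (q : H22) : ‖conj q‖ = ‖q‖ := by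
  rw [norm_eq, norm_eq]
  change ‖conjL2 q.1.fst‖ + ‖conjL2 q.1.snd‖ = _
  simp

@[fun_prop]
theorem continuous_conj : Continuous conj := by
  refine (LipschitzWith.of_dist_le_mul (K := 1) fun q r => ?_).continuous
  rw [dist_eq_norm, dist_eq_norm, ← conj_sub, norm_conj]
  simp

@[simp] theorem conj_of (f : 𝓢(ℝ, ℂ)) : conj (of f) = of (star f) := by
  apply Subtype.ext
  rw [← pair_of]
  change pair (conjL2 (of f).1.fst, conjL2 (of f).1.snd) = _
  rw [of_fst, of_snd, conjL2_toL2, conjL2_toL2, ← map_add]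
  congr 3
  · ext x
    simp
  · simp

@[simp] theorem jet0_conj : ∀ q, jet0 (conj q) = conjL2 (jet0 q) :=
  eq_of_schwartz (by fun_prop) (by fun_prop) fun f => by simp
@[simp] theorem jet1_conj : ∀ q, jet1 (conj q) = conjL2 (jet1 q) :=
  eq_of_schwartz (by fun_prop) (by fun_prop) fun f => by simp
@[simp] theorem bdd0_conj : ∀ q, bdd0 (conj q) = star (bdd0 q) :=
  eq_of_schwartz (by fun_prop) (by fun_prop) fun f => by simp

/-- The pair of `L²` functions representing the product of two elements of `H^{2,2}`. -/
def mulPair (a b : H22) : WithLp 1 (L2R × L2R) :=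
  pair (bcfMul (bdd0 a) (jet0 b + mom2 b),
    bcfMul (bdd0 a) (jet2 b) + (2 : ℂ) • bcfMul (bdd1 a) (jet1 b) + bcfMul (bdd0 b) (jet2 a))

@[fun_prop]
theorem continuous_mulPair : Continuous fun p : H22 × H22 => mulPair p.1 p.2 := by
  unfold mulPair
  fun_prop

theorem mulPair_of (f g : 𝓢(ℝ, ℂ)) : mulPair (of f) (of g) = (of (f * g)).1 := by
  rw [← pair_of, mulPair]
  simp only [bdd0_of, bdd1_of, jet0_of, jet1_of, jet2_of, mom2_of, ← map_add, bcfMul_toB,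
    ← Sch.toL2.map_smul]
  congr 4 <;> ext x <;> simp <;> ring

theorem mulPair_mem (a b : H22) : mulPair a b ∈ H22Submodule := by
  refine denseRange_of.induction_on₂ (p := fun a b => mulPair a b ∈ H22Submodule)
    (isClosed_submodule.preimage continuous_mulPair) (fun f g => ?_) a b
  rw [mulPair_of]
  exact (of (f * g)).2

/-- By Leibniz, every term pairs a sup norm of q or q' (at most 2‖q‖) with an L² norm; the terms sum
to 4 + 2 + 4 + 2 = 12. -/
theorem norm_mulPair_le (a b : H22) : ‖mulPair a b‖ ≤ 16 * ‖a‖ * ‖b‖ := by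
  have e : ‖mulPair a b‖ = ‖bcfMul (bdd0 a) (jet0 b + mom2 b)‖ + ‖bcfMul (bdd0 a) (jet2 b) +
      (2 : ℂ) • bcfMul (bdd1 a) (jet1 b) + bcfMul (bdd0 b) (jet2 a)‖ :=
    WithLp.prod_norm_eq_of_L1 _
  have key : ∀ {u : ℝ →ᵇ ℂ} {v : L2R} {s t : ℝ}, ‖u‖ ≤ 2 * s → ‖v‖ ≤ t → 0 ≤ s →
      ‖bcfMul u v‖ ≤ 2 * s * t := fun hu hv hs =>
    (norm_bcfMul_le _ _).trans (mul_le_mul hu hv (norm_nonneg _) (by positivity))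
  have h1 := key (norm_bdd0_le a) ((norm_add_le _ _).trans
    (add_le_add (norm_jet0_le b) (norm_mom2_le b))) (norm_nonneg a)
  have h2 := key (norm_bdd0_le a) (norm_jet2_le b) (norm_nonneg a)
  have h3 := key (norm_bdd1_le a) (norm_jet1_le b) (norm_nonneg a)
  have h4 := key (norm_bdd0_le b) (norm_jet2_le a) (norm_nonneg b)
  have h5 : ‖(2 : ℂ) • bcfMul (bdd1 a) (jet1 b)‖ = 2 * ‖bcfMul (bdd1 a) (jet1 b)‖ := by
    simp [norm_smul]
  have h6 := (norm_add₃_le (a := bcfMul (bdd0 a) (jet2 b))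
    (b := (2 : ℂ) • bcfMul (bdd1 a) (jet1 b)) (c := bcfMul (bdd0 b) (jet2 a)))
  have h7 := mul_nonneg (norm_nonneg a) (norm_nonneg b)
  rw [e]
  linarith

/-- The product of two elements of `H^{2,2}`. -/
def mul : H22 →L[ℂ] H22 →L[ℂ] H22 :=
  LinearMap.mkContinuous₂
    (LinearMap.mk₂ ℂ (fun a b : H22 => (⟨mulPair a b, mulPair_mem a b⟩ : H22))
      (fun a a' b => Subtype.ext (by
        change mulPair (a + a') b = mulPair a b + mulPair a' b
        unfold mulPair
        refine Eq.trans (congrArg pair (Prod.ext ?_ ?_)) (map_add pair (_, _) (_, _)) <;>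
        simp only [map_add, add_apply, smul_add, Prod.fst_add, Prod.snd_add] <;>
        abel))
      (fun c a b => Subtype.ext (by
        change mulPair (c • a) b = c • mulPair a b
        unfold mulPair
        refine Eq.trans (congrArg pair (Prod.ext ?_ ?_)) (map_smul pair c (_, _)) <;>
        simp only [map_smul, map_add, smul_apply, smul_add, Prod.smul_fst, Prod.smul_snd] <;>
        simp only [smul_comm c (2 : ℂ)]))
      (fun a b b' => Subtype.ext (by
        change mulPair a (b + b') = mulPair a b + mulPair a b'
        unfold mulPair
        refine Eq.trans (congrArg pair (Prod.ext ?_ ?_)) (map_add pair (_, _) (_, _)) <;>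
        simp only [map_add, add_apply, smul_add, Prod.fst_add, Prod.snd_add] <;>
        abel))
      (fun c a b => Subtype.ext (by
        change mulPair a (c • b) = c • mulPair a b
        unfold mulPair
        refine Eq.trans (congrArg pair (Prod.ext ?_ ?_)) (map_smul pair c (_, _)) <;>
        simp only [map_smul, map_add, smul_apply, smul_add, Prod.smul_fst, Prod.smul_snd] <;>
        simp only [smul_comm c (2 : ℂ)])))
    16 norm_mulPair_le

@[simp] theorem mul_of (f g : 𝓢(ℝ, ℂ)) : mul (of f) (of g) = of (f * g) :=
  Subtype.ext (mulPair_of f g)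

@[fun_prop]
theorem _root_.Continuous.h22mul {Z : Type*} [TopologicalSpace Z] {a b : Z → H22}
    (ha : Continuous a) (hb : Continuous b) : Continuous fun z => mul (a z) (b z) :=
  (mul.continuous.comp ha).clm_apply hb

theorem mul_comm : ∀ a b, mul a b = mul b a :=
  eq_of_schwartz₂ (by fun_prop) (by fun_prop) fun f g => by
    rw [mul_of, mul_of]
    congr 1
    ext x
    simp [_root_.mul_comm]

@[simp] theorem jet0_mul : ∀ a b, jet0 (mul a b) = bcfMul (bdd0 a) (jet0 b) :=
  eq_of_schwartz₂ (by fun_prop) (by fun_prop) fun f g => by simp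
@[simp] theorem bdd0_mul : ∀ a b, bdd0 (mul a b) = bdd0 a * bdd0 b :=
  eq_of_schwartz₂ (by fun_prop) (by fun_prop) fun f g => by simp
@[simp] theorem mom1_mul : ∀ a b, mom1 (mul a b) = bcfMul (bdd0 a) (mom1 b) :=
  eq_of_schwartz₂ (by fun_prop) (by fun_prop) fun f g => by
    simp only [mul_of, mom1_of, bdd0_of, bcfMul_toB]
    congr 1
    ext x
    simp
    ring
@[simp] theorem mom2_mul : ∀ a b, mom2 (mul a b) = bcfMul (bdd0 a) (mom2 b) :=
  eq_of_schwartz₂ (by fun_prop) (by fun_prop) fun f g => by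
    simp only [mul_of, mom2_of, bdd0_of, bcfMul_toB]
    congr 1
    ext x
    simp
    ring
@[simp] theorem jet1_mul : ∀ a b, jet1 (mul a b) =
    bcfMul (bdd0 b) (jet1 a) + bcfMul (bdd0 a) (jet1 b) :=
  eq_of_schwartz₂ (by fun_prop) (by fun_prop) fun f g => by
    simp only [mul_of, jet1_of, bdd0_of, bcfMul_toB, ← map_add]
    congr 1
    ext x
    simp
    ring
@[simp] theorem jet2_mul : ∀ a b, jet2 (mul a b) =
    bcfMul (bdd0 a) (jet2 b) + (2 : ℂ) • bcfMul (bdd1 a) (jet1 b) + bcfMul (bdd0 b) (jet2 a) :=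
  eq_of_schwartz₂ (by fun_prop) (by fun_prop) fun f g => by
    simp only [mul_of, jet2_of, jet1_of, bdd1_of, bdd0_of, bcfMul_toB, ← map_add,
      ← Sch.toL2.map_smul]
    congr 1
    ext x
    simp
    ring
theorem bdd0_jet0_comm : ∀ a b, bcfMul (bdd0 a) (jet0 b) = bcfMul (bdd0 b) (jet0 a) :=
  eq_of_schwartz₂ (by fun_prop) (by fun_prop) fun f g => by
    simp only [jet0_of, bdd0_of, bcfMul_toB]
    congr 1
    ext x
    simp [_root_.mul_comm]
@[simp] theorem mom1_conj : ∀ q, mom1 (conj q) = conjL2 (mom1 q) :=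
  eq_of_schwartz (by fun_prop) (by fun_prop) fun f => by
    simp only [conj_of, mom1_of, conjL2_toL2]
    congr 1
    ext x
    simp

end H22
end

open MeasureTheory
open scoped SchwartzMap ContDiff

noncomputable section

open scoped BoundedContinuousFunction FourierTransform

/-! ### The free Schrödinger group -/

theorem hasTemperateGrowth_cexp_mul_I :
    Function.HasTemperateGrowth (fun s : ℝ => Complex.exp (s * Complex.I)) := by
  have hd : ∀ s : ℝ, HasDerivAt (fun s : ℝ => Complex.exp (s * Complex.I))
      (Complex.I * Complex.exp (s * Complex.I)) s := fun s => by
    have h := (((Complex.ofRealCLM.hasDerivAt (x := s)).mul_const Complex.I).cexp)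
    simpa [mul_comm] using h
  refine ⟨(Complex.ofRealCLM.contDiff.mul contDiff_const).cexp, fun n => ⟨0, 1, fun x => ?_⟩⟩
  rw [norm_iteratedFDeriv_eq_norm_iteratedDeriv]
  have h : ∀ n : ℕ, iteratedDeriv n (fun s : ℝ => Complex.exp (s * Complex.I)) =
      fun s : ℝ => Complex.I ^ n * Complex.exp (s * Complex.I) := by
    intro n
    induction n with
    | zero => simp
    | succ n ih =>
      rw [iteratedDeriv_succ, ih]
      ext s
      rw [((hd s).const_mul _).deriv, pow_succ]
      ring
  rw [h]
  simp [Complex.norm_exp_ofReal_mul_I]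

/-- Taylor's formula for |θ| ≤ 1 and the trivial bound 2 + |θ| otherwise. Being valid for all θ, it
applies to the symbol of the free group at every frequency. -/
theorem norm_cexp_sub_one_sub_le (θ : ℝ) :
    ‖Complex.exp (θ * Complex.I) - 1 - θ * Complex.I‖ ≤ 3 * θ ^ 2 := by
  have hn : ‖(θ : ℂ) * Complex.I‖ = |θ| := by simp
  by_cases h : |θ| ≤ 1
  · have := Complex.norm_exp_sub_one_sub_id_le (x := (θ : ℂ) * Complex.I) (by rwa [hn])
    rw [hn, sq_abs] at this
    nlinarith [sq_nonneg θ]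
  · have h1 := norm_sub_le (Complex.exp (θ * Complex.I) - 1) (θ * Complex.I)
    have h2 := norm_sub_le (Complex.exp (θ * Complex.I)) 1
    rw [Complex.norm_exp_ofReal_mul_I, norm_one] at h2
    rw [hn] at h1
    have := sq_abs θ
    push Not at h
    nlinarith

namespace Sch

/-- The symbol of the free Schrödinger group. -/
def symbol (t ξ : ℝ) : ℂ := Complex.exp ((-(4 * Real.pi ^ 2 * t * ξ ^ 2) : ℝ) * Complex.I)

theorem symbol_hasTemperateGrowth (t : ℝ) : Function.HasTemperateGrowth (symbol t) :=
  hasTemperateGrowth_cexp_mul_I.comp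
    (f := fun ξ : ℝ => -(4 * Real.pi ^ 2 * t * ξ ^ 2)) (by fun_prop)

@[simp] theorem norm_symbol (t ξ : ℝ) : ‖symbol t ξ‖ = 1 := Complex.norm_exp_ofReal_mul_I _

/-- The free Schrödinger group on Schwartz functions. -/
def group (t : ℝ) : 𝓢(ℝ, ℂ) →L[ℂ] 𝓢(ℝ, ℂ) := SchwartzMap.fourierMultiplierCLM ℂ (symbol t)

theorem fourier_group (t : ℝ) (f : 𝓢(ℝ, ℂ)) :
    𝓕 (group t f) = SchwartzMap.smulLeftCLM ℂ (symbol t) (𝓕 f) := by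
  rw [group, SchwartzMap.fourierMultiplierCLM_apply]
  exact FourierTransform.fourier_fourierInv_eq (SchwartzMap.smulLeftCLM ℂ (symbol t) (𝓕 f))

theorem fourier_group_apply (t : ℝ) (f : 𝓢(ℝ, ℂ)) (ξ : ℝ) :
    𝓕 (group t f) ξ = symbol t ξ * 𝓕 f ξ := by
  rw [fourier_group, SchwartzMap.smulLeftCLM_apply_apply (symbol_hasTemperateGrowth t),
    smul_eq_mul]

theorem fourier_injective {f g : 𝓢(ℝ, ℂ)} (h : (𝓕 f : 𝓢(ℝ, ℂ)) = 𝓕 g) : f = g := by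
  have := congrArg (fun k : 𝓢(ℝ, ℂ) => (𝓕⁻ k : 𝓢(ℝ, ℂ))) h
  simpa using this

theorem norm_fourier (f : 𝓢(ℝ, ℂ)) : ‖toL2 (𝓕 f)‖ = ‖toL2 f‖ :=
  SchwartzMap.norm_fourier_toL2_eq f

theorem D_eq_lineDeriv (f : 𝓢(ℝ, ℂ)) : D f = LineDeriv.lineDerivOp (1 : ℝ) f := by
  ext x
  rw [SchwartzMap.lineDerivOp_apply_eq_fderiv, D_apply, fderiv_apply_one_eq_deriv]

theorem fourier_D_apply (f : 𝓢(ℝ, ℂ)) (ξ : ℝ) :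
    𝓕 (D f) ξ = (2 * Real.pi * Complex.I) * (ξ * 𝓕 f ξ) := by
  have hg : Function.HasTemperateGrowth (fun x : ℝ => x) := Function.HasTemperateGrowth.id'
  rw [D_eq_lineDeriv, SchwartzMap.fourier_lineDerivOp_eq]
  simp [SchwartzMap.smulLeftCLM_apply_apply hg]

theorem D_fourier_apply (f : 𝓢(ℝ, ℂ)) (ξ : ℝ) :
    D (𝓕 f) ξ = -(2 * Real.pi * Complex.I) * 𝓕 (X f) ξ := by
  have hg : Function.HasTemperateGrowth (fun x : ℝ => x) := Function.HasTemperateGrowth.id'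
  rw [D_eq_lineDeriv, SchwartzMap.lineDerivOp_fourier_eq]
  have h : SchwartzMap.smulLeftCLM ℂ (fun x : ℝ => (inner ℝ x 1 : ℝ)) f = X f := by
    ext x
    simp [SchwartzMap.smulLeftCLM_apply_apply hg]
  rw [h, FourierTransform.fourier_smul]
  simp

theorem hasDerivAt_symbol (t ξ : ℝ) :
    HasDerivAt (symbol t) (-(8 * Real.pi ^ 2 * t * Complex.I) * (ξ * symbol t ξ)) ξ := by
  have h1 : HasDerivAt (fun ξ : ℝ => -(4 * Real.pi ^ 2 * t * ξ ^ 2))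
      (-(4 * Real.pi ^ 2 * t * (2 * ξ))) ξ := by
    simpa using (((hasDerivAt_pow 2 ξ).const_mul (4 * Real.pi ^ 2 * t)).fun_neg)
  have h := ((h1.ofReal_comp).mul_const Complex.I).cexp
  have h' : HasDerivAt (symbol t) _ ξ := h
  convert h' using 1
  simp only [symbol]
  push_cast
  ring

theorem group_D (t : ℝ) (f : 𝓢(ℝ, ℂ)) : D (group t f) = group t (D f) := by
  apply fourier_injective
  ext ξ
  rw [fourier_D_apply, fourier_group_apply, fourier_group_apply, fourier_D_apply]
  ring

/-- On the Fourier side x acts as a derivative, and differentiating the symbol e^{-4π²itξ²} brings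
down a factor tξ. This commutation is the source of the polynomial growth in t of weighted norms. -/
theorem X_group (t : ℝ) (f : 𝓢(ℝ, ℂ)) :
    X (group t f) = group t (X f - (2 * t * Complex.I) • D f) := by
  apply fourier_injective
  ext ξ
  have hpi : (2 * Real.pi * Complex.I) ≠ 0 := by
    simp [Real.pi_ne_zero]
  have h1 := D_fourier_apply (group t f) ξ
  have h2 : D (𝓕 (group t f)) ξ = -(8 * Real.pi ^ 2 * t * Complex.I) * (ξ * symbol t ξ) * 𝓕 f ξ +
      symbol t ξ * D (𝓕 f) ξ := by
    have h3 : ((𝓕 (group t f) : 𝓢(ℝ, ℂ)) : ℝ → ℂ) = fun ξ => symbol t ξ * 𝓕 f ξ := by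
      ext ξ
      exact fourier_group_apply t f ξ
    rw [D_apply, h3]
    exact ((hasDerivAt_symbol t ξ).mul (hasDerivAt (𝓕 f) ξ)).deriv
  rw [h2, D_fourier_apply] at h1
  have h4 : 𝓕 (group t (X f - (2 * t * Complex.I) • D f)) ξ =
      symbol t ξ * (𝓕 (X f) ξ - (2 * t * Complex.I) * 𝓕 (D f) ξ) := by
    rw [fourier_group_apply, sub_eq_add_neg, FourierTransform.fourier_add, ← neg_smul,
      FourierTransform.fourier_smul, add_apply, smul_apply, smul_eq_mul]
    ring
  rw [h4, fourier_D_apply]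
  have h5 := Complex.I_sq
  apply mul_left_cancel₀ (neg_ne_zero.2 hpi)
  rw [← h1]
  linear_combination (-8 * Real.pi ^ 2 * t * ξ * symbol t ξ * 𝓕 f ξ * Complex.I) * h5

theorem norm_group (t : ℝ) (f : 𝓢(ℝ, ℂ)) : ‖toL2 (group t f)‖ = ‖toL2 f‖ := by
  rw [← norm_fourier, ← norm_fourier f]
  exact le_antisymm (norm_toL2_le fun x => by simp [fourier_group_apply])
    (norm_toL2_le fun x => by simp [fourier_group_apply])

theorem group_zero (f : 𝓢(ℝ, ℂ)) : group 0 f = f := by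
  apply fourier_injective
  ext ξ
  rw [fourier_group_apply]
  simp [symbol]

theorem group_add (s t : ℝ) (f : 𝓢(ℝ, ℂ)) : group (s + t) f = group s (group t f) := by
  apply fourier_injective
  ext ξ
  rw [fourier_group_apply, fourier_group_apply, fourier_group_apply, ← mul_assoc, symbol, symbol,
    symbol, ← Complex.exp_add]
  congr 2
  push_cast
  ring

theorem fourier_D_D_apply (f : 𝓢(ℝ, ℂ)) (ξ : ℝ) :
    𝓕 (D (D f)) ξ = -(4 * Real.pi ^ 2 * ξ ^ 2) * 𝓕 f ξ := by
  rw [fourier_D_apply, fourier_D_apply]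
  linear_combination (4 * Real.pi ^ 2 * ξ ^ 2 * 𝓕 f ξ) * Complex.I_sq

theorem norm_group_sub_le (t : ℝ) (f : 𝓢(ℝ, ℂ)) :
    ‖toL2 (group t f - f)‖ ≤ |t| * ‖toL2 (D (D f))‖ := by
  have e : ‖toL2 ((t : ℂ) • 𝓕 (D (D f)))‖ = |t| * ‖toL2 (D (D f))‖ := by
    rw [map_smul, norm_smul, norm_fourier, Complex.norm_real, Real.norm_eq_abs]
  rw [← e, ← norm_fourier]
  refine norm_toL2_le fun ξ => ?_
  have h : 𝓕 (group t f - f) ξ = (symbol t ξ - 1) * 𝓕 f ξ := by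
    rw [sub_eq_add_neg, FourierTransform.fourier_add, add_apply, fourier_group_apply,
      ← neg_one_smul ℂ f, FourierTransform.fourier_smul, smul_apply]
    simp
    ring
  rw [h, smul_apply, fourier_D_D_apply, smul_eq_mul, ← mul_assoc, norm_mul, norm_mul]
  gcongr
  have h2 := Real.norm_exp_I_mul_ofReal_sub_one_le (x := -(4 * Real.pi ^ 2 * t * ξ ^ 2))
  rw [mul_comm] at h2
  refine h2.trans (le_of_eq ?_)
  rw [← Complex.norm_real]
  congr 1
  push_cast
  ring

theorem norm_group_sub_sub_le (t : ℝ) (f : 𝓢(ℝ, ℂ)) :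
    ‖toL2 (group t f - f - (t * Complex.I) • D (D f))‖ ≤
      3 * t ^ 2 * ‖toL2 (D (D (D (D f))))‖ := by
  have e : ‖toL2 ((3 * t ^ 2 : ℂ) • 𝓕 (D (D (D (D f)))))‖ =
      3 * t ^ 2 * ‖toL2 (D (D (D (D f))))‖ := by
    rw [map_smul, norm_smul, norm_fourier]
    simp
  rw [← e, ← norm_fourier]
  refine norm_toL2_le fun ξ => ?_
  have h : 𝓕 (group t f - f - (t * Complex.I) • D (D f)) ξ =
      (symbol t ξ - 1 - (-(4 * Real.pi ^ 2 * t * ξ ^ 2) : ℝ) * Complex.I) * 𝓕 f ξ := by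
    rw [sub_eq_add_neg, sub_eq_add_neg, FourierTransform.fourier_add, FourierTransform.fourier_add,
      add_apply, add_apply, fourier_group_apply, ← neg_one_smul ℂ f,
      FourierTransform.fourier_smul, smul_apply, ← neg_smul,
      FourierTransform.fourier_smul, smul_apply, fourier_D_D_apply]
    simp
    ring
  rw [h, smul_apply, fourier_D_D_apply, fourier_D_D_apply, smul_eq_mul, ← mul_assoc,
    ← mul_assoc, norm_mul, norm_mul]
  gcongr
  refine (norm_cexp_sub_one_sub_le _).trans (le_of_eq ?_)
  have : (3 * (t : ℂ) ^ 2 * -(4 * Real.pi ^ 2 * ξ ^ 2) * -(4 * Real.pi ^ 2 * ξ ^ 2)) =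
      ((3 * (-(4 * Real.pi ^ 2 * t * ξ ^ 2)) ^ 2 : ℝ) : ℂ) := by
    push_cast
    ring
  rw [this, Complex.norm_real, Real.norm_of_nonneg (by positivity)]

end Sch

/-- The free Schrödinger group on `L²`. -/
def freeL2 (t : ℝ) : L2R →L[ℂ] L2R :=
  (Sch.toL2.comp (Sch.group t)).toLinearMap.extendOfNorm Sch.toL2.toLinearMap

@[simp] theorem freeL2_toL2 (t : ℝ) (f : 𝓢(ℝ, ℂ)) :
    freeL2 t (Sch.toL2 f) = Sch.toL2 (Sch.group t f) :=
  LinearMap.extendOfNorm_eq (f := (Sch.toL2.comp (Sch.group t)).toLinearMap)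
    (e := Sch.toL2.toLinearMap) Sch.denseRange_toL2
    ⟨1, fun f => by simpa using (Sch.norm_group t f).le⟩ f

@[simp] theorem norm_freeL2 (t : ℝ) (g : L2R) : ‖freeL2 t g‖ = ‖g‖ :=
  Sch.denseRange_toL2.induction_on (p := fun g => ‖freeL2 t g‖ = ‖g‖) g
    (isClosed_eq (by fun_prop) (by fun_prop)) fun f => by simp [Sch.norm_group]

@[simp] theorem freeL2_zero (g : L2R) : freeL2 0 g = g :=
  Sch.denseRange_toL2.induction_on (p := fun g => freeL2 0 g = g) g
    (isClosed_eq (by fun_prop) (by fun_prop)) fun f => by simp [Sch.group_zero]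

theorem freeL2_add (s t : ℝ) (g : L2R) : freeL2 (s + t) g = freeL2 s (freeL2 t g) :=
  Sch.denseRange_toL2.induction_on (p := fun g => freeL2 (s + t) g = freeL2 s (freeL2 t g)) g
    (isClosed_eq (by fun_prop) (by fun_prop)) fun f => by simp [Sch.group_add]

@[simp] theorem freeL2_freeL2_neg (t : ℝ) (g : L2R) : freeL2 t (freeL2 (-t) g) = g := by
  rw [← freeL2_add]
  simp

theorem tendsto_freeL2_zero (g : L2R) :
    Filter.Tendsto (fun t => freeL2 t g) (nhds 0) (nhds g) := by
  rw [Metric.tendsto_nhds]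
  intro ε hε
  obtain ⟨f, hf⟩ := Sch.denseRange_toL2.exists_dist_lt g (by positivity : 0 < ε / 3)
  have h0 : Filter.Tendsto (fun t : ℝ => |t| * ‖Sch.toL2 (Sch.D (Sch.D f))‖) (nhds 0) (nhds 0) := by
    have : Continuous fun t : ℝ => |t| * ‖Sch.toL2 (Sch.D (Sch.D f))‖ := by fun_prop
    simpa using this.tendsto 0
  filter_upwards [h0.eventually_lt_const (by positivity : 0 < ε / 3)] with t ht
  have h1 := (Sch.norm_group_sub_le t f).trans_lt ht
  rw [map_sub] at h1
  calc dist (freeL2 t g) g ≤ dist (freeL2 t g) (freeL2 t (Sch.toL2 f)) +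
        dist (freeL2 t (Sch.toL2 f)) (Sch.toL2 f) + dist (Sch.toL2 f) g := dist_triangle4 _ _ _ _
    _ < ε / 3 + ε / 3 + ε / 3 := by
        gcongr
        · rw [dist_eq_norm, ← map_sub, norm_freeL2, ← dist_eq_norm]
          exact hf
        · rw [dist_eq_norm, freeL2_toL2]
          exact h1
        · rwa [dist_comm]
    _ = ε := by ring

theorem continuous_freeL2 (g : L2R) : Continuous fun t => freeL2 t g := by
  rw [continuous_iff_continuousAt]
  intro t
  have h1 : Filter.Tendsto (fun s => s - t) (nhds t) (nhds 0) := by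
    have : Continuous fun s : ℝ => s - t := by fun_prop
    simpa using this.tendsto t
  have h2 := ((freeL2 t).continuous.tendsto g).comp ((tendsto_freeL2_zero g).comp h1)
  refine h2.congr fun s => ?_
  simp only [Function.comp]
  rw [← freeL2_add]
  congr 2
  ring

theorem continuous_freeL2_uncurry : Continuous fun p : ℝ × L2R => freeL2 p.1 p.2 := by
  rw [continuous_iff_continuousAt]
  rintro ⟨t, g⟩
  rw [ContinuousAt, tendsto_iff_norm_sub_tendsto_zero]
  have h1 : Continuous fun p : ℝ × L2R => ‖p.2 - g‖ + ‖freeL2 p.1 g - freeL2 t g‖ := by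
    have := (continuous_freeL2 g).comp (continuous_fst (X := ℝ) (Y := L2R))
    fun_prop
  have h2 := h1.tendsto (t, g)
  simp only [sub_self, norm_zero, add_zero] at h2
  refine squeeze_zero (fun _ => norm_nonneg _) (fun p => ?_) h2
  calc ‖freeL2 p.1 p.2 - freeL2 t g‖ = ‖freeL2 p.1 (p.2 - g) + (freeL2 p.1 g - freeL2 t g)‖ := by
        rw [map_sub]
        congr 1
        abel
    _ ≤ _ := (norm_add_le _ _).trans (by rw [norm_freeL2])

theorem Continuous.freeL2 {Z : Type*} [TopologicalSpace Z] {t : Z → ℝ} {g : Z → L2R}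
    (ht : Continuous t) (hg : Continuous g) : Continuous fun z => freeL2 (t z) (g z) :=
  by
  have h : Continuous fun z => (t z, g z) := ht.prodMk hg
  simpa only [Function.comp_def] using continuous_freeL2_uncurry.comp h

namespace H22

theorem norm_freeL2_jet0_sub_le (t : ℝ) : ∀ q : H22,
    ‖freeL2 t (jet0 q) - jet0 q‖ ≤ |t| * ‖q‖ :=
  le_of_schwartz (by fun_prop) (by fun_prop) fun f => by
    rw [jet0_of, freeL2_toL2, ← map_sub]
    refine (Sch.norm_group_sub_le t f).trans ?_
    gcongr
    exact norm_jet2_of_le f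

/-- The second-order remainder costs four derivatives and is available for Schwartz functions only.
Approximating q by f in `H22`, the error q - f contributes at most 2|t|‖q - f‖, which is a small
multiple of |t|. -/
theorem hasDerivAt_freeL2_zero (q : H22) :
    HasDerivAt (fun t => freeL2 t (jet0 q)) (Complex.I • jet2 q) 0 := by
  rw [hasDerivAt_iff_isLittleO, Asymptotics.isLittleO_iff]
  intro c hc
  obtain ⟨f, hf⟩ := denseRange_of.exists_dist_lt q (by positivity : 0 < c / 4)
  have h0 : Filter.Tendsto (fun t : ℝ => 3 * |t| * ‖Sch.toL2 (Sch.D (Sch.D (Sch.D (Sch.D f))))‖)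
      (nhds 0) (nhds 0) := by
    have : Continuous fun t : ℝ => 3 * |t| * ‖Sch.toL2 (Sch.D (Sch.D (Sch.D (Sch.D f))))‖ := by
      fun_prop
    simpa using this.tendsto 0
  filter_upwards [h0.eventually_lt_const (by positivity : 0 < c / 2)] with t ht
  have h1 := Sch.norm_group_sub_sub_le t f
  have h2 := norm_freeL2_jet0_sub_le t (q - of f)
  have h3 := norm_jet2_le (q - of f)
  rw [dist_eq_norm] at hf
  have e : freeL2 t (jet0 q) - freeL2 0 (jet0 q) - (t - 0) • Complex.I • jet2 q =
      (freeL2 t (jet0 (q - of f)) - jet0 (q - of f)) - ((t : ℂ) * Complex.I) • jet2 (q - of f) +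
      Sch.toL2 (Sch.group t f - f - (t * Complex.I) • Sch.D (Sch.D f)) := by
    rw [map_sub Sch.toL2, map_sub Sch.toL2, Sch.toL2.map_smul, ← freeL2_toL2]
    simp only [map_sub, jet0_of, jet2_of, freeL2_zero, sub_zero, smul_sub, mul_smul,
      Complex.coe_smul]
    abel
  rw [e, sub_zero, Real.norm_eq_abs]
  refine (norm_add_le _ _).trans ?_
  have h4 : ‖((t : ℂ) * Complex.I) • jet2 (q - of f)‖ ≤ |t| * ‖q - of f‖ := by
    rw [norm_smul]
    simp only [norm_mul, Complex.norm_real, Complex.norm_I, mul_one, Real.norm_eq_abs]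
    gcongr
  have h5 := norm_sub_le (freeL2 t (jet0 (q - of f)) - jet0 (q - of f))
    (((t : ℂ) * Complex.I) • jet2 (q - of f))
  have h6 : |t| * ‖q - of f‖ ≤ |t| * (c / 4) := by gcongr
  have h7 : 3 * t ^ 2 * ‖Sch.toL2 (Sch.D (Sch.D (Sch.D (Sch.D f))))‖ ≤ |t| * (c / 2) := by
    rw [← sq_abs]
    nlinarith [mul_le_mul_of_nonneg_left ht.le (abs_nonneg t)]
  linarith

theorem hasDerivAt_freeL2 (q : H22) (t : ℝ) :
    HasDerivAt (fun t => freeL2 t (jet0 q)) (Complex.I • freeL2 t (jet2 q)) t := by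
  have h1 : HasDerivAt (fun s => freeL2 (s - t) (jet0 q)) (Complex.I • jet2 q) t := by
    have h := hasDerivAt_freeL2_zero q
    rw [← sub_self t] at h
    simpa using HasDerivAt.comp_sub_const t t h
  have h2 := ((freeL2 t).restrictScalars ℝ).hasFDerivAt.comp_hasDerivAt t h1
  simp only [ContinuousLinearMap.coe_restrictScalars', map_smul] at h2
  refine h2.congr_of_eventuallyEq (Filter.Eventually.of_forall fun s => ?_)
  simp only [Function.comp]
  rw [← freeL2_add]
  congr 2
  ring

/-- A bound for the norm of the free Schrödinger group on `H^{2,2}`. -/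
def freeBound (t : ℝ) : ℝ := 3 + 14 * |t| + 4 * t ^ 2

/-- Commuting x² through the group gives x²f - 2it(2xf' + f) + (2it)²f''. With ‖xf'‖ ≤ 3‖of f‖ this
has norm at most 1 + 14|t| + 4t² times ‖of f‖, and q and q'' add 1 each. -/
theorem norm_of_group_le (t : ℝ) (f : 𝓢(ℝ, ℂ)) :
    ‖of (Sch.group t f)‖ ≤ freeBound t * ‖of f‖ := by
  have h := norm_le (of (Sch.group t f))
  rw [jet0_of, mom2_of, jet2_of, Sch.norm_group, Sch.group_D, Sch.group_D, Sch.norm_group,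
    Sch.X_group, Sch.X_group, Sch.norm_group] at h
  have e : Sch.toL2 (Sch.X (Sch.X f - (2 * t * Complex.I) • Sch.D f) -
      (2 * t * Complex.I) • Sch.D (Sch.X f - (2 * t * Complex.I) • Sch.D f)) =
      Sch.toL2 (Sch.X (Sch.X f)) - (2 * t * Complex.I) • (Sch.toL2 (Sch.X (Sch.D f)) +
        Sch.toL2 (Sch.X (Sch.D f)) + Sch.toL2 f) +
      (2 * t * Complex.I) ^ 2 • Sch.toL2 (Sch.D (Sch.D f)) := by
    simp only [← map_add, ← map_sub, ← Sch.toL2.map_smul]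
    congr 1
    ext x
    simp
    ring
  rw [e] at h
  have h1 : ‖(2 * t * Complex.I : ℂ)‖ = 2 * |t| := by simp
  have h2 : ‖(2 * t * Complex.I : ℂ) • (Sch.toL2 (Sch.X (Sch.D f)) +
        Sch.toL2 (Sch.X (Sch.D f)) + Sch.toL2 f)‖ ≤ 2 * |t| * (7 * ‖of f‖) := by
    rw [norm_smul, h1]
    gcongr
    refine norm_add₃_le.trans ?_
    have := norm_mom1jet1_of_le f
    have := norm_jet0_of_le f
    linarith
  have h3 : ‖(2 * t * Complex.I : ℂ) ^ 2 • Sch.toL2 (Sch.D (Sch.D f))‖ ≤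
      4 * t ^ 2 * ‖of f‖ := by
    rw [norm_smul, norm_pow, h1, mul_pow, sq_abs]
    have := norm_jet2_of_le f
    rw [show (2 : ℝ) ^ 2 = 4 by norm_num]
    gcongr
  have h4 := norm_add_le (Sch.toL2 (Sch.X (Sch.X f)) - (2 * t * Complex.I) •
    (Sch.toL2 (Sch.X (Sch.D f)) + Sch.toL2 (Sch.X (Sch.D f)) + Sch.toL2 f))
    ((2 * t * Complex.I) ^ 2 • Sch.toL2 (Sch.D (Sch.D f)))
  have h5 := norm_sub_le (Sch.toL2 (Sch.X (Sch.X f))) ((2 * t * Complex.I) •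
    (Sch.toL2 (Sch.X (Sch.D f)) + Sch.toL2 (Sch.X (Sch.D f)) + Sch.toL2 f))
  have := norm_mom2_of_le f
  have := norm_jet0_of_le f
  have := norm_jet2_of_le f
  rw [freeBound]
  linarith

/-- The free Schrödinger group on `H^{2,2}`. -/
def free (t : ℝ) : H22 →L[ℂ] H22 := ext (of ∘ₗ (Sch.group t).toLinearMap)

@[simp] theorem free_of (t : ℝ) (f : 𝓢(ℝ, ℂ)) : free t (of f) = of (Sch.group t f) :=
  ext_of (T := of ∘ₗ (Sch.group t).toLinearMap) (fun f => norm_of_group_le t f) f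

theorem norm_free_le (t : ℝ) : ∀ q, ‖free t q‖ ≤ freeBound t * ‖q‖ :=
  le_of_schwartz (by fun_prop) (by fun_prop) fun f => by
    rw [free_of]
    exact norm_of_group_le t f

@[simp] theorem free_zero : ∀ q, free 0 q = q :=
  eq_of_schwartz (by fun_prop) (by fun_prop) fun f => by simp [Sch.group_zero]

theorem free_add (s t : ℝ) : ∀ q, free (s + t) q = free s (free t q) :=
  eq_of_schwartz (by fun_prop) (by fun_prop) fun f => by simp [Sch.group_add]

@[simp] theorem free_neg_free (t : ℝ) (q : H22) : free (-t) (free t q) = q := by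
  rw [← free_add]
  simp

@[simp] theorem free_free_neg (t : ℝ) (q : H22) : free t (free (-t) q) = q := by
  rw [← free_add]
  simp

theorem jet0_free (t : ℝ) : ∀ q, jet0 (free t q) = freeL2 t (jet0 q) :=
  eq_of_schwartz (by fun_prop) (by fun_prop) fun f => by simp
theorem jet1_free (t : ℝ) : ∀ q, jet1 (free t q) = freeL2 t (jet1 q) :=
  eq_of_schwartz (by fun_prop) (by fun_prop) fun f => by simp [Sch.group_D]
theorem jet2_free (t : ℝ) : ∀ q, jet2 (free t q) = freeL2 t (jet2 q) :=
  eq_of_schwartz (by fun_prop) (by fun_prop) fun f => by simp [Sch.group_D]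
theorem mom1_free (t : ℝ) : ∀ q, mom1 (free t q) =
    freeL2 t (mom1 q - (2 * t * Complex.I) • jet1 q) :=
  eq_of_schwartz (by fun_prop) (by fun_prop) fun f => by
    simp only [free_of, mom1_of, jet1_of, ← Sch.toL2.map_smul, ← map_sub, freeL2_toL2,
      Sch.X_group]
theorem mom2_free (t : ℝ) : ∀ q, mom2 (free t q) =
    freeL2 t (mom2 q - (2 * t * Complex.I) • ((2 : ℂ) • mom1jet1 q + jet0 q) -
      (4 * t ^ 2 : ℂ) • jet2 q) :=
  eq_of_schwartz (by fun_prop) (by fun_prop) fun f => by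
    simp only [free_of, mom2_of, mom1jet1_of, jet0_of, jet2_of, ← Sch.toL2.map_smul, ← map_sub,
      ← map_add, freeL2_toL2, Sch.X_group]
    congr 2
    ext x
    simp
    linear_combination (4 * t ^ 2 * Sch.D (Sch.D f) x) * Complex.I_sq

theorem continuous_of_jet {Z : Type*} [TopologicalSpace Z] {F : Z → H22}
    (h0 : Continuous fun z => jet0 (F z)) (h1 : Continuous fun z => mom2 (F z))
    (h2 : Continuous fun z => jet2 (F z)) : Continuous F := by
  rw [continuous_iff_continuousAt]
  intro z
  rw [ContinuousAt, tendsto_iff_norm_sub_tendsto_zero]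
  have h : Continuous fun y => ‖jet0 (F y) - jet0 (F z)‖ + ‖mom2 (F y) - mom2 (F z)‖ +
      ‖jet2 (F y) - jet2 (F z)‖ := by fun_prop
  have h' := h.tendsto z
  simp only [sub_self, norm_zero, add_zero] at h'
  refine squeeze_zero (fun _ => norm_nonneg _) (fun y => ?_) h'
  simpa using norm_le (F y - F z)

theorem continuous_free_uncurry : Continuous fun p : ℝ × H22 => free p.1 p.2 := by
  refine continuous_of_jet ?_ ?_ ?_
  · simp only [jet0_free]
    exact continuous_fst.freeL2 (by fun_prop)
  · simp only [mom2_free]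
    exact continuous_fst.freeL2 (by fun_prop)
  · simp only [jet2_free]
    exact continuous_fst.freeL2 (by fun_prop)

theorem _root_.Continuous.h22free {Z : Type*} [TopologicalSpace Z] {t : Z → ℝ} {q : Z → H22}
    (ht : Continuous t) (hq : Continuous q) : Continuous fun z => free (t z) (q z) :=
  by
  have h : Continuous fun z => (t z, q z) := ht.prodMk hq
  simpa only [Function.comp_def] using continuous_free_uncurry.comp h

end H22
end

open MeasureTheory
open scoped SchwartzMap ContDiff

noncomputable section

open Set

/-! ### Ordinary differential equations with an a priori bound -/

section ODE

variable {E : Type*} [NormedAddCommGroup E]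

/-- A cutoff, equal to `1` on the ball of radius `R` and to `0` off the ball of radius `R + 1`. -/
def normCutoff (R : ℝ) (y : E) : ℝ := max 0 (min 1 (R + 1 - ‖y‖))

theorem abs_normCutoff_sub_le (R : ℝ) (a b : E) :
    |normCutoff R a - normCutoff R b| ≤ ‖a - b‖ := by
  have h1 := abs_max_sub_max_le_abs (min 1 (R + 1 - ‖a‖)) (min 1 (R + 1 - ‖b‖)) 0
  have h2 := abs_min_sub_min_le_max 1 (R + 1 - ‖a‖) 1 (R + 1 - ‖b‖)
  have h3 := abs_norm_sub_norm_le b a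
  rw [max_comm _ 0, max_comm _ 0] at h1
  rw [norm_sub_rev a b]
  refine h1.trans (h2.trans ?_)
  simpa using h3

theorem normCutoff_nonneg (R : ℝ) (y : E) : 0 ≤ normCutoff R y := le_max_left _ _

theorem normCutoff_le_one (R : ℝ) (y : E) : normCutoff R y ≤ 1 :=
  max_le zero_le_one (min_le_left _ _)

theorem normCutoff_eq_one {R : ℝ} {y : E} (h : ‖y‖ ≤ R) : normCutoff R y = 1 := by
  rw [normCutoff, min_eq_left (by linarith), max_eq_right zero_le_one]

theorem normCutoff_eq_zero {R : ℝ} {y : E} (h : R + 1 < ‖y‖) : normCutoff R y = 0 := by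
  rw [normCutoff, max_eq_left ((min_le_right _ _).trans (by linarith))]

theorem exists_bound_of_lipschitz {F : ℝ → E → E} (hc : ∀ y, Continuous fun t => F t y)
    (hL : ∀ T R : ℝ, ∃ K, ∀ t, |t| ≤ T → ∀ a b : E, ‖a‖ ≤ R → ‖b‖ ≤ R →
      ‖F t a - F t b‖ ≤ K * ‖a - b‖) (T R : ℝ) (hR : 0 ≤ R) :
    ∃ C, 0 ≤ C ∧ ∀ t, |t| ≤ T → ∀ a : E, ‖a‖ ≤ R → ‖F t a‖ ≤ C := by
  obtain ⟨K, hK⟩ := hL T R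
  obtain ⟨C, hC⟩ := (isCompact_Icc (a := -T) (b := T)).exists_bound_of_continuousOn
    (hc 0).continuousOn
  refine ⟨max 0 (|K| * R + C), le_max_left _ _, fun t ht a ha => le_max_of_le_right ?_⟩
  have h1 := hK t ht a 0 ha (by simpa using hR)
  have h2 := hC t (abs_le.1 ht)
  have h3 : ‖F t a‖ ≤ ‖F t a - F t 0‖ + ‖F t 0‖ := by
    simpa using norm_add_le (F t a - F t 0) (F t 0)
  have h4 : K * ‖a - 0‖ ≤ |K| * R := by
    rw [sub_zero]
    exact mul_le_mul (le_abs_self K) ha (norm_nonneg _) (abs_nonneg _)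
  linarith

variable [NormedSpace ℝ E]

/-- Gronwall's inequality forward in time, and for negative times the same after t ↦ -t. -/
theorem norm_le_exp_of_norm_deriv_le {f f' : ℝ → E} {K τ : ℝ}
    (hd : ∀ t ∈ Ioo (-τ) τ, HasDerivAt f (f' t) t)
    (hb : ∀ t ∈ Ioo (-τ) τ, ‖f' t‖ ≤ K * ‖f t‖) :
    ∀ t ∈ Ioo (-τ) τ, ‖f t‖ ≤ ‖f 0‖ * Real.exp (K * |t|) := by
  have key : ∀ {g g' : ℝ → E}, (∀ t ∈ Ico 0 τ, HasDerivAt g (g' t) t) →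
      (∀ t ∈ Ico 0 τ, ‖g' t‖ ≤ K * ‖g t‖) → ∀ t ∈ Ico 0 τ, ‖g t‖ ≤ ‖g 0‖ * Real.exp (K * t) := by
    intro g g' hg hg' t ht
    have hs : ∀ s ∈ Icc 0 t, s ∈ Ico 0 τ := fun s hs => ⟨hs.1, hs.2.trans_lt ht.2⟩
    have h := norm_le_gronwallBound_of_norm_deriv_right_le (f := g) (f' := g') (δ := ‖g 0‖) (K := K)
      (ε := 0) (a := 0) (b := t)
      (fun s h => (hg s (hs s h)).continuousAt.continuousWithinAt)
      (fun s h => (hg s (hs s (Ico_subset_Icc_self h))).hasDerivWithinAt) le_rfl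
      (fun s h => by simpa using hg' s (hs s (Ico_subset_Icc_self h))) t ⟨ht.1, le_rfl⟩
    simpa [gronwallBound_ε0] using h
  intro t ht
  rcases le_total 0 t with h0 | h0
  · rw [abs_of_nonneg h0]
    exact key (fun s hs => hd s ⟨by linarith [hs.1, hs.2], hs.2⟩)
      (fun s hs => hb s ⟨by linarith [hs.1, hs.2], hs.2⟩) t ⟨h0, ht.2⟩
  · rw [abs_of_nonpos h0]
    have h := key (g := fun s => f (-s)) (g' := fun s => -f' (-s)) (fun s hs => by
      have h1 := hd (-s) ⟨by linarith [hs.1, hs.2], by linarith [hs.1, hs.2]⟩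
      simpa [Function.comp_def] using h1.scomp s (hasDerivAt_neg s))
      (fun s hs => by
        simpa using hb (-s) ⟨by linarith [hs.1, hs.2], by linarith [hs.1, hs.2]⟩)
      (-t) ⟨by linarith, by linarith [ht.1]⟩
    simpa using h

/-- The cutoff turns a field that is Lipschitz and bounded on a ball into a globally Lipschitz one.
At least one of two points may be assumed to lie in the ball, since otherwise both values vanish. -/
theorem norm_cutoff_smul_sub_le {R K C : ℝ} {f : E → E} (hK : 0 ≤ K) (hC : 0 ≤ C)
    (hL : ∀ a b : E, ‖a‖ ≤ R + 1 → ‖b‖ ≤ R + 1 → ‖f a - f b‖ ≤ K * ‖a - b‖)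
    (hB : ∀ a : E, ‖a‖ ≤ R + 1 → ‖f a‖ ≤ C) (a b : E) :
    ‖normCutoff R a • f a - normCutoff R b • f b‖ ≤ (K + C) * ‖a - b‖ := by
  have key : ∀ a b : E, ‖a‖ ≤ R + 1 →
      ‖normCutoff R a • f a - normCutoff R b • f b‖ ≤ (K + C) * ‖a - b‖ := by
    intro a b ha
    have h1 := abs_normCutoff_sub_le R a b
    have hn := norm_nonneg (a - b)
    have h2 : ‖(normCutoff R a - normCutoff R b) • f a‖ ≤ ‖a - b‖ * C := by
      rw [norm_smul, Real.norm_eq_abs]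
      exact mul_le_mul h1 (hB a ha) (norm_nonneg _) hn
    by_cases hb : ‖b‖ ≤ R + 1
    · have h3 : ‖normCutoff R b • (f a - f b)‖ ≤ K * ‖a - b‖ := by
        rw [norm_smul, Real.norm_of_nonneg (normCutoff_nonneg R b)]
        refine (mul_le_of_le_one_left (norm_nonneg _) (normCutoff_le_one R b)).trans (hL a b ha hb)
      have e : normCutoff R a • f a - normCutoff R b • f b =
          (normCutoff R a - normCutoff R b) • f a + normCutoff R b • (f a - f b) := by module
      rw [e]
      refine (norm_add_le _ _).trans ?_
      linarith
    · rw [normCutoff_eq_zero (not_le.1 hb)] at h2 ⊢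
      rw [sub_zero] at h2
      rw [zero_smul, sub_zero]
      nlinarith
  by_cases ha : ‖a‖ ≤ R + 1
  · exact key a b ha
  · by_cases hb : ‖b‖ ≤ R + 1
    · rw [norm_sub_rev, norm_sub_rev a b]
      exact key b a hb
    · rw [normCutoff_eq_zero (not_le.1 ha), normCutoff_eq_zero (not_le.1 hb), zero_smul, zero_smul,
        sub_zero, norm_zero]
      positivity

/-- The truncated field is bounded and globally Lipschitz, so it has a solution on the whole of [-T,
T]. As long as this solution stays below R + 1 in norm it solves the original equation, and then the
a priori bound keeps it below R. By continuity it never reaches R + 1. -/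
theorem exists_solution_Ioo [CompleteSpace E] {F : ℝ → E → E}
    (hc : ∀ y, Continuous fun t => F t y)
    (hL : ∀ T R : ℝ, ∃ K, ∀ t, |t| ≤ T → ∀ a b : E, ‖a‖ ≤ R → ‖b‖ ≤ R →
      ‖F t a - F t b‖ ≤ K * ‖a - b‖) (y0 : E) {T R : ℝ} (hT : 0 < T) (hR : ‖y0‖ ≤ R)
    (ap : ∀ τ, 0 < τ → τ ≤ T → ∀ y : ℝ → E, y 0 = y0 →
      (∀ t ∈ Ioo (-τ) τ, HasDerivAt y (F t (y t)) t) → ∀ t ∈ Ioo (-τ) τ, ‖y t‖ ≤ R) :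
    ∃ y : ℝ → E, y 0 = y0 ∧ ∀ t ∈ Ioo (-T) T, HasDerivAt y (F t (y t)) t ∧ ‖y t‖ ≤ R := by
  have hR0 : 0 ≤ R := (norm_nonneg _).trans hR
  -- The cutoff is 1 up to radius R + 1, one more than the a priori bound, and vanishes beyond R +
  -- 2.
  obtain ⟨K, hK⟩ := hL T (R + 1 + 1)
  obtain ⟨C, hC0, hC⟩ := exists_bound_of_lipschitz hc hL T (R + 1 + 1) (by linarith)
  set G : ℝ → E → E := fun t y => normCutoff (R + 1) y • F t y with hG
  have hGL : ∀ t, |t| ≤ T → ∀ a b, ‖G t a - G t b‖ ≤ (|K| + C) * ‖a - b‖ := fun t ht =>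
    norm_cutoff_smul_sub_le (abs_nonneg K) hC0 (fun a b ha hb => (hK t ht a b ha hb).trans
      (mul_le_mul_of_nonneg_right (le_abs_self K) (norm_nonneg _))) (fun a ha => hC t ht a ha)
  have hGB : ∀ t, |t| ≤ T → ∀ a, ‖G t a‖ ≤ C := fun t ht a => by
    by_cases ha : ‖a‖ ≤ R + 1 + 1
    · simp only [hG, norm_smul, Real.norm_of_nonneg (normCutoff_nonneg _ _)]
      exact (mul_le_of_le_one_left (norm_nonneg _) (normCutoff_le_one _ _)).trans (hC t ht a ha)
    · simp only [hG, normCutoff_eq_zero (not_le.1 ha), zero_smul, norm_zero, hC0]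
  -- A curve of speed at most C moves by at most C T in time T, so the ball of radius C T imposes no
  -- restriction on the time of existence.
  have hPL : IsPicardLindelof G (tmin := -T) (tmax := T) ⟨0, by constructor <;> linarith⟩ y0
      ⟨C * T, by positivity⟩ 0 ⟨C, hC0⟩ ⟨|K| + C, by positivity⟩ := by
    refine ⟨fun t ht => ?_, fun y _ => ?_, fun t ht a _ => hGB t (abs_le.2 ht) a, ?_⟩
    · exact (LipschitzWith.of_dist_le_mul fun a b => by
        rw [dist_eq_norm, dist_eq_norm]
        exact hGL t (abs_le.2 ht) a b).lipschitzOnWith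
    · exact ((hc y).const_smul _).continuousOn
    · simp
      exact le_rfl
  obtain ⟨y, hy0, hy⟩ := hPL.exists_eq_forall_mem_Icc_hasDerivWithinAt₀
  have hy0' : y 0 = y0 := hy0
  have hd : ∀ t ∈ Ioo (-T) T, HasDerivAt y (G t (y t)) t := fun t ht =>
    (hy t (Ioo_subset_Icc_self ht)).hasDerivAt (Icc_mem_nhds ht.1 ht.2)
  have hsmall : ∀ t ∈ Ioo (-T) T, ‖y t‖ < R + 1 := by
    by_contra! hcon
    obtain ⟨t2, ht2, hy2⟩ := hcon
    set T' := |t2| with hT'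
    have hT'T : T' < T := abs_lt.2 ht2
    have hcont : ContinuousOn y (Icc (-T') T') := fun t ht =>
      (hd t ⟨by linarith [ht.1], by linarith [ht.2]⟩).continuousAt.continuousWithinAt
    have hcl : IsClosed (Icc (-T') T' ∩ y ⁻¹' {v | R + 1 ≤ ‖v‖}) :=
      hcont.preimage_isClosed_of_isClosed isClosed_Icc (isClosed_le continuous_const continuous_norm)
    -- A time of least absolute value at which the norm is at least R + 1; on (-|t1|, |t1|) the
    -- truncation is inactive.
    obtain ⟨t1, ht1, hmin⟩ := (isCompact_Icc.of_isClosed_subset hcl inter_subset_left).exists_isMinOn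
      ⟨t2, abs_le.1 le_rfl, hy2⟩ continuous_abs.continuousOn
    have hmin' : ∀ t, |t| < |t1| → ‖y t‖ < R + 1 := by
      intro t ht
      by_contra! h
      have h1 : |t1| ≤ T' := abs_le.2 ht1.1
      exact absurd (hmin ⟨abs_le.1 (by linarith), h⟩) (not_le.2 ht)
    have h1T : |t1| < T := (abs_le.2 ht1.1).trans_lt hT'T
    have h1pos : 0 < |t1| := by
      rw [abs_pos]
      rintro rfl
      have : R + 1 ≤ ‖y 0‖ := ht1.2
      rw [hy0'] at this
      linarith
    have hb := ap |t1| h1pos h1T.le y hy0' (fun t ht => by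
      have h := hd t ⟨by linarith [ht.1], by linarith [ht.2]⟩
      simpa only [hG, normCutoff_eq_one (hmin' t (abs_lt.2 ht)).le, one_smul] using h)
    have hca : ContinuousAt y t1 := (hd t1 (abs_lt.1 h1T)).continuousAt
    have hclos : t1 ∈ closure (Ioo (-|t1|) |t1|) := by
      rw [closure_Ioo (by linarith)]
      exact abs_le.1 le_rfl
    have hle : ‖y t1‖ ≤ R := by
      have hfr := mem_closure_iff_frequently.1 hclos
      by_contra! hlt
      obtain ⟨s, hs1, hs2⟩ :=
        (hfr.and_eventually (hca.norm.eventually_const_lt hlt)).exists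
      exact absurd (hb s hs1) (not_le.2 hs2)
    have : R + 1 ≤ ‖y t1‖ := ht1.2
    linarith
  have hd' : ∀ t ∈ Ioo (-T) T, HasDerivAt y (F t (y t)) t := fun t ht => by
    simpa only [hG, normCutoff_eq_one (hsmall t ht).le, one_smul] using hd t ht
  exact ⟨y, hy0', fun t ht => ⟨hd' t ht, ap T hT le_rfl y hy0' hd' t ht⟩⟩

/-- Solutions on (-(n+1), n+1) agree on common intervals, since the a priori bound confines both to
a ball on which the field is Lipschitz. The global solution takes at time t the value of the one
with index ⌈|t|⌉. -/
theorem exists_global_solution [CompleteSpace E] {F : ℝ → E → E}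
    (hc : ∀ y, Continuous fun t => F t y)
    (hL : ∀ T R : ℝ, ∃ K, ∀ t, |t| ≤ T → ∀ a b : E, ‖a‖ ≤ R → ‖b‖ ≤ R →
      ‖F t a - F t b‖ ≤ K * ‖a - b‖) (y0 : E)
    (ap : ∀ T, 0 < T → ∃ R, ∀ τ, 0 < τ → τ ≤ T → ∀ y : ℝ → E, y 0 = y0 →
      (∀ t ∈ Ioo (-τ) τ, HasDerivAt y (F t (y t)) t) → ∀ t ∈ Ioo (-τ) τ, ‖y t‖ ≤ R) :
    ∃ y : ℝ → E, y 0 = y0 ∧ ∀ t, HasDerivAt y (F t (y t)) t := by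
  have hex : ∀ n : ℕ, ∃ y : ℝ → E, y 0 = y0 ∧
      ∀ t ∈ Ioo (-(n + 1 : ℝ)) (n + 1), HasDerivAt y (F t (y t)) t := by
    intro n
    obtain ⟨R, hR⟩ := ap (n + 1) (by positivity)
    obtain ⟨y, h0, h⟩ := exists_solution_Ioo hc hL y0 (T := n + 1) (R := max R ‖y0‖) (by positivity)
      (le_max_right _ _) (fun τ h1 h2 y hy h3 t ht => (hR τ h1 h2 y hy h3 t ht).trans
        (le_max_left _ _))
    exact ⟨y, h0, fun t ht => (h t ht).1⟩
  choose y hy0 hy using hex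
  have huniq : ∀ m n : ℕ, m ≤ n → EqOn (y m) (y n) (Ioo (-(m + 1 : ℝ)) (m + 1)) := by
    intro m n hmn
    have hmn' : (m : ℝ) ≤ n := by exact_mod_cast hmn
    have hn : ∀ t ∈ Ioo (-(m + 1 : ℝ)) (m + 1), HasDerivAt (y n) (F t (y n t)) t := fun t ht =>
      hy n t ⟨by linarith [ht.1], by linarith [ht.2]⟩
    obtain ⟨R, hR⟩ := ap (m + 1) (by positivity)
    obtain ⟨K, hK⟩ := hL (m + 1) R
    refine ODE_solution_unique_of_mem_Ioo (v := F) (K := ⟨|K|, abs_nonneg K⟩)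
      (s := fun _ => Metric.closedBall 0 R) (t₀ := 0) ?_ ?_ ?_ ?_ ?_
    · intro t ht
      refine LipschitzOnWith.of_dist_le_mul fun a ha b hb => ?_
      rw [dist_eq_norm, dist_eq_norm]
      exact (hK t (abs_lt.2 ht).le a b (by simpa using ha) (by simpa using hb)).trans
        (mul_le_mul_of_nonneg_right (le_abs_self K) (norm_nonneg _))
    · constructor <;> linarith [(Nat.cast_nonneg m : (0 : ℝ) ≤ m)]
    · exact fun t ht => ⟨hy m t ht, by
        simpa using hR (m + 1) (by positivity) le_rfl (y m) (hy0 m) (hy m) t ht⟩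
    · exact fun t ht => ⟨hn t ht, by
        simpa using hR (m + 1) (by positivity) le_rfl (y n) (hy0 n) hn t ht⟩
    · rw [hy0, hy0]
  have hmem : ∀ t : ℝ, t ∈ Ioo (-((⌈|t|⌉₊ : ℕ) + 1 : ℝ)) ((⌈|t|⌉₊ : ℕ) + 1) := fun t =>
    abs_lt.1 ((Nat.le_ceil |t|).trans_lt (lt_add_one _))
  refine ⟨fun t => y ⌈|t|⌉₊ t, hy0 _, fun t => ?_⟩
  refine (hy ⌈|t|⌉₊ t (hmem t)).congr_of_eventuallyEq ?_
  filter_upwards [Ioo_mem_nhds (hmem t).1 (hmem t).2] with s hs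
  rcases le_total ⌈|t|⌉₊ ⌈|s|⌉₊ with h | h
  · exact (huniq _ _ h hs).symm
  · exact huniq _ _ h (hmem s)

end ODE

/-! ### Maps that are Lipschitz on bounded sets -/

/-- The map `f` is Lipschitz on bounded sets. -/
def LipBdd {E F : Type*} [NormedAddCommGroup E] [NormedAddCommGroup F] (f : E → F) : Prop :=
  ∀ R : ℝ, ∃ K, 0 ≤ K ∧ ∀ a b : E, ‖a‖ ≤ R → ‖b‖ ≤ R → ‖f a - f b‖ ≤ K * ‖a - b‖

namespace LipBdd

variable {E F G H : Type*} [NormedAddCommGroup E] [NormedAddCommGroup F] [NormedAddCommGroup G]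
  [NormedAddCommGroup H]

theorem exists_bound {f : E → F} (hf : LipBdd f) (R : ℝ) :
    ∃ C, 0 ≤ C ∧ ∀ a : E, ‖a‖ ≤ R → ‖f a‖ ≤ C := by
  obtain ⟨K, hK0, hK⟩ := hf R
  refine ⟨K * |R| + ‖f 0‖, by positivity, fun a ha => ?_⟩
  have h1 := hK a 0 ha (by simpa using (norm_nonneg a).trans ha)
  have h2 : ‖f a‖ ≤ ‖f a - f 0‖ + ‖f 0‖ := by simpa using norm_add_le (f a - f 0) (f 0)
  rw [sub_zero] at h1
  have h3 : K * ‖a‖ ≤ K * |R| := mul_le_mul_of_nonneg_left (ha.trans (le_abs_self R)) hK0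
  linarith

theorem continuous {f : E → F} (hf : LipBdd f) : Continuous f := by
  rw [continuous_iff_continuousAt]
  intro a
  obtain ⟨K, hK0, hK⟩ := hf (‖a‖ + 1)
  rw [ContinuousAt, tendsto_iff_norm_sub_tendsto_zero]
  have h : Continuous fun b => K * ‖b - a‖ := by fun_prop
  have h' := h.tendsto a
  simp only [sub_self, norm_zero, mul_zero] at h'
  refine squeeze_zero' (Filter.Eventually.of_forall fun _ => norm_nonneg _) ?_ h'
  filter_upwards [Metric.ball_mem_nhds a one_pos] with b hb
  refine hK b a ?_ (by linarith)
  have := norm_le_norm_add_norm_sub' b a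
  rw [mem_ball_iff_norm] at hb
  linarith

theorem of_norm_sub_le {f : E → F} {K : ℝ} (h : ∀ a b, ‖f a - f b‖ ≤ K * ‖a - b‖) : LipBdd f :=
  fun _ => ⟨|K|, abs_nonneg K, fun a b _ _ =>
    (h a b).trans (mul_le_mul_of_nonneg_right (le_abs_self K) (norm_nonneg _))⟩

theorem id : LipBdd (fun a : E => a) := of_norm_sub_le (K := 1) fun a b => by simp

theorem fst : LipBdd (fun p : E × F => p.1) := of_norm_sub_le (K := 1) fun a b => by
  rw [one_mul]
  exact norm_fst_le (a - b)

theorem snd : LipBdd (fun p : E × F => p.2) := of_norm_sub_le (K := 1) fun a b => by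
  rw [one_mul]
  exact norm_snd_le (a - b)

theorem comp {f : F → G} {g : E → F} (hf : LipBdd f) (hg : LipBdd g) :
    LipBdd (fun a => f (g a)) := fun R => by
  obtain ⟨C, _, hC⟩ := hg.exists_bound R
  obtain ⟨K, hK0, hK⟩ := hg R
  obtain ⟨K', hK0', hK'⟩ := hf C
  refine ⟨K' * K, by positivity, fun a b ha hb => ?_⟩
  refine (hK' _ _ (hC a ha) (hC b hb)).trans ?_
  rw [mul_assoc]
  exact mul_le_mul_of_nonneg_left (hK a b ha hb) hK0'

theorem add {f g : E → F} (hf : LipBdd f) (hg : LipBdd g) : LipBdd (fun a => f a + g a) :=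
  fun R => by
  obtain ⟨K, hK0, hK⟩ := hf R
  obtain ⟨K', hK0', hK'⟩ := hg R
  refine ⟨K + K', by positivity, fun a b ha hb => ?_⟩
  rw [add_sub_add_comm, add_mul]
  exact (norm_add_le _ _).trans (add_le_add (hK a b ha hb) (hK' a b ha hb))

theorem prodMk {f : E → F} {g : E → G} (hf : LipBdd f) (hg : LipBdd g) :
    LipBdd (fun a => (f a, g a)) := fun R => by
  obtain ⟨K, hK0, hK⟩ := hf R
  obtain ⟨K', hK0', hK'⟩ := hg R
  refine ⟨max K K', le_max_of_le_left hK0, fun a b ha hb => ?_⟩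
  rw [Prod.mk_sub_mk, Prod.norm_mk]
  exact max_le ((hK a b ha hb).trans (by gcongr; exact le_max_left _ _))
    ((hK' a b ha hb).trans (by gcongr; exact le_max_right _ _))

theorem of_clm [NormedSpace ℂ E] [NormedSpace ℂ F] (T : E →L[ℂ] F) : LipBdd (fun a => T a) :=
  of_norm_sub_le (K := ‖T‖) fun a b => by
    rw [← map_sub]
    exact T.le_opNorm _

theorem clm [NormedSpace ℂ F] [NormedSpace ℂ G] (T : F →L[ℂ] G) {f : E → F} (hf : LipBdd f) :
    LipBdd (fun a => T (f a)) := (of_clm T).comp hf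

theorem smul [NormedSpace ℂ F] (c : ℂ) {f : E → F} (hf : LipBdd f) : LipBdd (fun a => c • f a) :=
  clm (c • ContinuousLinearMap.id ℂ F) hf

theorem neg [NormedSpace ℂ F] {f : E → F} (hf : LipBdd f) : LipBdd (fun a => -f a) :=
  clm (-ContinuousLinearMap.id ℂ F) hf

theorem bilin [NormedSpace ℂ F] [NormedSpace ℂ G] [NormedSpace ℂ H] (B : F →L[ℂ] G →L[ℂ] H)
    {f : E → F} {g : E → G} (hf : LipBdd f) (hg : LipBdd g) : LipBdd (fun a => B (f a) (g a)) :=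
  fun R => by
  obtain ⟨K, hK0, hK⟩ := hf R
  obtain ⟨K', hK0', hK'⟩ := hg R
  obtain ⟨C, hC0, hC⟩ := hf.exists_bound R
  obtain ⟨C', hC0', hC'⟩ := hg.exists_bound R
  refine ⟨‖B‖ * K * C' + ‖B‖ * C * K', by positivity, fun a b ha hb => ?_⟩
  have e : B (f a) (g a) - B (f b) (g b) = B (f a - f b) (g a) + B (f b) (g a - g b) := by
    simp only [map_sub, sub_apply]
    abel
  rw [e]
  have h1 : ‖B (f a - f b) (g a)‖ ≤ ‖B‖ * (K * ‖a - b‖) * C' :=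
    (B.le_opNorm₂ _ _).trans (by gcongr; exacts [hK a b ha hb, hC' a ha])
  have h2 : ‖B (f b) (g a - g b)‖ ≤ ‖B‖ * C * (K' * ‖a - b‖) :=
    (B.le_opNorm₂ _ _).trans (by gcongr; exacts [hC b hb, hK' a b ha hb])
  refine (norm_add_le _ _).trans ((add_le_add h1 h2).trans (le_of_eq ?_))
  ring

theorem mul {f g : E → BoundedContinuousFunction ℝ ℂ} (hf : LipBdd f)
    (hg : LipBdd g) : LipBdd (fun a => f a * g a) :=
  bilin (ContinuousLinearMap.mul ℂ (BoundedContinuousFunction ℝ ℂ)) hf hg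

theorem h22conj {f : E → H22} (hf : LipBdd f) : LipBdd (fun a => H22.conj (f a)) :=
  comp (f := H22.conj) (of_norm_sub_le (K := 1) fun a b => by
    rw [← H22.conj_sub, H22.norm_conj, one_mul]) hf

end LipBdd
end

open MeasureTheory
open scoped SchwartzMap ContDiff

noncomputable section

open Set Filter Topology

/-! ### Derivatives in time -/

/-- A product rule for a family `L` that is only jointly continuous and not differentiable in the
parameter. Because g vanishes at t, the difference quotient is `L r` applied to that of g. In the
applications g is a difference such as b(r) - b(t), and the frozen part is differentiated
separately. -/
theorem hasDerivAt_apply_of_eq_zero {F G : Type*} [NormedAddCommGroup F] [NormedSpace ℝ F]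
    [NormedAddCommGroup G] [NormedSpace ℝ G] {L : ℝ → F → G} {g : ℝ → F} {g' : F} {t : ℝ}
    (hL : ContinuousAt (fun p : ℝ × F => L p.1 p.2) (t, g'))
    (hs : ∀ (r c : ℝ) (v : F), L r (c • v) = c • L r v)
    (hg : HasDerivAt g g' t) (h0 : g t = 0) : HasDerivAt (fun r => L r (g r)) (L t g') t := by
  rw [hasDerivAt_iff_tendsto_slope] at hg ⊢
  have h1 : Tendsto (fun r : ℝ => (r, slope g t r)) (𝓝[≠] t) (𝓝 (t, g')) :=
    (tendsto_nhdsWithin_of_tendsto_nhds tendsto_id).prodMk_nhds hg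
  refine (hL.tendsto.comp h1).congr fun r => ?_
  have hz : L t 0 = 0 := by simpa using hs t 0 0
  simp only [Function.comp_apply, slope_def_module, h0, hz, sub_zero, hs]

theorem HasDerivAt.clmC {F G : Type*} [NormedAddCommGroup F] [NormedSpace ℂ F] [NormedSpace ℝ F]
    [IsScalarTower ℝ ℂ F] [NormedAddCommGroup G] [NormedSpace ℂ G] [NormedSpace ℝ G]
    [IsScalarTower ℝ ℂ G] (T : F →L[ℂ] G) {f : ℝ → F} {f' : F} {t : ℝ} (hf : HasDerivAt f f' t) :
    HasDerivAt (fun r => T (f r)) (T f') t :=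
  (T.restrictScalars ℝ).hasFDerivAt.comp_hasDerivAt t hf

theorem hasDerivAt_clm_of_eq_zero {F G : Type*} [NormedAddCommGroup F] [NormedSpace ℂ F]
    [NormedSpace ℝ F] [IsScalarTower ℝ ℂ F] [NormedAddCommGroup G] [NormedSpace ℂ G]
    [NormedSpace ℝ G] [IsScalarTower ℝ ℂ G] {T : ℝ → F →L[ℂ] G} {g : ℝ → F} {g' : F} {t : ℝ}
    (hT : ContinuousAt T t) (hg : HasDerivAt g g' t) (h0 : g t = 0) :
    HasDerivAt (fun r => T r (g r)) (T t g') t :=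
  hasDerivAt_apply_of_eq_zero (L := fun r v => T r v)
    (ContinuousAt.clm_apply (ContinuousAt.comp (x := (t, g')) hT continuousAt_fst) continuousAt_snd)
    (fun r c v => ((T r).restrictScalars ℝ).map_smul c v) hg h0

namespace H22

local notation "⟪" x ", " y "⟫" => inner ℂ x y

theorem inner_jet1_jet0 : ∀ a b : H22, ⟪jet1 a, jet0 b⟫ = -⟪jet0 a, jet1 b⟫ :=
  eq_of_schwartz₂ (by fun_prop) (by fun_prop) fun f g => by
    simp only [jet0_of, jet1_of, Sch.inner_toL2]
    have h : Sch.D (star f * g) = star (Sch.D f) * g + star f * Sch.D g := by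
      ext x; simp
    have := Sch.int_D (star f * g)
    rw [h, map_add] at this
    exact eq_neg_of_add_eq_zero_left this

theorem inner_jet1_jet1 : ∀ a b : H22, ⟪jet1 a, jet1 b⟫ = -⟪jet0 a, jet2 b⟫ :=
  eq_of_schwartz₂ (by fun_prop) (by fun_prop) fun f g => by
    have := inner_jet1_jet0 (of f) (of (Sch.D g))
    simpa using this

theorem inner_jet2_jet0 (a b : H22) : ⟪jet2 a, jet0 b⟫ = -⟪jet1 a, jet1 b⟫ := by
  rw [← inner_conj_symm, ← inner_conj_symm (jet1 a), inner_jet1_jet1]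
  simp

theorem re_inner_comm (x y : L2R) : (⟪x, y⟫).re = (⟪y, x⟫).re := by
  rw [← inner_conj_symm x y, Complex.conj_re]

theorem normSq_eq_re_inner (x : L2R) : ‖x‖ ^ 2 = (⟪x, x⟫).re :=
  (inner_self_eq_norm_sq (𝕜 := ℂ) x).symm

section Deriv

variable {a b : ℝ → H22} {a' b' : L2R} {t : ℝ}

theorem hasDerivAt_inner_of_eq_zero {f g : ℝ → L2R} {g' : L2R} (hf : ContinuousAt f t)
    (hg : HasDerivAt g g' t) (h0 : g t = 0) : HasDerivAt (fun r => ⟪f r, g r⟫) ⟪f t, g'⟫ t :=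
  hasDerivAt_apply_of_eq_zero (L := fun r v => ⟪f r, v⟫)
    (ContinuousAt.inner (𝕜 := ℂ) (hf.comp (x := (t, g')) continuousAt_fst) continuousAt_snd)
    (fun r c v => by rw [inner_smul_right_eq_smul]) hg h0

/-- Only the L² functions a and b are differentiable in time; a_x is merely continuous. The
increment of b is paired with a_x(r), and in the part with b(t) frozen the space derivative is moved
onto b(t). -/
theorem hasDerivAt_inner_jet1_jet0 (ha : ContinuousAt a t)
    (hda : HasDerivAt (fun r => jet0 (a r)) a' t) (hdb : HasDerivAt (fun r => jet0 (b r)) b' t) :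
    HasDerivAt (fun r => ⟪jet1 (a r), jet0 (b r)⟫) (⟪jet1 (a t), b'⟫ - ⟪a', jet1 (b t)⟫) t := by
  have h1 := hasDerivAt_inner_of_eq_zero (f := fun r => jet1 (a r)) (by fun_prop)
    (hdb.sub_const (jet0 (b t))) (sub_self _)
  have h2 := HasDerivAt.inner ℂ hda (hasDerivAt_const t (jet1 (b t)))
  rw [inner_zero_right, zero_add] at h2
  refine (h1.sub h2).congr_of_eventuallyEq (Eventually.of_forall fun r => ?_) |>.congr_deriv rfl
  simp [inner_sub_right, inner_jet1_jet0]

theorem hasDerivAt_inner_jet1_jet1 (ha : ContinuousAt a t)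
    (hda : HasDerivAt (fun r => jet0 (a r)) a' t) (hdb : HasDerivAt (fun r => jet0 (b r)) b' t) :
    HasDerivAt (fun r => ⟪jet1 (a r), jet1 (b r)⟫) (-⟪jet2 (a t), b'⟫ - ⟪a', jet2 (b t)⟫) t := by
  have h1 := hasDerivAt_inner_of_eq_zero (f := fun r => jet2 (a r)) (by fun_prop)
    (hdb.sub_const (jet0 (b t))) (sub_self _)
  have h2 := HasDerivAt.inner ℂ hda (hasDerivAt_const t (jet2 (b t)))
  rw [inner_zero_right, zero_add] at h2
  refine (h1.neg.sub h2).congr_of_eventuallyEq (Eventually.of_forall fun r => ?_)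
  simp [inner_sub_right, inner_jet2_jet0, inner_jet1_jet1]

theorem hasDerivAt_normSq_jet0 (hda : HasDerivAt (fun r => jet0 (a r)) a' t) :
    HasDerivAt (fun r => ‖jet0 (a r)‖ ^ 2) (2 * (⟪jet0 (a t), a'⟫).re) t := by
  have h := Complex.reCLM.hasFDerivAt.comp_hasDerivAt t (HasDerivAt.inner ℂ hda hda)
  refine (h.congr_of_eventuallyEq (Eventually.of_forall fun r => ?_)).congr_deriv ?_
  · exact normSq_eq_re_inner _
  · rw [map_add, two_mul]
    exact congrArg _ (re_inner_comm _ _)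

theorem hasDerivAt_normSq_jet1_sub_jet0 (ha : ContinuousAt a t) (hb : ContinuousAt b t)
    (hda : HasDerivAt (fun r => jet0 (a r)) a' t) (hdb : HasDerivAt (fun r => jet0 (b r)) b' t) :
    HasDerivAt (fun r => ‖jet1 (a r) - jet0 (b r)‖ ^ 2)
      (-2 * (⟪jet2 (a t) - jet1 (b t), a'⟫ + ⟪jet1 (a t) - jet0 (b t), b'⟫).re) t := by
  have h1 := hasDerivAt_inner_jet1_jet1 ha hda hda
  have h2 := hasDerivAt_inner_jet1_jet0 ha hda hdb
  have h3 := hasDerivAt_inner_jet1_jet0 hb hdb hda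
  have h4 := HasDerivAt.inner ℂ hdb hdb
  have h := Complex.reCLM.hasFDerivAt.comp_hasDerivAt t (((h1.sub h2).add h3).add h4)
  refine (h.congr_of_eventuallyEq (Eventually.of_forall fun r => ?_)).congr_deriv ?_
  · rw [normSq_eq_re_inner]
    rw [inner_sub_left, inner_sub_right, inner_sub_right]
    simp only [Complex.reCLM_apply, Function.comp, Pi.add_apply, Pi.sub_apply, Complex.add_re,
      Complex.sub_re, inner_jet1_jet0 (b r), Complex.neg_re]
    ring
  · simp [inner_sub_left, re_inner_comm a', re_inner_comm b']
    ring

theorem hasDerivAt_jet0_mul (ha : ContinuousAt a t)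
    (hda : HasDerivAt (fun r => jet0 (a r)) a' t) (hdb : HasDerivAt (fun r => jet0 (b r)) b' t) :
    HasDerivAt (fun r => jet0 (mul (a r) (b r)))
      (bcfMul (bdd0 (a t)) b' + bcfMul (bdd0 (b t)) a') t := by
  have h1 := hasDerivAt_clm_of_eq_zero (T := fun r => bcfMul (bdd0 (a r))) (by fun_prop)
    (hdb.sub_const (jet0 (b t))) (sub_self _)
  have h2 := hda.clmC (bcfMul (bdd0 (b t)))
  refine (h1.add h2).congr_of_eventuallyEq (Eventually.of_forall fun r => ?_)
  simp [bdd0_jet0_comm (b t)]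

theorem hasDerivAt_jet0_conj (hda : HasDerivAt (fun r => jet0 (a r)) a' t) :
    HasDerivAt (fun r => jet0 (conj (a r))) (conjL2 a') t := by
  simpa only [jet0_conj, Function.comp_def] using conjL2.hasFDerivAt.comp_hasDerivAt t hda

end Deriv

/-! ### The forced Schrödinger equation -/

theorem mom1jet1_free (t : ℝ) : ∀ q, mom1jet1 (free t q) =
    freeL2 t (mom1jet1 q - (2 * t * Complex.I) • jet2 q) :=
  eq_of_schwartz (by fun_prop) (by fun_prop) fun f => by
    have := mom1_free t (of (Sch.D f))
    simpa [Sch.group_D] using this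

/-- The equation `A_t = i A_xx + n` holds at time `t`, as a derivative in `H^{2,2}(ℝ)` after the
free evolution has been undone. -/
def ForcedAt (A : ℝ → H22) (n : H22) (t : ℝ) : Prop :=
  HasDerivAt (fun r => free (-r) (A r)) (free (-t) n) t

namespace ForcedAt

variable {A B : ℝ → H22} {n m : H22} {t : ℝ}

theorem sub (hA : ForcedAt A n t) (hB : ForcedAt B m t) :
    ForcedAt (fun r => A r - B r) (n - m) t := by
  simpa only [ForcedAt, map_sub, Pi.sub_def] using HasDerivAt.sub hA hB

theorem continuousAt (hA : ForcedAt A n t) : ContinuousAt A t := by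
  have h : ContinuousAt (fun r => (r, free (-r) (A r))) t :=
    continuousAt_id.prodMk (HasDerivAt.continuousAt hA)
  have := ContinuousAt.comp (x := t) (f := fun r => (r, free (-r) (A r)))
    continuous_free_uncurry.continuousAt h
  simpa only [Function.comp_def, free_free_neg] using this

theorem hasDerivAt_clm (hA : ForcedAt A n t) (T : H22 →L[ℂ] L2R) :
    HasDerivAt (fun r => T (free (-r) (A r))) (T (free (-t) n)) t :=
  HasDerivAt.clmC T hA

/-- With w(r) the pulled-back solution, A(r) = U(r)w(t) + U(r)(w(r) - w(t)). The generator acts on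
the first term, and strong continuity of U suffices for the second. -/
theorem hasDerivAt_jet0 (hA : ForcedAt A n t) :
    HasDerivAt (fun r => jet0 (A r)) (Complex.I • jet2 (A t) + jet0 n) t := by
  have h1 := hasDerivAt_apply_of_eq_zero (L := fun r v => freeL2 r v)
    continuous_freeL2_uncurry.continuousAt (fun r c v => by simp)
    ((hA.hasDerivAt_clm jet0).sub_const (jet0 (free (-t) (A t)))) (sub_self _)
  have h2 := hasDerivAt_freeL2 (free (-t) (A t)) t
  refine ((h2.add h1).congr_of_eventuallyEq (Eventually.of_forall fun r => ?_)).congr_deriv ?_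
  · simp [jet0_free]
  · simp [jet0_free, jet2_free]

theorem hasDerivAt_freeL2_jet0 (hA : ForcedAt A n t) :
    HasDerivAt (fun r => freeL2 (-r) (jet0 (A r))) (freeL2 (-t) (jet0 n)) t := by
  simpa only [jet0_free] using hA.hasDerivAt_clm jet0

theorem hasDerivAt_freeL2_jet1 (hA : ForcedAt A n t) :
    HasDerivAt (fun r => freeL2 (-r) (jet1 (A r))) (freeL2 (-t) (jet1 n)) t := by
  simpa only [jet1_free] using hA.hasDerivAt_clm jet1

theorem hasDerivAt_two_mul_smul (c : ℂ) (hA : ForcedAt A n t) (T : H22 →L[ℂ] L2R) :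
    HasDerivAt (fun r : ℝ => (c * r) • T (free (-r) (A r)))
      ((c * t) • T (free (-t) n) + c • T (free (-t) (A t))) t := by
  have h : HasDerivAt (fun r : ℝ => c * (r : ℂ)) c t := by
    simpa using (Complex.ofRealCLM.hasDerivAt (x := t)).const_mul c
  exact h.smul (hA.hasDerivAt_clm T)

theorem hasDerivAt_freeL2_mom1 (hA : ForcedAt A n t) :
    HasDerivAt (fun r => freeL2 (-r) (mom1 (A r)))
      (freeL2 (-t) (mom1 n - (2 * Complex.I) • jet1 (A t))) t := by
  have h := (hA.hasDerivAt_clm mom1).sub (hA.hasDerivAt_two_mul_smul (2 * Complex.I) jet1)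
  refine (h.congr_of_eventuallyEq (Eventually.of_forall fun r => ?_)).congr_deriv ?_
  · simp [mom1_free, jet1_free]
    module
  · simp [mom1_free, jet1_free]
    module

/-- The commutation formula for x² has coefficients polynomial in time. Differentiating them yields
the commutator term, which contains xq' and q but no second derivative; this lets weighted L² norms
be propagated without their derivatives. -/
theorem hasDerivAt_freeL2_mom2 (hA : ForcedAt A n t) :
    HasDerivAt (fun r => freeL2 (-r) (mom2 (A r)))
      (freeL2 (-t) (mom2 n - (2 * Complex.I) • ((2 : ℂ) • mom1jet1 (A t) + jet0 (A t)))) t := by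
  have hs : HasDerivAt (fun r : ℝ => 4 * (r : ℂ) ^ 2) (8 * (t : ℂ)) t := by
    have h : HasDerivAt (fun r : ℝ => (r : ℂ)) 1 t := by
      exact (hasDerivAt_id t).ofReal_comp
    refine ((h.pow 2).const_mul (4 : ℂ)).congr_deriv ?_
    simp
    ring
  have h := ((hA.hasDerivAt_clm mom2).sub
    (hA.hasDerivAt_two_mul_smul (2 * Complex.I) ((2 : ℂ) • mom1jet1 + jet0))).sub
    (hs.smul (hA.hasDerivAt_clm jet2))
  have hI := Complex.I_mul_I
  refine (h.congr_of_eventuallyEq (Eventually.of_forall fun r => ?_)).congr_deriv ?_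
  · simp [mom2_free, jet0_free, jet2_free, mom1jet1_free]
    match_scalars <;> first
      | ring1
      | linear_combination (8 * (r : ℂ) ^ 2) * hI
  · simp [mom2_free, jet0_free, jet2_free, mom1jet1_free]
    match_scalars <;> first
      | ring1
      | linear_combination (-8 * (t : ℂ)) * hI
      | linear_combination (-8 * (t : ℂ) ^ 2) * hI

end ForcedAt

end H22
end

/-! ### The gauge-transformed system and propagation of its constraint -/

open MeasureTheory
open scoped SchwartzMap ContDiff

noncomputable section

open Set Filter Topology

theorem Sch.int_star (f : 𝓢(ℝ, ℂ)) : Sch.int (star f) = (starRingEnd ℂ) (Sch.int f) := by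
  simp only [Sch.int_apply, Sch.star_apply]
  exact integral_conj

/-- The energy identities for real parts below are reduced to this form: an explicit primitive W is
exhibited and the claim becomes pointwise algebra. -/
theorem Sch.re_int_eq_zero {Q W : 𝓢(ℝ, ℂ)} (h : Q + star Q = Sch.D W) : (Sch.int Q).re = 0 := by
  have h1 := Sch.int_D W
  rw [← h, map_add, Sch.int_star, Complex.add_conj] at h1
  simpa using h1

/-- Gronwall's inequality on a compact interval [-σ, σ] around t, where k is bounded. -/
theorem eq_zero_of_abs_deriv_le {f f' k : ℝ → ℝ} {τ : ℝ} (h0 : f 0 = 0)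
    (hd : ∀ t ∈ Ioo (-τ) τ, HasDerivAt f (f' t) t) (hk : ContinuousOn k (Ioo (-τ) τ))
    (hb : ∀ t ∈ Ioo (-τ) τ, |f' t| ≤ k t * |f t|) : ∀ t ∈ Ioo (-τ) τ, f t = 0 := by
  intro t ht
  obtain ⟨σ, h1, h2⟩ := exists_between (abs_lt.2 ht)
  have hsub : ∀ s ∈ Icc (-σ) σ, s ∈ Ioo (-τ) τ := fun s hs =>
    ⟨by linarith [hs.1], by linarith [hs.2]⟩
  obtain ⟨K, hK⟩ := isCompact_Icc.exists_bound_of_continuousOn (hk.mono hsub)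
  have h := norm_le_exp_of_norm_deriv_le (K := K) (fun s hs => hd s (hsub s (Ioo_subset_Icc_self hs)))
    (fun s hs => (hb s (hsub s (Ioo_subset_Icc_self hs))).trans
      (mul_le_mul_of_nonneg_right ((le_abs_self _).trans (hK s (Ioo_subset_Icc_self hs)))
        (abs_nonneg _))) t (abs_lt.1 h1)
  rw [h0, norm_zero, zero_mul] at h
  exact norm_le_zero_iff.1 h

theorem eq_of_deriv_eq_zero {E : Type*} [NormedAddCommGroup E] [NormedSpace ℝ E] {f : ℝ → E}
    {τ : ℝ} (hd : ∀ t ∈ Ioo (-τ) τ, HasDerivAt f 0 t) : ∀ t ∈ Ioo (-τ) τ, f t = f 0 := by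
  intro t ht
  have h := norm_le_exp_of_norm_deriv_le (K := 0) (f := fun s => f s - f 0) (f' := fun _ => 0)
    (fun s hs => (hd s hs).sub_const _) (fun s _ => by simp) t ht
  simpa [sub_eq_zero] using h

namespace H22

local notation "⟪" x ", " y "⟫" => inner ℂ x y

/-- The product of three elements of `H^{2,2}(ℝ)`. -/
def cub (a b c : H22) : H22 := mul a (mul b c)

@[fun_prop]
theorem _root_.Continuous.h22cub {Z : Type*} [TopologicalSpace Z] {a b c : Z → H22}
    (ha : Continuous a) (hb : Continuous b) (hc : Continuous c) :
    Continuous fun z => cub (a z) (b z) (c z) := ha.h22mul (hb.h22mul hc)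

@[simp] theorem cub_of (f g h : 𝓢(ℝ, ℂ)) : cub (of f) (of g) (of h) = of (f * (g * h)) := by
  simp [cub]

/-- The element `b - (i/2)|a|²a`, which equals `a'` along the gauge-transformed flow. -/
def velo (a b : H22) : H22 := b - (Complex.I / 2) • cub a a (conj a)

@[fun_prop]
theorem _root_.Continuous.h22velo {Z : Type*} [TopologicalSpace Z] {a b : Z → H22}
    (ha : Continuous a) (hb : Continuous b) : Continuous fun z => velo (a z) (b z) := by
  unfold velo
  fun_prop

@[simp] theorem velo_of (f g : 𝓢(ℝ, ℂ)) :
    velo (of f) (of g) = of (g - (Complex.I / 2) • (f * (f * star f))) := by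
  simp [velo]

/-- The time derivative of `a` along the flow, where `b` is the other unknown. -/
def rateFst (a b : H22) : L2R := Complex.I • jet2 a - jet0 (cub a a (conj b))

/-- The time derivative of `b` along the flow, where `a` is the other unknown. -/
def rateSnd (a b : H22) : L2R := Complex.I • jet2 b + jet0 (cub b b (conj a))

/-- The time derivative of `|a|²a` when that of `a` is `a'`. -/
def rateCub (a : H22) (a' : L2R) : L2R :=
  bcfMul (bdd0 a) (bcfMul (bdd0 a) (conjL2 a') + bcfMul (bdd0 (conj a)) a') +
    bcfMul (bdd0 (mul a (conj a))) a'

/-- The time derivative of `velo a b` along the flow. -/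
def rateVelo (a b : H22) : L2R := rateSnd a b - (Complex.I / 2) • rateCub a (rateFst a b)

/-- The defect of the constraint `a' = b - (i/2)|a|²a`. -/
def defect (a b : H22) : L2R := jet1 a - jet0 (velo a b)

@[fun_prop]
theorem continuous_rateFst {Z : Type*} [TopologicalSpace Z] {a b : Z → H22}
    (ha : Continuous a) (hb : Continuous b) : Continuous fun z => rateFst (a z) (b z) := by
  unfold rateFst
  fun_prop

@[fun_prop]
theorem continuous_rateSnd {Z : Type*} [TopologicalSpace Z] {a b : Z → H22}
    (ha : Continuous a) (hb : Continuous b) : Continuous fun z => rateSnd (a z) (b z) := by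
  unfold rateSnd
  fun_prop

@[fun_prop]
theorem continuous_rateVelo {Z : Type*} [TopologicalSpace Z] {a b : Z → H22}
    (ha : Continuous a) (hb : Continuous b) : Continuous fun z => rateVelo (a z) (b z) := by
  unfold rateVelo rateCub
  fun_prop

@[fun_prop]
theorem continuous_defect {Z : Type*} [TopologicalSpace Z] {a b : Z → H22}
    (ha : Continuous a) (hb : Continuous b) : Continuous fun z => defect (a z) (b z) := by
  unfold defect
  fun_prop

section Of

variable (f g : 𝓢(ℝ, ℂ))

theorem rateFst_of : rateFst (of f) (of g) =
    Sch.toL2 (Complex.I • Sch.D (Sch.D f) - f * (f * star g)) := by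
  simp [rateFst]

theorem rateSnd_of : rateSnd (of f) (of g) =
    Sch.toL2 (Complex.I • Sch.D (Sch.D g) + g * (g * star f)) := by
  simp [rateSnd]

theorem rateCub_of : rateCub (of f) (Sch.toL2 g) =
    Sch.toL2 (f * (f * star g + star f * g) + f * star f * g) := by
  simp [rateCub, -map_add, ← map_add Sch.toL2]

theorem defect_of : defect (of f) (of g) =
    Sch.toL2 (Sch.D f - g + (Complex.I / 2) • (f * (f * star f))) := by
  simp [defect]
  module

end Of

/-- The coefficient of the conjugate in the equation for the defect. -/
def defectCoeff (a b : H22) : L2R :=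
  bcfMul (bdd0 a * bdd1 a) (conjL2 (defect a b)) +
    Complex.I • bcfMul (bdd0 a * star (bdd0 a) * bdd0 a * bdd0 a) (conjL2 (defect a b)) +
    bcfMul (star (bdd0 a) * (bdd1 a + bdd0 b)) (defect a b)

/-- The left side is minus half the time derivative of ‖d‖², where d is the defect, written so that
no derivative of the rates is needed. Along the flow d_t = i d_xx + a² d̄_x + 2aa_x d̄ + i|a|²a² d̄
+ ā(a_x + b)d + i|a|⁴d. Paired with d, the first and last terms have no real part, and a² d̄_x
becomes -aa_x d̄, so only terms of order zero in d survive. -/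
theorem re_inner_defect : ∀ a b : H22,
    (⟪jet2 a - jet1 (velo a b), rateFst a b⟫ + ⟪defect a b, rateVelo a b⟫).re =
      -(⟪defect a b, defectCoeff a b⟫).re :=
  eq_of_schwartz₂ (by fun_prop) (by unfold defectCoeff; fun_prop) fun f g => by
    obtain ⟨d, hd⟩ : ∃ d, d = Sch.D f - g + (Complex.I / 2) • (f * (f * star f)) := ⟨_, rfl⟩
    obtain ⟨A, hA⟩ : ∃ A, A = Complex.I • Sch.D (Sch.D f) - f * (f * star g) := ⟨_, rfl⟩
    obtain ⟨V, hV⟩ : ∃ V, V = Complex.I • Sch.D (Sch.D g) + g * (g * star f) - (Complex.I / 2) •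
      (f * (f * star A + star f * A) + f * star f * A) := ⟨_, rfl⟩
    have h1 : Sch.D A - V = Complex.I • Sch.D (Sch.D d) + f * f * star (Sch.D d) +
        (2 : ℂ) • (f * Sch.D f * star d) + Complex.I • (f * star f * f * f * star d) +
        star f * (Sch.D f + g) * d + Complex.I • (f * star f * f * star f * d) := by
      ext x
      simp [hA, hV, hd]
      ring_nf
      simp [Complex.I_sq]
      ring
    have h2 : jet2 (of f) - jet1 (velo (of f) (of g)) = Sch.toL2 (Sch.D d) := by
      rw [hd]
      simp
      module
    have h3 : rateVelo (of f) (of g) = Sch.toL2 V := by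
      rw [rateVelo, rateSnd_of, rateFst_of, ← hA, rateCub_of, hV, map_sub, map_smul]
    rw [h2, h3, rateFst_of, ← hA, defectCoeff, defect_of, ← hd]
    obtain ⟨B, hB⟩ : ∃ B, B = f * Sch.D f * star d + Complex.I • (f * star f * f * f * star d) +
      star f * (Sch.D f + g) * d := ⟨_, rfl⟩
    have h4 : bcfMul (bdd0 (of f) * bdd1 (of f)) (conjL2 (Sch.toL2 d)) +
        Complex.I • bcfMul (bdd0 (of f) * star (bdd0 (of f)) * bdd0 (of f) * bdd0 (of f))
          (conjL2 (Sch.toL2 d)) +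
        bcfMul (star (bdd0 (of f)) * (bdd1 (of f) + bdd0 (of g))) (Sch.toL2 d) = Sch.toL2 B := by
      rw [hB]
      simp only [bdd0_of, bdd1_of, Sch.star_toB]
      rw [← map_add Sch.toB (Sch.D f) g]
      simp only [Sch.toB_mul, conjL2_toL2, bcfMul_toB]
      simp only [map_add, map_smul]
    rw [h4, ← add_eq_zero_iff_eq_neg, ← Complex.add_re, Sch.inner_toL2, Sch.inner_toL2,
      Sch.inner_toL2, ← map_add, ← map_add]
    have h5 : V = Sch.D A - (Complex.I • Sch.D (Sch.D d) + f * f * star (Sch.D d) +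
        (2 : ℂ) • (f * Sch.D f * star d) + Complex.I • (f * star f * f * f * star d) +
        star f * (Sch.D f + g) * d + Complex.I • (f * star f * f * star f * d)) := by
      rw [← h1, sub_sub_cancel]
    refine Sch.re_int_eq_zero (W := star d * A + d * star A - Complex.I • (star d * Sch.D d) +
      Complex.I • (d * star (Sch.D d)) - (1 / 2 : ℂ) • (star d * star d * (f * f)) -
      (1 / 2 : ℂ) • (d * d * (star f * star f))) ?_
    clear h4 h3 h2 h1 hV hA hd
    ext x
    simp [h5, hB]
    ring

theorem exists_re_inner_defectCoeff_le : ∃ k : H22 → H22 → ℝ,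
    (Continuous fun p : H22 × H22 => k p.1 p.2) ∧
      ∀ a b, |(⟪defect a b, defectCoeff a b⟫).re| ≤ k a b * ‖defect a b‖ ^ 2 := by
  refine ⟨fun a b => ‖bdd0 a * bdd1 a‖ + ‖bdd0 a * star (bdd0 a) * bdd0 a * bdd0 a‖ +
    ‖star (bdd0 a) * (bdd1 a + bdd0 b)‖, by fun_prop, fun a b => ?_⟩
  have h1 : ‖defectCoeff a b‖ ≤ (‖bdd0 a * bdd1 a‖ +
      ‖bdd0 a * star (bdd0 a) * bdd0 a * bdd0 a‖ + ‖star (bdd0 a) * (bdd1 a + bdd0 b)‖) *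
        ‖defect a b‖ := by
    rw [defectCoeff, add_mul, add_mul]
    refine norm_add₃_le.trans (add_le_add_three ?_ ?_ (norm_bcfMul_le _ _))
    · simpa using norm_bcfMul_le (bdd0 a * bdd1 a) (conjL2 (defect a b))
    · simpa [norm_smul] using norm_bcfMul_le (bdd0 a * star (bdd0 a) * bdd0 a * bdd0 a)
        (conjL2 (defect a b))
  refine (Complex.abs_re_le_norm _).trans ((norm_inner_le_norm _ _).trans ?_)
  nlinarith [norm_nonneg (defect a b)]

/-- The gauge-transformed system holds at time `t`. -/
structure SystemAt (φ ψ : ℝ → H22) (t : ℝ) : Prop where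
  fst : ForcedAt φ (-cub (φ t) (φ t) (conj (ψ t))) t
  snd : ForcedAt ψ (cub (ψ t) (ψ t) (conj (φ t))) t

namespace SystemAt

variable {φ ψ : ℝ → H22} {t τ : ℝ}

theorem hasDerivAt_fst (h : SystemAt φ ψ t) :
    HasDerivAt (fun r => jet0 (φ r)) (rateFst (φ t) (ψ t)) t := by
  simpa only [rateFst, map_neg, ← sub_eq_add_neg] using h.fst.hasDerivAt_jet0

theorem hasDerivAt_snd (h : SystemAt φ ψ t) :
    HasDerivAt (fun r => jet0 (ψ r)) (rateSnd (φ t) (ψ t)) t := h.snd.hasDerivAt_jet0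

theorem hasDerivAt_velo (h : SystemAt φ ψ t) :
    HasDerivAt (fun r => jet0 (velo (φ r) (ψ r))) (rateVelo (φ t) (ψ t)) t := by
  have hc := h.fst.continuousAt
  have h1 := h.hasDerivAt_fst
  have h2 := hasDerivAt_jet0_mul hc h1 (hasDerivAt_jet0_conj h1)
  have h3 := hasDerivAt_jet0_mul (b := fun r => mul (φ r) (conj (φ r))) hc h1 h2
  have h4 := h.hasDerivAt_snd.sub
    (h3.clmC ((Complex.I / 2) • ContinuousLinearMap.id ℂ L2R))
  refine (h4.congr_of_eventuallyEq (Eventually.of_forall fun r => ?_)).congr_deriv rfl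
  simp [velo, cub]

theorem continuousAt_velo (h : SystemAt φ ψ t) : ContinuousAt (fun r => velo (φ r) (ψ r)) t :=
  ContinuousAt.comp (g := fun p : H22 × H22 => velo p.1 p.2) (f := fun r => (φ r, ψ r))
    (Continuous.continuousAt (by fun_prop)) (h.fst.continuousAt.prodMk h.snd.continuousAt)

/-- The squared norm of the defect satisfies a homogeneous linear differential inequality with zero
initial value. -/
theorem defect_eq_zero (h : ∀ t ∈ Ioo (-τ) τ, SystemAt φ ψ t) (h0 : defect (φ 0) (ψ 0) = 0) :
    ∀ t ∈ Ioo (-τ) τ, defect (φ t) (ψ t) = 0 := by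
  obtain ⟨k, hk, hkb⟩ := exists_re_inner_defectCoeff_le
  intro t ht
  have key := eq_zero_of_abs_deriv_le (f := fun t => ‖defect (φ t) (ψ t)‖ ^ 2)
    (k := fun t => 2 * k (φ t) (ψ t)) (by simp [h0])
    (fun t ht => hasDerivAt_normSq_jet1_sub_jet0 (h t ht).fst.continuousAt
      (h t ht).continuousAt_velo (h t ht).hasDerivAt_fst (h t ht).hasDerivAt_velo)
    (fun t ht => ContinuousAt.continuousWithinAt <| continuousAt_const.mul <|
      ContinuousAt.comp (g := fun p : H22 × H22 => k p.1 p.2) (f := fun r => (φ r, ψ r))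
      hk.continuousAt ((h t ht).fst.continuousAt.prodMk (h t ht).snd.continuousAt)) ?_ t ht
  · simpa using key
  · intro t ht
    have e := re_inner_defect (φ t) (ψ t)
    rw [defect] at e
    rw [e, ← defect, abs_of_nonneg (sq_nonneg ‖defect (φ t) (ψ t)‖)]
    have := hkb (φ t) (ψ t)
    rw [neg_mul_neg, abs_mul, abs_two]
    linarith

end SystemAt

end H22
end

/-! ### Conserved quantities and the tame cubic estimate -/

open MeasureTheory
open scoped SchwartzMap ContDiff

noncomputable section

open Set Filter Topology

namespace H22

local notation "⟪" x ", " y "⟫" => inner ℂ x y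

theorem inner_jet0_jet1 (a b : H22) : ⟪jet0 a, jet1 b⟫ = -⟪jet1 a, jet0 b⟫ := by
  rw [inner_jet1_jet0, neg_neg]

theorem eq_of_inner_toL2 {x y : L2R} (h : ∀ f, ⟪Sch.toL2 f, x⟫ = ⟪Sch.toL2 f, y⟫) : x = y := by
  have : (fun z : L2R => ⟪z, x⟫) = fun z => ⟪z, y⟫ :=
    Sch.denseRange_toL2.equalizer (by fun_prop) (by fun_prop) (funext h)
  exact ext_inner_left ℂ fun z => congrFun this z

/-- The identity q' = p is differentiated weakly, against Schwartz functions. This and its weighted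
analogue trade the top norms of φ for lower norms of ψ. -/
theorem jet2_eq_of_jet1_eq {a p : H22} (h : jet1 a = jet0 p) : jet2 a = jet1 p :=
  eq_of_inner_toL2 fun f => by
    have h1 := inner_jet1_jet1 (of f) a
    have h2 := inner_jet1_jet0 (of f) p
    rw [h] at h1
    rw [h1, neg_inj] at h2
    simpa using h2

theorem mom1jet1_eq_of_jet1_eq {a p : H22} (h : jet1 a = jet0 p) : mom1jet1 a = mom1 p := by
  have key : ∀ (f : 𝓢(ℝ, ℂ)) (q : H22),
      ⟪Sch.toL2 f, mom1jet1 q⟫ = ⟪Sch.toL2 (Sch.X f), jet1 q⟫ := fun f =>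
    eq_of_schwartz (by fun_prop) (by fun_prop) fun g => by
      simp only [mom1jet1_of, jet1_of, Sch.inner_toL2]
      congr 1
      ext x
      simp
      ring
  have key' : ∀ (f : 𝓢(ℝ, ℂ)) (q : H22),
      ⟪Sch.toL2 f, mom1 q⟫ = ⟪Sch.toL2 (Sch.X f), jet0 q⟫ := fun f =>
    eq_of_schwartz (by fun_prop) (by fun_prop) fun g => by
      simp only [mom1_of, jet0_of, Sch.inner_toL2]
      congr 1
      ext x
      simp
      ring
  exact eq_of_inner_toL2 fun f => by rw [key, key', h]

/-- Conservation of mass, up to the defect d. Inserting b = a_x + (i/2)|a|²a - d makes everything a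
total derivative except the pairing with d. -/
theorem re_inner_rateFst : ∀ a b : H22,
    (⟪jet0 a, rateFst a b⟫).re = (⟪defect a b, jet0 (cub a a (conj a))⟫).re :=
  eq_of_schwartz₂ (by fun_prop) (by fun_prop) fun f g => by
    rw [rateFst_of, defect_of, conj_of, cub_of, jet0_of, jet0_of, Sch.inner_toL2, Sch.inner_toL2,
      ← sub_eq_zero, ← Complex.sub_re, ← map_sub]
    refine Sch.re_int_eq_zero (W := Complex.I • (star f * Sch.D f) -
      Complex.I • (f * star (Sch.D f)) - (1 / 2 : ℂ) • (f * star f * (f * star f))) ?_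
    ext x
    simp
    ring

/-- Conservation of ∫ψ̄_x φ; it does not require the constraint. -/
theorem inner_rate_eq_zero : ∀ a b : H22,
    ⟪jet1 b, rateFst a b⟫ - ⟪rateSnd a b, jet1 a⟫ = 0 :=
  eq_of_schwartz₂ (by fun_prop) (by fun_prop) fun f g => by
    rw [rateFst_of, rateSnd_of, jet1_of, jet1_of, Sch.inner_toL2, Sch.inner_toL2, ← map_sub]
    have h : star (Sch.D g) * (Complex.I • Sch.D (Sch.D f) - f * (f * star g)) -
        star (Complex.I • Sch.D (Sch.D g) + g * (g * star f)) * Sch.D f =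
        Sch.D (Complex.I • (star (Sch.D g) * Sch.D f) -
          (1 / 2 : ℂ) • (star g * star g * (f * f))) := by
      ext x
      simp
      ring
    rw [h, Sch.int_D]

/-- The quadratic part of the energy at the level of two derivatives, together with its quartic
correction. -/
def energy (a b : H22) : ℂ :=
  ⟪jet1 b, jet1 (velo a b)⟫ + (3 * Complex.I / 4) * ⟪jet1 (mul b b), jet0 (mul a a)⟫

/-- Here p stands for `velo a b` and is left free to keep the identity algebraic. With p_t = ip_xx -
(a²b̄)_x the left side is the time derivative of `energy`. Modulo a total derivative, each remaining
term has the factor a_x - p, which vanishes on the constraint. -/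
theorem inner_rate_energy : ∀ a b p : H22,
    -⟪jet2 b, Complex.I • jet2 p - jet1 (cub a a (conj b))⟫ - ⟪rateSnd a b, jet2 p⟫ +
      (3 * Complex.I / 4) * (⟪jet1 (mul b b),
          bcfMul (bdd0 a) (rateFst a b) + bcfMul (bdd0 a) (rateFst a b)⟫ -
        ⟪bcfMul (bdd0 b) (rateSnd a b) + bcfMul (bdd0 b) (rateSnd a b), jet1 (mul a a)⟫) =
      ⟪jet2 b, (2 : ℂ) • bcfMul (bdd0 a * star (bdd0 b)) (jet1 a - jet0 p)⟫ +
      ⟪jet1 b, (3 : ℂ) • bcfMul (bdd1 a * star (bdd0 b)) (jet1 a - jet0 p) +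
        (2 : ℂ) • bcfMul (bdd0 a * star (bdd1 b)) (jet1 a - jet0 p) +
        bcfMul (bdd0 p * star (bdd0 b)) (jet1 a - jet0 p)⟫ +
      ⟪jet0 b, bcfMul (star (bdd0 b) * bdd1 p) (jet1 a - jet0 p)⟫ :=
  eq_of_schwartz₃ (by fun_prop) (by fun_prop) fun f g h => by
    have hm : ∀ (c : ℂ) (Q : 𝓢(ℝ, ℂ)), c * Sch.int Q = Sch.int (c • Q) := fun c Q =>
      (Sch.int.map_smul c Q).symm
    rw [rateFst_of, rateSnd_of, ← sub_eq_zero]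
    simp only [conj_of, cub_of, mul_of, jet0_of, jet1_of, jet2_of, bdd0_of, bdd1_of, Sch.star_toB,
      Sch.toB_mul, ← map_sub, bcfMul_toB, ← map_smul, ← map_add, Sch.inner_toL2, hm, ← map_neg]
    refine (congrArg Sch.int ?_).trans (Sch.int_D ((1 / 2 : ℂ) • (f * f * star (Sch.D g) * star (Sch.D g)) -
      (3 : ℂ) • (f * star g * star (Sch.D g) * Sch.D f) -
      Complex.I • (f * f * f * star g * star g * star g) +
      (2 : ℂ) • (f * h * star g * star (Sch.D g)) - star g * star g * f * Sch.D h +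
      (1 / 2 : ℂ) • (h * h * star g * star g)))
    ext x
    simp
    ring_nf
    simp [Complex.I_sq]
    ring

theorem inner_jet1_mul_self : ∀ a b : H22, ⟪jet1 (mul b b), jet0 (mul a a)⟫ =
    ⟪jet1 b, (2 : ℂ) • jet0 (cub a a (conj b))⟫ :=
  eq_of_schwartz₂ (by fun_prop) (by fun_prop) fun f g => by
    simp only [conj_of, cub_of, mul_of, jet0_of, jet1_of, ← map_smul, Sch.inner_toL2]
    congr 1
    ext x
    simp
    ring

namespace SystemAt

variable {φ ψ : ℝ → H22} {t τ : ℝ}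

/-- On the constraint `velo` is φ_x, so for a test function f the pairing ⟨f, velo⟩ equals -⟨f', φ⟩
near time t. Comparing the two time derivatives gives the x-derivative of the equation for φ. -/
theorem rateVelo_eq (h : ∀ t ∈ Ioo (-τ) τ, SystemAt φ ψ t)
    (hd : ∀ t ∈ Ioo (-τ) τ, defect (φ t) (ψ t) = 0) (ht : t ∈ Ioo (-τ) τ) :
    rateVelo (φ t) (ψ t) = Complex.I • jet2 (velo (φ t) (ψ t)) -
      jet1 (cub (φ t) (φ t) (conj (ψ t))) :=
  eq_of_inner_toL2 fun f => by
    have h1 := HasDerivAt.inner ℂ (hasDerivAt_const t (Sch.toL2 f)) (h t ht).hasDerivAt_velo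
    have h2 := HasDerivAt.inner ℂ (hasDerivAt_const t (jet1 (of f))) (h t ht).hasDerivAt_fst
    have h3 := h1.unique (h2.neg.congr_of_eventuallyEq ?_)
    · have e : jet2 (φ t) = jet1 (velo (φ t) (ψ t)) := jet2_eq_of_jet1_eq (sub_eq_zero.1 (hd t ht))
      have e1 := inner_jet1_jet1 (of f) (velo (φ t) (ψ t))
      have e2 := inner_jet1_jet0 (of f) (cub (φ t) (φ t) (conj (ψ t)))
      simp only [inner_zero_left, add_zero] at h3
      rw [h3, rateFst, e, inner_sub_right, inner_smul_right, e1, e2, inner_sub_right,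
        inner_smul_right, jet0_of]
      ring
    · filter_upwards [Ioo_mem_nhds ht.1 ht.2] with s hs
      have e : jet1 (φ s) = jet0 (velo (φ s) (ψ s)) := sub_eq_zero.1 (hd s hs)
      have e1 := inner_jet0_jet1 (of f) (φ s)
      rw [jet0_of] at e1
      rw [← e, e1]
      rfl

theorem mass_eq (h : ∀ t ∈ Ioo (-τ) τ, SystemAt φ ψ t)
    (hd : ∀ t ∈ Ioo (-τ) τ, defect (φ t) (ψ t) = 0) (ht : t ∈ Ioo (-τ) τ) :
    ‖jet0 (φ t)‖ ^ 2 = ‖jet0 (φ 0)‖ ^ 2 :=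
  eq_of_deriv_eq_zero (f := fun t => ‖jet0 (φ t)‖ ^ 2) (fun s hs => by
    have := hasDerivAt_normSq_jet0 (h s hs).hasDerivAt_fst
    rwa [re_inner_rateFst, hd s hs, inner_zero_left, Complex.zero_re, mul_zero] at this) t ht

theorem momentum_eq (h : ∀ t ∈ Ioo (-τ) τ, SystemAt φ ψ t) (ht : t ∈ Ioo (-τ) τ) :
    ⟪jet1 (ψ t), jet0 (φ t)⟫ = ⟪jet1 (ψ 0), jet0 (φ 0)⟫ :=
  eq_of_deriv_eq_zero (f := fun t => ⟪jet1 (ψ t), jet0 (φ t)⟫) (fun s hs => by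
    refine (hasDerivAt_inner_jet1_jet0 (h s hs).snd.continuousAt (h s hs).hasDerivAt_snd
      (h s hs).hasDerivAt_fst).congr_deriv ?_
    exact inner_rate_eq_zero _ _) t ht

theorem energy_eq (h : ∀ t ∈ Ioo (-τ) τ, SystemAt φ ψ t)
    (hd : ∀ t ∈ Ioo (-τ) τ, defect (φ t) (ψ t) = 0) (ht : t ∈ Ioo (-τ) τ) :
    energy (φ t) (ψ t) = energy (φ 0) (ψ 0) :=
  eq_of_deriv_eq_zero (f := fun t => energy (φ t) (ψ t)) (fun s hs => by
    have hs' := h s hs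
    have hc := hs'.fst.continuousAt
    have hc' := hs'.snd.continuousAt
    have h1 := hasDerivAt_inner_jet1_jet1 hc' hs'.hasDerivAt_snd hs'.hasDerivAt_velo
    have hm : ContinuousAt (fun r => mul (ψ r) (ψ r)) s :=
      (Continuous.h22mul continuous_id continuous_id).continuousAt.comp hc'
    have h2 := hasDerivAt_inner_jet1_jet0 (a := fun r => mul (ψ r) (ψ r))
      (b := fun r => mul (φ r) (φ r)) hm
      (hasDerivAt_jet0_mul hc' hs'.hasDerivAt_snd hs'.hasDerivAt_snd)
      (hasDerivAt_jet0_mul hc hs'.hasDerivAt_fst hs'.hasDerivAt_fst)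
    have h3 := HasDerivAt.const_mul (3 * Complex.I / 4) h2
    have h4 := HasDerivAt.fun_add h1 h3
    have hz : jet1 (φ s) - jet0 (velo (φ s) (ψ s)) = 0 := hd s hs
    rw [rateVelo_eq h hd hs, inner_rate_energy, hz] at h4
    simpa only [energy, map_zero, smul_zero, inner_zero_right, add_zero] using h4) t ht

end SystemAt

/-- The low-order norms of `a` are at most `M`. -/
structure LowBound (M : ℝ) (a : H22) : Prop where
  jet0 : ‖jet0 a‖ ≤ M
  jet1 : ‖jet1 a‖ ≤ M
  bdd0 : ‖bdd0 a‖ ≤ M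

theorem LowBound.conj {M : ℝ} {a : H22} (h : LowBound M a) : LowBound M (conj a) :=
  ⟨by simpa using h.jet0, by simpa using h.jet1, by simpa using h.bdd0⟩

theorem norm_bcfMul_le_of_le {b : BoundedContinuousFunction ℝ ℂ} {g : L2R} {B C : ℝ} (hb : ‖b‖ ≤ B)
    (hg : ‖g‖ ≤ C) : ‖bcfMul b g‖ ≤ B * C :=
  (norm_bcfMul_le b g).trans
    (mul_le_mul hb hg (norm_nonneg _) ((norm_nonneg b).trans hb))

/-- A tame estimate: each term of the Leibniz expansion contains one norm bounded by ‖·‖, the other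
two factors being measured in low norms. In products of two first derivatives, one is taken in sup
norm and the other in L². -/
theorem norm_cub_le {M : ℝ} {a b c : H22} (ha : LowBound M a) (hb : LowBound M b)
    (hc : LowBound M c) : ‖cub a b c‖ ≤ 9 * M ^ 2 * (‖a‖ + ‖b‖ + ‖c‖) := by
  have hM : 0 ≤ M := (norm_nonneg _).trans ha.jet0
  have h0 : ‖H22.jet0 (cub a b c)‖ ≤ M * (M * ‖c‖) := by
    simp only [cub, jet0_mul]
    exact norm_bcfMul_le_of_le ha.bdd0 (norm_bcfMul_le_of_le hb.bdd0 (norm_jet0_le c))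
  have h1 : ‖mom2 (cub a b c)‖ ≤ M * (M * ‖c‖) := by
    simp only [cub, mom2_mul]
    exact norm_bcfMul_le_of_le ha.bdd0 (norm_bcfMul_le_of_le hb.bdd0 (norm_mom2_le c))
  have h2 : ‖jet2 (cub a b c)‖ ≤ M * (M * ‖c‖ + 2 * (2 * ‖b‖ * M) + M * ‖b‖) +
      2 * (2 * ‖a‖ * (M * M + M * M)) + M * M * ‖a‖ := by
    rw [cub, jet2_mul]
    refine norm_add₃_le.trans (add_le_add_three (norm_bcfMul_le_of_le ha.bdd0 ?_) ?_
      (norm_bcfMul_le_of_le ?_ (norm_jet2_le a)))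
    · rw [jet2_mul]
      refine norm_add₃_le.trans (add_le_add_three
        (norm_bcfMul_le_of_le hb.bdd0 (norm_jet2_le c)) ?_
        (norm_bcfMul_le_of_le hc.bdd0 (norm_jet2_le b)))
      rw [norm_smul, Complex.norm_two]
      exact mul_le_mul_of_nonneg_left (norm_bcfMul_le_of_le (norm_bdd1_le b) hc.jet1) zero_le_two
    · rw [norm_smul, Complex.norm_two, jet1_mul]
      exact mul_le_mul_of_nonneg_left (norm_bcfMul_le_of_le (norm_bdd1_le a)
        (norm_add_le_of_le (norm_bcfMul_le_of_le hc.bdd0 hb.jet1)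
          (norm_bcfMul_le_of_le hb.bdd0 hc.jet1))) zero_le_two
    · rw [bdd0_mul]
      exact (_root_.norm_mul_le _ _).trans (mul_le_mul hb.bdd0 hc.bdd0 (norm_nonneg _) hM)
  refine (norm_le _).trans ?_
  nlinarith [mul_nonneg (sq_nonneg M) (norm_nonneg a), mul_nonneg (sq_nonneg M) (norm_nonneg b),
    mul_nonneg (sq_nonneg M) (norm_nonneg c)]

end H22
end

/-! ### A priori bounds and global existence for the system -/

open MeasureTheory
open scoped SchwartzMap ContDiff

noncomputable section

open Set Filter Topology

namespace H22

local notation "⟪" x ", " y "⟫" => inner ℂ x y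

theorem norm_I_div_two : ‖(Complex.I / 2 : ℂ)‖ = 1 / 2 := by simp

theorem norm_jet0_cub_conj_le {a c : H22} {B : ℝ} (h : ‖bdd0 a‖ ≤ B) :
    ‖jet0 (cub a a (conj c))‖ ≤ B * (B * ‖jet0 c‖) := by
  simp only [cub, jet0_mul, jet0_conj]
  exact norm_bcfMul_le_of_le h (norm_bcfMul_le_of_le h (norm_conjL2 _).le)

theorem norm_jet1_cub_conj_le {a : H22} {B C : ℝ} (h : ‖bdd0 a‖ ≤ B) (h1 : ‖jet1 a‖ ≤ C) :
    ‖jet1 (cub a a (conj a))‖ ≤ 3 * (B * (B * C)) := by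
  have hB : 0 ≤ B := (norm_nonneg _).trans h
  have hb : ‖bdd0 (mul a (conj a))‖ ≤ B * B := by
    rw [bdd0_mul]
    refine (_root_.norm_mul_le _ _).trans (mul_le_mul h ?_ (norm_nonneg _) hB)
    rwa [bdd0_conj, norm_star]
  have hc : ‖bdd0 (conj a)‖ ≤ B := by rwa [bdd0_conj, norm_star]
  rw [cub, jet1_mul, jet1_mul]
  refine (norm_add_le_of_le (norm_bcfMul_le_of_le hb h1) (norm_bcfMul_le_of_le h
    (norm_add_le_of_le (norm_bcfMul_le_of_le hc h1) (norm_bcfMul_le_of_le h (C := C) ?_)))).trans ?_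
  · simpa using h1
  · linarith

/-- Small conserved quantities bound the low-order norms. -/
theorem lowBound_of_energy {a b : H22} (hd : defect a b = 0) (hm : ‖jet0 a‖ ≤ 1 / 2)
    (h2 : ‖(⟪jet1 b, jet0 a⟫ : ℂ)‖ ≤ 3 / 4) (h4 : ‖energy a b‖ ≤ 1) :
    LowBound 4 a ∧ LowBound 4 b := by
  have hd' : jet1 a = jet0 (velo a b) := sub_eq_zero.1 hd
  have hsub : jet1 a = jet0 b - (Complex.I / 2) • jet0 (cub a a (conj a)) := by
    rw [hd', velo, map_sub, map_smul]
  have hb2 := norm_bdd0_sq_le a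
  have n0 := norm_nonneg (jet0 a)
  have n1 := norm_nonneg (jet1 a)
  -- Agmon's inequality gives ‖a‖_∞² ‖a‖₂ ≤ 2‖a‖₂² ‖a'‖₂, and ‖a‖₂ ≤ 1/2.
  have hR : ‖jet0 (cub a a (conj a))‖ ≤ 1 / 2 * ‖jet1 a‖ := by
    refine (norm_jet0_cub_conj_le le_rfl).trans ?_
    have : ‖bdd0 a‖ * (‖bdd0 a‖ * ‖jet0 a‖) = ‖bdd0 a‖ ^ 2 * ‖jet0 a‖ := by ring
    rw [this]
    have h3 : ‖bdd0 a‖ ^ 2 * ‖jet0 a‖ ≤ 2 * (‖jet0 a‖ * ‖jet1 a‖) * ‖jet0 a‖ :=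
      mul_le_mul_of_nonneg_right hb2 n0
    have h5 : ‖jet0 a‖ * ‖jet0 a‖ ≤ 1 / 2 * (1 / 2) := mul_self_le_mul_self n0 hm
    nlinarith
  have hdiff : ‖jet0 b - jet1 a‖ ≤ 1 / 4 * ‖jet1 a‖ := by
    rw [hsub, sub_sub_cancel, ← hsub, norm_smul, norm_I_div_two]
    linarith
  -- The conserved ⟨b', a⟩ is -⟨b, a'⟩, and b differs from a' by at most ‖a'‖/4; the quadratic error
  -- is absorbed, leaving ‖a'‖ ≤ 1.
  have hmom : ‖jet1 a‖ ^ 2 ≤ 3 / 4 + 1 / 4 * ‖jet1 a‖ ^ 2 := by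
    have e : (⟪jet1 a, jet1 a⟫ : ℂ) = -⟪jet1 b, jet0 a⟫ - ⟪jet0 b - jet1 a, jet1 a⟫ := by
      rw [inner_jet1_jet0, inner_sub_left]
      ring
    have e1 : ‖jet1 a‖ ^ 2 = ‖(⟪jet1 a, jet1 a⟫ : ℂ)‖ := by
      rw [inner_self_eq_norm_sq_to_K]
      simp
    rw [e1, e]
    refine (norm_sub_le _ _).trans ?_
    rw [norm_neg]
    refine add_le_add h2 ((norm_inner_le_norm _ _).trans ?_)
    rw [← e, ← e1]
    nlinarith
  have hj1 : ‖jet1 a‖ ≤ 1 := by nlinarith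
  have hb1 : ‖bdd0 a‖ ≤ 1 := by nlinarith [norm_nonneg (bdd0 a)]
  have hj0b : ‖jet0 b‖ ≤ 5 / 4 := by
    have := norm_le_norm_add_norm_sub' (jet0 b) (jet1 a)
    linarith
  have hR1 : ‖jet1 (cub a a (conj a))‖ ≤ 3 := by
    simpa using norm_jet1_cub_conj_le hb1 hj1
  have hQ : ‖jet0 (cub a a (conj b))‖ ≤ 5 / 4 := by
    refine (norm_jet0_cub_conj_le hb1).trans ?_
    linarith
  have n1b := norm_nonneg (jet1 b)
  -- Both corrections to ⟨b', b'⟩ in the energy are linear in ‖b'‖: 27/8 = (1/2)·3 + (3/4)·2·(5/4).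
  -- The inequality forces ‖b'‖ ≤ 4.
  have hen : ‖jet1 b‖ ^ 2 ≤ 1 + 27 / 8 * ‖jet1 b‖ := by
    have e : (⟪jet1 b, jet1 b⟫ : ℂ) = energy a b +
        (Complex.I / 2) * ⟪jet1 b, jet1 (cub a a (conj a))⟫ -
        (3 * Complex.I / 4) * (2 * ⟪jet1 b, jet0 (cub a a (conj b))⟫) := by
      rw [energy, inner_jet1_mul_self, velo, map_sub, map_smul, inner_sub_right, inner_smul_right,
        inner_smul_right]
      ring
    have e1 : ‖jet1 b‖ ^ 2 = ‖(⟪jet1 b, jet1 b⟫ : ℂ)‖ := by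
      rw [inner_self_eq_norm_sq_to_K]
      simp
    have i1 := (norm_inner_le_norm (𝕜 := ℂ) (jet1 b) (jet1 (cub a a (conj a)))).trans
      (mul_le_mul_of_nonneg_left hR1 n1b)
    have i2 := (norm_inner_le_norm (𝕜 := ℂ) (jet1 b) (jet0 (cub a a (conj b)))).trans
      (mul_le_mul_of_nonneg_left hQ n1b)
    rw [e1, e]
    refine (norm_sub_le _ _).trans ((add_le_add_left (norm_add_le _ _) _).trans ?_)
    rw [norm_mul, norm_mul, norm_mul, norm_I_div_two]
    have e3 : ‖(3 * Complex.I / 4 : ℂ)‖ = 3 / 4 := by simp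
    rw [e3, Complex.norm_two]
    linarith
  have hj1b : ‖jet1 b‖ ≤ 4 := by nlinarith
  have hb0b : ‖bdd0 b‖ ≤ 4 := by
    have := norm_bdd0_sq_le b
    have : ‖jet0 b‖ * ‖jet1 b‖ ≤ 5 / 4 * 4 := mul_le_mul hj0b hj1b n1b (by norm_num)
    nlinarith [norm_nonneg (bdd0 b)]
  exact ⟨⟨by linarith, by linarith, by linarith⟩, by linarith, hj1b, hb0b⟩

theorem SystemAt.lowBound {φ ψ : ℝ → H22} {t τ : ℝ} (h : ∀ t ∈ Ioo (-τ) τ, SystemAt φ ψ t)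
    (hd : defect (φ 0) (ψ 0) = 0) (hm : ‖jet0 (φ 0)‖ ≤ 1 / 2)
    (h2 : ‖(⟪jet1 (ψ 0), jet0 (φ 0)⟫ : ℂ)‖ ≤ 3 / 4) (h4 : ‖energy (φ 0) (ψ 0)‖ ≤ 1)
    (ht : t ∈ Ioo (-τ) τ) : LowBound 4 (φ t) ∧ LowBound 4 (ψ t) := by
  have hd' := SystemAt.defect_eq_zero h hd
  refine lowBound_of_energy (hd' t ht) ?_ ?_ ?_
  · exact (abs_le_of_sq_le_sq' (by rw [SystemAt.mass_eq h hd' ht]; gcongr) (by norm_num)).2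
  · rwa [SystemAt.momentum_eq h ht]
  · rwa [SystemAt.energy_eq h hd' ht]

/-- The nonlinearity of the gauge-transformed system. -/
def sysNonlin (Y : H22 × H22) : H22 × H22 :=
  (-cub Y.1 Y.1 (conj Y.2), cub Y.2 Y.2 (conj Y.1))

theorem lipBdd_cub {E : Type*} [NormedAddCommGroup E] {f g h : E → H22} (hf : LipBdd f)
    (hg : LipBdd g) (hh : LipBdd h) : LipBdd fun a => cub (f a) (g a) (h a) :=
  LipBdd.bilin mul hf (LipBdd.bilin mul hg hh)

theorem lipBdd_sysNonlin : LipBdd sysNonlin :=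
  (lipBdd_cub .fst .fst LipBdd.snd.h22conj).neg.prodMk (lipBdd_cub .snd .snd LipBdd.fst.h22conj)

theorem freeBound_le {t T : ℝ} (h : |t| ≤ T) : freeBound t ≤ freeBound T := by
  have h0 := abs_nonneg t
  have h1 : t ^ 2 ≤ T ^ 2 := sq_le_sq.2 (h.trans (le_abs_self T))
  have h2 : |t| ≤ |T| := h.trans (le_abs_self T)
  unfold freeBound
  linarith

theorem freeBound_nonneg (t : ℝ) : 0 ≤ freeBound t := by
  unfold freeBound
  positivity

/-- The free evolution of pairs. -/
def freePair (t : ℝ) : H22 × H22 →L[ℂ] H22 × H22 := (free t).prodMap (free t)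

theorem norm_freePair_le {t T : ℝ} (h : |t| ≤ T) (Y : H22 × H22) :
    ‖freePair t Y‖ ≤ freeBound T * ‖Y‖ := by
  have key : ∀ q, ‖free t q‖ ≤ freeBound T * ‖q‖ := fun q => (norm_free_le t q).trans
    (mul_le_mul_of_nonneg_right (freeBound_le h) (norm_nonneg _))
  refine max_le ((key _).trans ?_) ((key _).trans ?_)
  · exact mul_le_mul_of_nonneg_left (norm_fst_le Y) (freeBound_nonneg T)
  · exact mul_le_mul_of_nonneg_left (norm_snd_le Y) (freeBound_nonneg T)

/-- The system in the interaction picture. -/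
def sysField (t : ℝ) (Y : H22 × H22) : H22 × H22 := freePair (-t) (sysNonlin (freePair t Y))

theorem continuous_sysField (Y : H22 × H22) : Continuous fun t => sysField t Y := by
  have h0 : Continuous fun t : ℝ => freePair t Y :=
    (continuous_id.h22free continuous_const).prodMk (continuous_id.h22free continuous_const)
  have h : Continuous fun t : ℝ => sysNonlin (freePair t Y) := by
    simpa only [Function.comp_def] using lipBdd_sysNonlin.continuous.comp h0
  exact (continuous_neg.h22free h.fst).prodMk (continuous_neg.h22free h.snd)

theorem lipschitz_sysField (T R : ℝ) : ∃ K, ∀ t, |t| ≤ T → ∀ a b : H22 × H22, ‖a‖ ≤ R → ‖b‖ ≤ R →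
    ‖sysField t a - sysField t b‖ ≤ K * ‖a - b‖ := by
  have hF := freeBound_nonneg T
  obtain ⟨K, hK0, hK⟩ := lipBdd_sysNonlin (freeBound T * R)
  refine ⟨freeBound T * (K * freeBound T), fun t ht a b ha hb => ?_⟩
  rw [sysField, sysField, ← map_sub]
  refine (norm_freePair_le (T := T) (by rwa [abs_neg]) _).trans ?_
  rw [mul_assoc]
  refine mul_le_mul_of_nonneg_left ((hK _ _ ?_ ?_).trans ?_) hF
  · exact (norm_freePair_le ht a).trans (mul_le_mul_of_nonneg_left ha hF)
  · exact (norm_freePair_le ht b).trans (mul_le_mul_of_nonneg_left hb hF)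
  · rw [← map_sub, mul_assoc]
    exact mul_le_mul_of_nonneg_left (norm_freePair_le ht _) hK0

theorem systemAt_of_hasDerivAt {D : ℝ → H22 × H22} {t : ℝ} (h : HasDerivAt D (sysField t (D t)) t) :
    SystemAt (fun r => free r (D r).1) (fun r => free r (D r).2) t := by
  constructor
  · have h1 := h.clmC (ContinuousLinearMap.fst ℂ H22 H22)
    unfold ForcedAt
    simp only [free_neg_free]
    exact h1
  · have h1 := h.clmC (ContinuousLinearMap.snd ℂ H22 H22)
    unfold ForcedAt
    simp only [free_neg_free]
    exact h1

theorem norm_sysNonlin_le {M : ℝ} {Y : H22 × H22} (h1 : LowBound M Y.1) (h2 : LowBound M Y.2) :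
    ‖sysNonlin Y‖ ≤ 27 * M ^ 2 * ‖Y‖ := by
  have n1 := norm_fst_le Y
  have n2 := norm_snd_le Y
  have hM := sq_nonneg M
  refine max_le ?_ ?_
  · rw [sysNonlin, norm_neg]
    refine (norm_cub_le h1 h1 h2.conj).trans ?_
    rw [norm_conj]
    nlinarith
  · refine (norm_cub_le h2 h2 h1.conj).trans ?_
    rw [norm_conj]
    nlinarith

/-- The low norms are bounded by 4 on any interval of existence, so by `norm_sysNonlin_le` the field
grows at most linearly along the solution. Gronwall's inequality supplies the a priori bound for
`exists_global_solution`. -/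
theorem exists_system {a b : H22} (hd : defect a b = 0) (hm : ‖jet0 a‖ ≤ 1 / 2)
    (h2 : ‖(⟪jet1 b, jet0 a⟫ : ℂ)‖ ≤ 3 / 4) (h4 : ‖energy a b‖ ≤ 1) :
    ∃ φ ψ : ℝ → H22, φ 0 = a ∧ ψ 0 = b ∧
      ∀ t, SystemAt φ ψ t ∧ defect (φ t) (ψ t) = 0 ∧ LowBound 4 (φ t) ∧ LowBound 4 (ψ t) := by
  obtain ⟨D, hD0, hD⟩ := exists_global_solution continuous_sysField lipschitz_sysField (a, b) (by
    intro T hT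
    have hF := freeBound_nonneg T
    -- One factor `freeBound T` for each direction of the free evolution, around the cubic bound
    -- with M = 4.
    set K := freeBound T * (27 * 4 ^ 2 * freeBound T) with hK
    refine ⟨‖(a, b)‖ * Real.exp (K * T), fun τ hτ hτT D hD0 hD t ht => ?_⟩
    have hs : ∀ t ∈ Ioo (-τ) τ, SystemAt (fun r => free r (D r).1) (fun r => free r (D r).2) t :=
      fun t ht => systemAt_of_hasDerivAt (hD t ht)
    have hlow := fun (t : ℝ) (ht : t ∈ Ioo (-τ) τ) => SystemAt.lowBound hs (by simpa [hD0])
      (by simpa [hD0] using hm) (by simpa [hD0]) (by simpa [hD0]) ht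
    have h := norm_le_exp_of_norm_deriv_le (K := K) hD (fun s hs => by
      have hsT : |s| ≤ T := (abs_lt.2 hs).le.trans hτT
      refine (norm_freePair_le (T := T) (by rwa [abs_neg]) _).trans ?_
      rw [hK, mul_assoc]
      refine mul_le_mul_of_nonneg_left ((norm_sysNonlin_le (Y := freePair s (D s)) (hlow s hs).1 (hlow s hs).2).trans ?_) hF
      rw [mul_assoc (27 * 4 ^ 2 : ℝ)]
      exact mul_le_mul_of_nonneg_left (norm_freePair_le hsT _) (by norm_num)) t ht
    rw [hD0] at h
    refine h.trans ?_
    gcongr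
    exact (abs_lt.2 ht).le.trans hτT)
  have hs : ∀ t, SystemAt (fun r => free r (D r).1) (fun r => free r (D r).2) t :=
    fun t => systemAt_of_hasDerivAt (hD t)
  refine ⟨_, _, by simp [hD0], by simp [hD0], fun t => ⟨hs t, ?_⟩⟩
  have ht : t ∈ Ioo (-(|t| + 1)) (|t| + 1) := abs_lt.1 (lt_add_one _)
  exact ⟨SystemAt.defect_eq_zero (fun t _ => hs t) (by simpa [hD0]) t ht,
    SystemAt.lowBound (fun t _ => hs t) (by simpa [hD0]) (by simpa [hD0] using hm) (by simpa [hD0])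
      (by simpa [hD0]) ht⟩

end H22
end

/-! ### Lipschitz dependence for the system -/

open MeasureTheory
open scoped SchwartzMap ContDiff

noncomputable section

open Set Filter Topology

namespace H22

local notation "⟪" x ", " y "⟫" => inner ℂ x y

theorem cub_sub_cub (a c a' c' : H22) : cub a a c - cub a' a' c' =
    cub (a - a') a c + cub a' (a - a') c + cub a' a' (c - c') := by
  simp only [cub, map_sub, sub_apply]
  abel

/-- With `cub_swap` this brings any chosen factor to the last slot, where a weight acts. -/
theorem cub_rotate (a b c : H22) : cub a b c = cub c a b := by
  have h : ∀ a b c : H22, cub a b c = cub c a b :=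
    eq_of_schwartz₃ (by fun_prop) (by fun_prop) fun f g h => by
      simp only [cub_of]
      congr 1
      ext x
      simp
      ring
  exact h a b c

theorem cub_swap (a b c : H22) : cub a b c = cub a c b := by
  rw [cub, cub, mul_comm b]

/-- `T` is a weight: it commutes with multiplications. -/
def IsWeight (T : H22 →L[ℂ] L2R) : Prop := ∀ a b, T (mul a b) = bcfMul (bdd0 a) (T b)

theorem IsWeight.norm_cub_le {T : H22 →L[ℂ] L2R} (hT : IsWeight T) {a b c : H22} {A B C : ℝ}
    (ha : ‖bdd0 a‖ ≤ A) (hb : ‖bdd0 b‖ ≤ B) (hc : ‖T c‖ ≤ C) : ‖T (cub a b c)‖ ≤ A * (B * C) := by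
  rw [cub, hT, hT]
  exact norm_bcfMul_le_of_le ha (norm_bcfMul_le_of_le hb hc)

theorem IsWeight.norm_cub_sub_le {T : H22 →L[ℂ] L2R} (hT : IsWeight T) {M D E : ℝ}
    {a c a' c' : H22} (ha : LowBound M a) (ha' : LowBound M a') (hc : LowBound M c)
    (hD : ‖T (a - a')‖ ≤ D) (hE : ‖T (cub a' a' (c - c'))‖ ≤ E) :
    ‖T (cub a a c) - T (cub a' a' c')‖ ≤ 2 * (M * (M * D)) + E := by
  rw [← map_sub, cub_sub_cub, map_add, map_add]
  have h1 : ‖T (cub (a - a') a c)‖ ≤ M * (M * D) := by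
    rw [← cub_rotate]
    exact hT.norm_cub_le ha.bdd0 hc.bdd0 hD
  have h2 : ‖T (cub a' (a - a') c)‖ ≤ M * (M * D) := by
    rw [cub_swap]
    exact hT.norm_cub_le ha'.bdd0 hc.bdd0 hD
  refine norm_add₃_le.trans ?_
  linarith

theorem isWeight_jet0 : IsWeight jet0 := jet0_mul
theorem isWeight_mom1 : IsWeight mom1 := mom1_mul
theorem isWeight_mom2 : IsWeight mom2 := mom2_mul

theorem norm_jet1_cub_le {A B C : ℝ} {a b c : H22} (ha : LowBound A a) (hb : LowBound B b)
    (hc : LowBound C c) : ‖jet1 (cub a b c)‖ ≤ 3 * (A * B * C) := by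
  have hB : 0 ≤ B := (norm_nonneg _).trans hb.jet0
  rw [cub, jet1_mul, jet1_mul]
  refine (norm_add_le_of_le (norm_bcfMul_le_of_le (B := B * C) ?_ ha.jet1) (norm_bcfMul_le_of_le
    ha.bdd0 (norm_add_le_of_le (norm_bcfMul_le_of_le hc.bdd0 hb.jet1)
      (norm_bcfMul_le_of_le hb.bdd0 hc.jet1)))).trans ?_
  · rw [bdd0_mul]
    exact (_root_.norm_mul_le _ _).trans (mul_le_mul hb.bdd0 hc.bdd0 (norm_nonneg _) hB)
  · linarith

theorem norm_jet1_cub_sub_le {M D : ℝ} {a c a' c' : H22} (ha : LowBound M a) (ha' : LowBound M a')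
    (hc : LowBound M c) (hD : LowBound D (a - a')) (hE : LowBound D (c - c')) :
    ‖jet1 (cub a a c) - jet1 (cub a' a' c')‖ ≤ 9 * (M * M * D) := by
  rw [← map_sub, cub_sub_cub, map_add, map_add]
  refine (norm_add₃_le.trans (add_le_add_three (norm_jet1_cub_le hD ha hc)
    (norm_jet1_cub_le ha' hD hc) (norm_jet1_cub_le ha' ha' hE))).trans ?_
  linarith

/-- The norms that control the differences of two solutions of the system are at most `ε`. -/
structure RedBound (ε : ℝ) (a b : H22) : Prop where
  jet0_fst : ‖jet0 a‖ ≤ ε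
  jet1_fst : ‖jet1 a‖ ≤ ε
  mom1_fst : ‖mom1 a‖ ≤ ε
  mom2_fst : ‖mom2 a‖ ≤ ε
  jet0_snd : ‖jet0 b‖ ≤ ε
  jet1_snd : ‖jet1 b‖ ≤ ε
  mom1_snd : ‖mom1 b‖ ≤ ε

theorem lowBound_of_jet {ε : ℝ} {a : H22} (h0 : ‖jet0 a‖ ≤ ε) (h1 : ‖jet1 a‖ ≤ ε) :
    LowBound (2 * ε) a := by
  have hε := (norm_nonneg _).trans h0
  refine ⟨by linarith, by linarith, abs_le_of_sq_le_sq ?_ (by linarith) |>.trans' (le_abs_self _)⟩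
  have h2 : ‖jet0 a‖ * ‖jet1 a‖ ≤ ε * ε := mul_le_mul h0 h1 (norm_nonneg _) hε
  nlinarith [norm_bdd0_sq_le a]

theorem RedBound.low_fst {ε : ℝ} {a b : H22} (h : RedBound ε a b) : LowBound (2 * ε) a :=
  lowBound_of_jet h.jet0_fst h.jet1_fst

theorem RedBound.low_snd {ε : ℝ} {a b : H22} (h : RedBound ε a b) : LowBound (2 * ε) b :=
  lowBound_of_jet h.jet0_snd h.jet1_snd

/-- The controlling quantities, with the free evolution undone. -/
def reduced (t : ℝ) (a b : H22) : (L2R × L2R × L2R × L2R) × L2R × L2R × L2R :=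
  ((freeL2 (-t) (jet0 a), freeL2 (-t) (jet1 a), freeL2 (-t) (mom1 a), freeL2 (-t) (mom2 a)),
    freeL2 (-t) (jet0 b), freeL2 (-t) (jet1 b), freeL2 (-t) (mom1 b))

/-- The product carries the sup norm and the free group is isometric on L², so undoing the free
evolution does not change the norms. -/
theorem norm_reduced_le {t ε : ℝ} {a b : H22} : ‖reduced t a b‖ ≤ ε ↔ RedBound ε a b := by
  simp only [reduced, norm_prod_le_iff, norm_freeL2]
  exact ⟨fun ⟨⟨h1, h2, h3, h4⟩, h5, h6, h7⟩ => ⟨h1, h2, h3, h4, h5, h6, h7⟩,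
    fun ⟨h1, h2, h3, h4, h5, h6, h7⟩ => ⟨⟨h1, h2, h3, h4⟩, h5, h6, h7⟩⟩

/-- A global solution of the system that satisfies the constraint, with bounded low-order norms. -/
structure IsFlow (φ ψ : ℝ → H22) (t : ℝ) : Prop where
  system : SystemAt φ ψ t
  defect : defect (φ t) (ψ t) = 0
  low_fst : LowBound 4 (φ t)
  low_snd : LowBound 4 (ψ t)

theorem jet1_eq_of_defect {a b : H22} (h : defect a b = 0) : jet1 a = jet0 (velo a b) :=
  sub_eq_zero.1 h

/-- Comparison with this flow, for which the bound on x²φ' may be taken as 0, turns the difference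
estimate into a bound on a single solution. -/
theorem isFlow_zero (t : ℝ) : IsFlow (fun _ => 0) (fun _ => 0) t := by
  have h0 : LowBound 4 0 := ⟨by simp, by simp, by simp⟩
  refine ⟨⟨?_, ?_⟩, by simp [H22.defect, velo, cub], h0, h0⟩ <;>
  · simp only [ForcedAt, cub, map_zero, neg_zero, zero_apply]
    exact hasDerivAt_const t (0 : H22)

section Difference

variable {φ ψ φ' ψ' : ℝ → H22} {t ε B : ℝ}

theorem conj_sub_conj (a b : H22) : conj a - conj b = conj (a - b) := (conj_sub a b).symm

theorem norm_cub_conj_sub_le {T : H22 →L[ℂ] L2R} (hT : IsWeight T)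
    (hTc : ∀ q, T (conj q) = conjL2 (T q)) {M D : ℝ} {a b a' b' : H22} (ha : LowBound M a)
    (ha' : LowBound M a') (hb : LowBound M b) (hD : ‖T (a - a')‖ ≤ D) (hE : ‖T (b - b')‖ ≤ D) :
    ‖T (cub a a (conj b)) - T (cub a' a' (conj b'))‖ ≤ 3 * (M * (M * D)) := by
  refine (hT.norm_cub_sub_le (E := M * (M * D)) ha ha' hb.conj hD ?_).trans (by linarith)
  refine hT.norm_cub_le ha'.bdd0 ha'.bdd0 ?_
  rwa [conj_sub_conj, hTc, norm_conjL2]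

theorem norm_jet1_cub_conj_sub_le {M D : ℝ} {a b a' b' : H22} (ha : LowBound M a)
    (ha' : LowBound M a') (hb : LowBound M b) (hD : LowBound D (a - a'))
    (hE : LowBound D (b - b')) :
    ‖jet1 (cub a a (conj b)) - jet1 (cub a' a' (conj b'))‖ ≤ 9 * (M * M * D) :=
  norm_jet1_cub_sub_le ha ha' hb.conj hD (by rw [conj_sub_conj]; exact hE.conj)

/-- The constraint expresses xφ_x through xψ and a cubic term; 25 = 1 + (1/2)·3·4². -/
theorem IsFlow.norm_mom1jet1_sub_le (h : IsFlow φ ψ t) (h' : IsFlow φ' ψ' t)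
    (hε : RedBound ε (φ t - φ' t) (ψ t - ψ' t)) : ‖mom1jet1 (φ t - φ' t)‖ ≤ 25 * ε := by
  have h1 := norm_cub_conj_sub_le isWeight_mom1 mom1_conj h.low_fst h'.low_fst h.low_fst
    hε.mom1_fst hε.mom1_fst
  have h2 := hε.mom1_snd
  rw [map_sub, mom1jet1_eq_of_jet1_eq (jet1_eq_of_defect h.defect),
    mom1jet1_eq_of_jet1_eq (jet1_eq_of_defect h'.defect), velo, velo, map_sub, map_sub, map_smul,
    map_smul, sub_sub_sub_comm, ← smul_sub, ← map_sub mom1]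
  refine (norm_sub_le _ _).trans ?_
  rw [norm_smul, norm_I_div_two]
  linarith

/-- The constraint differentiated in x; 145 = 1 + (1/2)·9·4²·2, the last 2 coming from
`lowBound_of_jet`. -/
theorem IsFlow.norm_jet2_sub_le (h : IsFlow φ ψ t) (h' : IsFlow φ' ψ' t)
    (hε : RedBound ε (φ t - φ' t) (ψ t - ψ' t)) : ‖jet2 (φ t - φ' t)‖ ≤ 145 * ε := by
  have h1 := norm_jet1_cub_conj_sub_le h.low_fst h'.low_fst h.low_fst hε.low_fst hε.low_fst
  have h2 := hε.jet1_snd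
  rw [map_sub, jet2_eq_of_jet1_eq (jet1_eq_of_defect h.defect),
    jet2_eq_of_jet1_eq (jet1_eq_of_defect h'.defect), velo, velo, map_sub, map_sub, map_smul,
    map_smul, sub_sub_sub_comm, ← smul_sub, ← map_sub jet1]
  refine (norm_sub_le _ _).trans ?_
  rw [norm_smul, norm_I_div_two]
  linarith

/-- The controlling norms form a closed system. The commutator terms produced by the weights are
φ_x, ψ_x and xφ_x, the last being recovered from the constraint, so neither x²ψ nor ψ_xx is ever
needed. The largest numerical constant is 9·4²·2 = 288, from the first derivatives. -/
theorem IsFlow.exists_hasDerivAt_reduced (h : IsFlow φ ψ t) (h' : IsFlow φ' ψ' t)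
    (hB : ‖mom2 (φ' t)‖ ≤ B) : ∃ e, HasDerivAt (fun r => reduced r (φ r - φ' r) (ψ r - ψ' r)) e t ∧
      ‖e‖ ≤ (300 + 8 * B) * ‖reduced t (φ t - φ' t) (ψ t - ψ' t)‖ := by
  have hB0 : 0 ≤ B := (norm_nonneg _).trans hB
  have hf := h.system.fst.sub h'.system.fst
  have hs := h.system.snd.sub h'.system.snd
  refine ⟨_, HasDerivAt.prodMk
    (hf.hasDerivAt_freeL2_jet0.prodMk (hf.hasDerivAt_freeL2_jet1.prodMk
      (hf.hasDerivAt_freeL2_mom1.prodMk hf.hasDerivAt_freeL2_mom2)))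
    (hs.hasDerivAt_freeL2_jet0.prodMk (hs.hasDerivAt_freeL2_jet1.prodMk
      hs.hasDerivAt_freeL2_mom1)), ?_⟩
  set ε := ‖reduced t (φ t - φ' t) (ψ t - ψ' t)‖ with hεdef
  have hε : RedBound ε (φ t - φ' t) (ψ t - ψ' t) := norm_reduced_le.1 le_rfl
  have hε0 : 0 ≤ ε := norm_nonneg _
  have hBε : 0 ≤ B * ε := by positivity
  have n2 : ‖(2 * Complex.I : ℂ)‖ = 2 := by simp
  simp only [norm_prod_le_iff, norm_freeL2]
  refine ⟨⟨?_, ?_, ?_, ?_⟩, ?_, ?_, ?_⟩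
  · have := norm_cub_conj_sub_le isWeight_jet0 jet0_conj h.low_fst h'.low_fst h.low_snd
      hε.jet0_fst hε.jet0_snd
    rw [neg_sub_neg, norm_sub_rev, map_sub] at *
    linarith
  · have := norm_jet1_cub_conj_sub_le h.low_fst h'.low_fst h.low_snd hε.low_fst hε.low_snd
    rw [neg_sub_neg, map_sub, norm_sub_rev]
    linarith
  · have := norm_cub_conj_sub_le isWeight_mom1 mom1_conj h.low_fst h'.low_fst h.low_snd
      hε.mom1_fst hε.mom1_snd
    rw [norm_sub_rev] at this
    refine (norm_sub_le _ _).trans ?_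
    rw [neg_sub_neg, map_sub, norm_smul, n2]
    linarith [hε.jet1_fst]
  -- There is no control of x²(ψ - ψ'), so the weight is put on φ', which is where B enters.
  · have h1 : ‖mom2 (cub (φ' t) (φ' t) (conj (ψ t) - conj (ψ' t)))‖ ≤ 4 * (2 * ε * B) := by
      rw [conj_sub_conj, cub_swap]
      exact isWeight_mom2.norm_cub_le h'.low_fst.bdd0 hε.low_snd.conj.bdd0 hB
    have h2 := isWeight_mom2.norm_cub_sub_le h.low_fst h'.low_fst h.low_snd.conj hε.mom2_fst h1
    rw [norm_sub_rev] at h2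
    refine (norm_sub_le _ _).trans ?_
    have h3 := h.norm_mom1jet1_sub_le h' hε
    have h4 := norm_add_le ((2 : ℂ) • mom1jet1 (φ t - φ' t)) (jet0 (φ t - φ' t))
    rw [norm_smul, Complex.norm_two] at h4
    rw [neg_sub_neg, map_sub, norm_smul, n2]
    linarith [hε.jet0_fst]
  · have := norm_cub_conj_sub_le isWeight_jet0 jet0_conj h.low_snd h'.low_snd h.low_fst
      hε.jet0_snd hε.jet0_fst
    rw [map_sub]
    linarith
  · have := norm_jet1_cub_conj_sub_le h.low_snd h'.low_snd h.low_fst hε.low_snd hε.low_fst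
    rw [map_sub]
    linarith
  · have := norm_cub_conj_sub_le isWeight_mom1 mom1_conj h.low_snd h'.low_snd h.low_fst
      hε.mom1_snd hε.mom1_fst
    refine (norm_sub_le _ _).trans ?_
    rw [map_sub, norm_smul, n2]
    linarith [hε.jet1_snd]

theorem IsFlow.norm_sub_le {τ : ℝ} (h : ∀ t, IsFlow φ ψ t) (h' : ∀ t, IsFlow φ' ψ' t)
    (hB : ∀ t ∈ Ioo (-τ) τ, ‖mom2 (φ' t)‖ ≤ B) (ht : t ∈ Ioo (-τ) τ) :
    ‖φ t - φ' t‖ ≤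
      147 * (‖reduced 0 (φ 0 - φ' 0) (ψ 0 - ψ' 0)‖ * Real.exp ((300 + 8 * B) * |t|)) := by
  have hex : ∀ t, ∃ e, t ∈ Ioo (-τ) τ →
      HasDerivAt (fun r => reduced r (φ r - φ' r) (ψ r - ψ' r)) e t ∧
        ‖e‖ ≤ (300 + 8 * B) * ‖reduced t (φ t - φ' t) (ψ t - ψ' t)‖ := fun t => by
    by_cases ht : t ∈ Ioo (-τ) τ
    · obtain ⟨e, he⟩ := (h t).exists_hasDerivAt_reduced (h' t) (hB t ht)
      exact ⟨e, fun _ => he⟩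
    · exact ⟨0, fun h => absurd h ht⟩
  choose e he using hex
  have key := norm_le_exp_of_norm_deriv_le (fun t ht => (he t ht).1) (fun t ht => (he t ht).2) t ht
  have hε := norm_reduced_le.1 key
  have h2 := (h t).norm_jet2_sub_le (h' t) hε
  refine (norm_le _).trans ?_
  linarith [hε.jet0_fst, hε.mom2_fst]

end Difference

end H22
end

/-! ### The gauged flow for Schwartz data -/

open MeasureTheory
open scoped SchwartzMap ContDiff

noncomputable section

open Set Filter Topology

namespace H22

local notation "⟪" x ", " y "⟫" => inner ℂ x y

/-- The initial value of the second unknown of the system. -/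
def _root_.Sch.second (f : 𝓢(ℝ, ℂ)) : 𝓢(ℝ, ℂ) := Sch.D f + (Complex.I / 2) • (f * (f * star f))

/-- The second unknown `a' + (i/2)|a|²a` as an element of `L²(ℝ)`. -/
def second0 (a : H22) : L2R := jet1 a + (Complex.I / 2) • jet0 (cub a a (conj a))

/-- The derivative of the second unknown. -/
def second1 (a : H22) : L2R := jet2 a + (Complex.I / 2) • jet1 (cub a a (conj a))

/-- The first moment of the second unknown. -/
def secondMom (a : H22) : L2R := mom1jet1 a + (Complex.I / 2) • mom1 (cub a a (conj a))

theorem lipBdd_second0 : LipBdd second0 :=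
  (LipBdd.of_clm jet1).add (((lipBdd_cub .id .id LipBdd.id.h22conj).clm jet0).smul _)

theorem lipBdd_second1 : LipBdd second1 :=
  (LipBdd.of_clm jet2).add (((lipBdd_cub .id .id LipBdd.id.h22conj).clm jet1).smul _)

theorem lipBdd_secondMom : LipBdd secondMom :=
  (LipBdd.of_clm mom1jet1).add (((lipBdd_cub .id .id LipBdd.id.h22conj).clm mom1).smul _)

section

variable (f : 𝓢(ℝ, ℂ))

theorem jet0_second : jet0 (of (Sch.second f)) = second0 (of f) := by
  simp [Sch.second, second0]

theorem jet1_second : jet1 (of (Sch.second f)) = second1 (of f) := by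
  simp [Sch.second, second1]

theorem mom1_second : mom1 (of (Sch.second f)) = secondMom (of f) := by
  simp [Sch.second, secondMom]

theorem velo_second : velo (of f) (of (Sch.second f)) = of (Sch.D f) := by
  rw [Sch.second, velo_of, add_sub_cancel_right]

theorem defect_second : defect (of f) (of (Sch.second f)) = 0 := by
  rw [defect, velo_second]
  simp

end

/-- The `H22` norm of f does not control that of the second unknown. But momentum and energy are
inner products involving only `second0`, `second1` and jets of f. These expressions are continuous
on `H22` and vanish at 0, so smallness of f in `H22` suffices. -/
theorem exists_small_energy : ∃ r : ℝ, 0 < r ∧ r ≤ 1 ∧ ∀ f : 𝓢(ℝ, ℂ), ‖of f‖ < r →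
    ‖jet0 (of f)‖ ≤ 1 / 2 ∧ ‖(⟪jet1 (of (Sch.second f)), jet0 (of f)⟫ : ℂ)‖ ≤ 3 / 4 ∧
      ‖energy (of f) (of (Sch.second f))‖ ≤ 1 := by
  have c0 := lipBdd_second0.continuous
  have c1 := lipBdd_second1.continuous
  have hz : second1 0 = 0 := by simp [second1, cub]
  have k1 : Continuous fun a : H22 => ‖(⟪second1 a, jet0 a⟫ : ℂ)‖ := by fun_prop
  have k2 : Continuous fun a : H22 => ‖(⟪second1 a, jet2 a⟫ : ℂ) + (3 * Complex.I / 4) *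
      ⟪second1 a, (2 : ℂ) • bcfMul (bdd0 a) (bcfMul (bdd0 a) (conjL2 (second0 a)))⟫‖ := by
    fun_prop
  have e1 := (k1.tendsto 0).eventually_le_const (u := 3 / 4) (by simp [hz])
  have e2 := (k2.tendsto 0).eventually_le_const (u := 1) (by simp [hz])
  obtain ⟨r, hr, hball⟩ := Metric.eventually_nhds_iff_ball.1 (e1.and e2)
  refine ⟨min r (1 / 2), by positivity, (min_le_right _ _).trans (by norm_num), fun f hf => ?_⟩
  have hf' := hball (of f) (by simpa using hf.trans_le (min_le_left _ _))
  refine ⟨(norm_jet0_le _).trans (hf.le.trans (min_le_right _ _)), ?_, ?_⟩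
  · rw [jet1_second]
    exact hf'.1
  · rw [energy, inner_jet1_mul_self, velo_second, jet1_second]
    refine le_of_eq_of_le ?_ hf'.2
    simp [cub, ← jet0_second]

/-- The time derivative along the gauge-transformed flow. -/
def gaugedRate (a : H22) : L2R :=
  Complex.I • jet2 a - bcfMul (bdd0 a) (bcfMul (bdd0 a) (conjL2 (second0 a)))

/-- The constraint eliminates ψ, leaving a closed equation for φ. -/
theorem IsFlow.rateFst_eq {φ ψ : ℝ → H22} {t : ℝ} (h : IsFlow φ ψ t) :
    rateFst (φ t) (ψ t) = gaugedRate (φ t) := by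
  have e : second0 (φ t) = jet0 (ψ t) := by
    rw [second0, jet1_eq_of_defect h.defect, velo, map_sub, map_smul, sub_add_cancel]
  rw [rateFst, gaugedRate, e]
  simp [cub]

/-- The reduced norm of ψ at time 0 needs only ψ, ψ_x and xψ, all of which are locally Lipschitz
functions of φ in `H22`. -/
theorem exists_reduced_le : ∃ L : ℝ, 0 ≤ L ∧ ∀ f g : 𝓢(ℝ, ℂ), ‖of f‖ ≤ 1 → ‖of g‖ ≤ 1 →
    ‖reduced 0 (of f - of g) (of (Sch.second f) - of (Sch.second g))‖ ≤ L * ‖of f - of g‖ := by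
  obtain ⟨K0, h0, hK0⟩ := lipBdd_second0 1
  obtain ⟨K1, h1, hK1⟩ := lipBdd_second1 1
  obtain ⟨K2, h2, hK2⟩ := lipBdd_secondMom 1
  refine ⟨1 + K0 + K1 + K2, by positivity, fun f g hf hg => norm_reduced_le.2 ?_⟩
  have hn := norm_nonneg (of f - of g)
  have le1 : ‖of f - of g‖ ≤ (1 + K0 + K1 + K2) * ‖of f - of g‖ :=
    le_mul_of_one_le_left hn (by linarith)
  refine ⟨(norm_jet0_le _).trans le1, (norm_jet1_le _).trans le1, (norm_mom1_le _).trans le1,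
    (norm_mom2_le _).trans le1, ?_, ?_, ?_⟩
  · rw [map_sub, jet0_second, jet0_second]
    exact (hK0 _ _ hf hg).trans (mul_le_mul_of_nonneg_right (by linarith) hn)
  · rw [map_sub, jet1_second, jet1_second]
    exact (hK1 _ _ hf hg).trans (mul_le_mul_of_nonneg_right (by linarith) hn)
  · rw [map_sub, mom1_second, mom1_second]
    exact (hK2 _ _ hf hg).trans (mul_le_mul_of_nonneg_right (by linarith) hn)

/-- The difference estimate is used twice: against the zero flow it gives a uniform bound B on |t| <
T + 1, and with that B it gives the Lipschitz constant. -/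
theorem exists_gauged_flow : ∃ r : ℝ, 0 < r ∧ ∃ Φ : 𝓢(ℝ, ℂ) → ℝ → H22,
    (∀ f, ‖of f‖ < r → Φ f 0 = of f ∧ Continuous (Φ f) ∧
      ∀ t, HasDerivAt (fun s => jet0 (Φ f s)) (gaugedRate (Φ f t)) t) ∧
    ∀ T : ℝ, ∃ K : ℝ, 0 ≤ K ∧ ∀ t, |t| ≤ T → (∀ f, ‖of f‖ < r → ‖Φ f t‖ ≤ K) ∧
      ∀ f g, ‖of f‖ < r → ‖of g‖ < r → ‖Φ f t - Φ g t‖ ≤ K * ‖of f - of g‖ := by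
  obtain ⟨r, hr, hr1, hsmall⟩ := exists_small_energy
  obtain ⟨L, hL0, hL⟩ := exists_reduced_le
  have hex : ∀ f, ∃ φ ψ : ℝ → H22, ‖of f‖ < r →
      φ 0 = of f ∧ ψ 0 = of (Sch.second f) ∧ ∀ t, IsFlow φ ψ t := fun f => by
    by_cases hf : ‖of f‖ < r
    · obtain ⟨h1, h2, h3⟩ := hsmall f hf
      obtain ⟨φ, ψ, h4, h5, h6⟩ := exists_system (defect_second f) h1 h2 h3
      exact ⟨φ, ψ, fun _ => ⟨h4, h5, fun t => ⟨(h6 t).1, (h6 t).2.1, (h6 t).2.2.1, (h6 t).2.2.2⟩⟩⟩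
    · exact ⟨0, 0, fun h => absurd h hf⟩
  choose Φ Ψ hΦ using hex
  refine ⟨r, hr, Φ, fun f hf => ⟨(hΦ f hf).1, ?_, fun t => ?_⟩, fun T => ?_⟩
  · exact continuous_iff_continuousAt.2 fun t => ((hΦ f hf).2.2 t).system.fst.continuousAt
  · rw [← ((hΦ f hf).2.2 t).rateFst_eq]
    exact ((hΦ f hf).2.2 t).system.hasDerivAt_fst
  · have main : ∀ {B : ℝ}, 0 ≤ B → ∀ {φ ψ φ' ψ' : ℝ → H22} (_ : ∀ t, IsFlow φ ψ t)
        (_ : ∀ t, IsFlow φ' ψ' t) (_ : ∀ t ∈ Ioo (-(T + 1)) (T + 1), ‖mom2 (φ' t)‖ ≤ B)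
        {f g : 𝓢(ℝ, ℂ)} (_ : ‖of f‖ < r) (_ : ‖of g‖ < r) (_ : φ 0 = of f)
        (_ : ψ 0 = of (Sch.second f)) (_ : φ' 0 = of g) (_ : ψ' 0 = of (Sch.second g)) {t : ℝ}
        (_ : |t| < T + 1),
        ‖φ t - φ' t‖ ≤ 147 * L * Real.exp ((300 + 8 * B) * (T + 1)) * ‖of f - of g‖ := by
      intro B hB φ ψ φ' ψ' h h' hm f g hf hg h1 h2 h3 h4 t ht
      have h5 := IsFlow.norm_sub_le h h' hm (abs_lt.1 ht)
      rw [h1, h2, h3, h4] at h5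
      refine h5.trans ?_
      have h6 := hL f g (by linarith) (by linarith)
      have h7 : Real.exp ((300 + 8 * B) * |t|) ≤ Real.exp ((300 + 8 * B) * (T + 1)) :=
        Real.exp_le_exp.2 (mul_le_mul_of_nonneg_left ht.le (by linarith))
      have h8 := mul_le_mul h6 h7 (Real.exp_nonneg _) (by positivity)
      linarith
    have hzero : Sch.second 0 = 0 := by
      ext x
      simp [Sch.second]
    set B := 147 * L * Real.exp ((300 + 8 * 0) * (T + 1)) with hBdef
    have hB0 : 0 ≤ B := by positivity
    have hbound : ∀ f, ‖of f‖ < r → ∀ t, |t| < T + 1 → ‖Φ f t‖ ≤ B := by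
      intro f hf t ht
      have := main le_rfl (hΦ f hf).2.2 isFlow_zero (fun t _ => by simp) hf (g := 0)
        (by simpa using hr) (hΦ f hf).1 (hΦ f hf).2.1 (by simp) (by simp [hzero]) ht
      rw [map_zero, sub_zero, sub_zero] at this
      exact this.trans (mul_le_of_le_one_right hB0 (by linarith))
    set K := 147 * L * Real.exp ((300 + 8 * B) * (T + 1)) with hKdef
    refine ⟨max B K, le_max_of_le_left hB0, fun t ht => ⟨fun f hf => ?_, fun f g hf hg => ?_⟩⟩
    · exact (hbound f hf t (by linarith)).trans (le_max_left _ _)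
    · refine (main hB0 (hΦ f hf).2.2 (hΦ g hg).2.2 (fun t ht => (norm_mom2_le _).trans
        (hbound g hg t (abs_lt.2 ht))) hf hg (hΦ f hf).1 (hΦ f hf).2.1 (hΦ g hg).1 (hΦ g hg).2.1
        (by linarith)).trans ?_
      exact mul_le_mul_of_nonneg_right (le_max_right _ _) (norm_nonneg _)

end H22
end

open MeasureTheory
open scoped SchwartzMap ContDiff
open scoped BoundedContinuousFunction

noncomputable section

open Set Filter Topology

/-! ### Primitives of products of square-integrable functions -/

theorem integrable_L2_mul (g h : L2R) : Integrable (fun x => g x * h x) :=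
  (Lp.memLp g).integrable_mul (Lp.memLp h)

theorem continuous_integral_Iic {f : ℝ → ℂ} (hf : Integrable f) :
    Continuous fun x => ∫ y in Iic x, f y := by
  have h : (fun x => ∫ y in Iic x, f y) = fun x => (∫ y in Iic 0, f y) + ∫ y in (0 : ℝ)..x, f y := by
    ext x
    rw [← intervalIntegral.integral_Iic_sub_Iic hf.integrableOn hf.integrableOn]
    ring
  rw [h]
  exact continuous_const.add
    (intervalIntegral.continuous_primitive (fun a b => hf.intervalIntegrable) 0)

theorem norm_setIntegral_L2_mul_le (g h : L2R) (s : Set ℝ) :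
    ‖∫ y in s, g y * h y‖ ≤ ‖g‖ * ‖h‖ := by
  have h1 : ‖∫ y in s, g y * h y‖ ≤ ∫ y, ‖g y * h y‖ :=
    (norm_integral_le_integral_norm _).trans
      (setIntegral_le_integral (integrable_L2_mul g h).norm
        (Eventually.of_forall fun x => norm_nonneg _))
  refine h1.trans ?_
  rw [integral_norm_eq_lintegral_enorm (integrable_L2_mul g h).1, ← eLpNorm_one_eq_lintegral_enorm,
    Lp.norm_def, Lp.norm_def, ← ENNReal.toReal_mul]
  refine ENNReal.toReal_mono (ENNReal.mul_ne_top (Lp.eLpNorm_ne_top g) (Lp.eLpNorm_ne_top h)) ?_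
  have h2 := eLpNorm_smul_le_mul_eLpNorm (p := 2) (q := 2) (r := 1) (Lp.memLp h).1 (Lp.memLp g).1
  exact h2

/-- The primitive `x ↦ ∫_{-∞}^x g h` of the product of two square-integrable functions. -/
def prim : L2R →L[ℂ] L2R →L[ℂ] (ℝ →ᵇ ℂ) :=
  LinearMap.mkContinuous₂
    (LinearMap.mk₂ ℂ (fun g h : L2R => BoundedContinuousFunction.ofNormedAddCommGroup
        (fun x => ∫ y in Iic x, g y * h y) (continuous_integral_Iic (integrable_L2_mul g h))
        (‖g‖ * ‖h‖) (fun x => norm_setIntegral_L2_mul_le g h _))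
      (fun g g' h => by
        ext x
        change ∫ y in Iic x, (g + g' : L2R) y * h y =
          (∫ y in Iic x, g y * h y) + ∫ y in Iic x, g' y * h y
        rw [← integral_add (integrable_L2_mul g h).integrableOn
          (integrable_L2_mul g' h).integrableOn]
        refine integral_congr_ae (ae_restrict_of_ae ?_)
        filter_upwards [Lp.coeFn_add g g'] with y hy
        rw [hy, Pi.add_apply, add_mul])
      (fun c g h => by
        ext x
        change ∫ y in Iic x, (c • g : L2R) y * h y = c * ∫ y in Iic x, g y * h y
        rw [← integral_const_mul]
        refine integral_congr_ae (ae_restrict_of_ae ?_)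
        filter_upwards [Lp.coeFn_smul c g] with y hy
        rw [hy, Pi.smul_apply, smul_eq_mul, mul_assoc])
      (fun g h h' => by
        ext x
        change ∫ y in Iic x, g y * (h + h' : L2R) y =
          (∫ y in Iic x, g y * h y) + ∫ y in Iic x, g y * h' y
        rw [← integral_add (integrable_L2_mul g h).integrableOn
          (integrable_L2_mul g h').integrableOn]
        refine integral_congr_ae (ae_restrict_of_ae ?_)
        filter_upwards [Lp.coeFn_add h h'] with y hy
        rw [hy, Pi.add_apply, mul_add])
      (fun c g h => by
        ext x
        change ∫ y in Iic x, g y * (c • h : L2R) y = c * ∫ y in Iic x, g y * h y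
        rw [← integral_const_mul]
        refine integral_congr_ae (ae_restrict_of_ae ?_)
        filter_upwards [Lp.coeFn_smul c h] with y hy
        rw [hy, Pi.smul_apply, smul_eq_mul, mul_left_comm]))
    1 (fun g h => by
      rw [one_mul]
      exact (BoundedContinuousFunction.norm_le (by positivity)).2
        fun x => norm_setIntegral_L2_mul_le g h _)

theorem prim_apply (g h : L2R) (x : ℝ) : prim g h x = ∫ y in Iic x, g y * h y := rfl

theorem prim_toL2 (f g : 𝓢(ℝ, ℂ)) (x : ℝ) :
    prim (Sch.toL2 f) (Sch.toL2 g) x = ∫ y in Iic x, f y * g y := by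
  rw [prim_apply]
  refine integral_congr_ae (ae_restrict_of_ae ?_)
  filter_upwards [Sch.coeFn_toL2 f, Sch.coeFn_toL2 g] with y h1 h2
  rw [h1, h2]

theorem hasDerivAt_prim (f g : 𝓢(ℝ, ℂ)) (x : ℝ) :
    HasDerivAt (prim (Sch.toL2 f) (Sch.toL2 g)) (f x * g x) x := by
  have hi : Integrable (fun y => f y * g y) := (f * g).integrable
  have hc : Continuous fun y => f y * g y := f.continuous.mul g.continuous
  have h : (prim (Sch.toL2 f) (Sch.toL2 g) : ℝ → ℂ) =
      fun x => (∫ y in Iic 0, f y * g y) + ∫ y in (0 : ℝ)..x, f y * g y := by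
    ext x
    rw [prim_toL2, ← intervalIntegral.integral_Iic_sub_Iic hi.integrableOn hi.integrableOn]
    ring
  rw [h]
  exact (intervalIntegral.integral_hasDerivAt_right hi.intervalIntegrable
    hc.stronglyMeasurable.stronglyMeasurableAtFilter hc.continuousAt).const_add _

/-- Applied to the local conservation of mass, this makes the time derivative of the gauge phase a
local expression. -/
theorem prim_add_eq {f g f' g' W : 𝓢(ℝ, ℂ)} (h : f * g + f' * g' = Sch.D W) :
    prim (Sch.toL2 f) (Sch.toL2 g) + prim (Sch.toL2 f') (Sch.toL2 g') = Sch.toB W := by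
  ext x
  change prim (Sch.toL2 f) (Sch.toL2 g) x + prim (Sch.toL2 f') (Sch.toL2 g') x = W x
  have h1 : Integrable (fun y => f y * g y) := (f * g).integrable
  have h2 : Integrable (fun y => f' y * g' y) := (f' * g').integrable
  rw [prim_toL2, prim_toL2, ← integral_add h1.integrableOn h2.integrableOn]
  have h3 : (fun y => f y * g y + f' y * g' y) = fun y => Sch.D W y := by
    ext y
    exact DFunLike.congr_fun h y
  rw [h3, integral_Iic_of_hasDerivAt_of_tendsto W.continuous.continuousWithinAt
    (fun y _ => Sch.hasDerivAt W y) (Sch.D W).integrable.integrableOn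
    (m := 0) ((zero_at_infty W).mono_left atBot_le_cocompact), sub_zero]

/-! ### The exponential of a bounded continuous function -/

/-- Evaluation at a point, as a ring homomorphism. -/
def bcfEval (x : ℝ) : (ℝ →ᵇ ℂ) →+* ℂ where
  toFun b := b x
  map_one' := rfl
  map_mul' _ _ := rfl
  map_zero' := rfl
  map_add' _ _ := rfl

theorem bcfExp_apply (b : ℝ →ᵇ ℂ) (x : ℝ) : NormedSpace.exp b x = Complex.exp (b x) := by
  have h := NormedSpace.map_exp (bcfEval x)
    (BoundedContinuousFunction.evalCLM ℂ x).continuous b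
  rw [Complex.exp_eq_exp_ℂ]
  exact h

theorem norm_bcfExp_le (b : ℝ →ᵇ ℂ) : ‖NormedSpace.exp b‖ ≤ Real.exp ‖b‖ := by
  refine (BoundedContinuousFunction.norm_le (Real.exp_nonneg _)).2 fun x => ?_
  rw [bcfExp_apply, Complex.norm_exp]
  exact Real.exp_le_exp.2 ((Complex.re_le_norm _).trans (b.norm_coe_le_norm x))

/-- The mean value inequality: in this commutative Banach algebra the derivative of exp at x is
multiplication by exp x. -/
theorem lipBdd_bcfExp : LipBdd (fun b : ℝ →ᵇ ℂ => NormedSpace.exp b) := fun R => by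
  refine ⟨Real.exp R, Real.exp_nonneg _, fun a b ha hb => ?_⟩
  refine Convex.norm_image_sub_le_of_norm_hasFDerivWithin_le (𝕜 := ℂ)
    (s := Metric.closedBall (0 : ℝ →ᵇ ℂ) R)
    (fun x _ => (hasFDerivAt_exp (𝕂 := ℂ)).hasFDerivWithinAt) (fun x hx => ?_)
    (convex_closedBall _ _) (by simpa using hb) (by simpa using ha)
  refine ContinuousLinearMap.opNorm_le_bound _ (Real.exp_nonneg _) fun c => ?_
  refine (norm_mul_le (NormedSpace.exp x) c).trans
    (mul_le_mul_of_nonneg_right ((norm_bcfExp_le x).trans ?_) (norm_nonneg _))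
  exact Real.exp_le_exp.2 (by simpa using hx)

end

open MeasureTheory
open scoped SchwartzMap ContDiff
open scoped BoundedContinuousFunction

noncomputable section

open Set Filter Topology

/-! ### The gauge transformation -/

/-- The gauge factor `exp(iσ ∫_{-∞}^x |q|²)`. -/
def gaugeExp (σ : ℝ) (q : L2R) : ℝ →ᵇ ℂ := NormedSpace.exp ((σ * Complex.I) • prim (conjL2 q) q)

theorem gaugeExp_apply (σ : ℝ) (q : L2R) (x : ℝ) :
    gaugeExp σ q x = Complex.exp (σ * Complex.I * prim (conjL2 q) q x) := bcfExp_apply _ _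

theorem star_prim_conj (q : L2R) (x : ℝ) :
    (starRingEnd ℂ) (prim (conjL2 q) q x) = prim (conjL2 q) q x := by
  rw [prim_apply, ← integral_conj]
  refine integral_congr_ae (ae_restrict_of_ae ?_)
  filter_upwards [coeFn_conjL2 q] with y hy
  rw [hy]
  simp [_root_.mul_comm]

theorem gaugeExp_neg_mul (σ : ℝ) (q : L2R) : gaugeExp (-σ) q * gaugeExp σ q = 1 := by
  ext x
  change gaugeExp (-σ) q x * gaugeExp σ q x = 1
  rw [gaugeExp_apply, gaugeExp_apply, ← Complex.exp_add]
  simp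

theorem star_gaugeExp (σ : ℝ) (q : L2R) : star (gaugeExp σ q) = gaugeExp (-σ) q := by
  ext x
  change (starRingEnd ℂ) (gaugeExp σ q x) = gaugeExp (-σ) q x
  rw [gaugeExp_apply, gaugeExp_apply, ← Complex.exp_conj]
  congr 1
  simp [star_prim_conj]

theorem star_gaugeExp_mul (σ : ℝ) (q : L2R) (x : ℝ) :
    (starRingEnd ℂ) (gaugeExp σ q x) * gaugeExp σ q x = 1 := by
  have h := gaugeExp_neg_mul σ q
  rw [← star_gaugeExp] at h
  exact DFunLike.congr_fun h x

namespace Sch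

/-- The primitive need not decay, but it is bounded with Schwartz derivative; hence gauge factors
map Schwartz functions to Schwartz functions. -/
theorem hasTemperateGrowth_prim (f g : 𝓢(ℝ, ℂ)) :
    Function.HasTemperateGrowth (prim (toL2 f) (toL2 g) : ℝ → ℂ) := by
  refine Function.HasTemperateGrowth.of_fderiv (k := 0) (C := ‖prim (toL2 f) (toL2 g)‖) ?_
    (fun x => (hasDerivAt_prim f g x).differentiableAt)
    (fun x => by simpa using (prim (toL2 f) (toL2 g)).norm_coe_le_norm x)
  have h : fderiv ℝ (prim (toL2 f) (toL2 g) : ℝ → ℂ) =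
      (ContinuousLinearMap.toSpanSingletonCLE (𝕜 := ℝ) (E := ℂ)).toContinuousLinearMap ∘ (f * g) := by
    ext x
    rw [(hasDerivAt_prim f g x).hasFDerivAt.fderiv]
    simp
  rw [h]
  exact (ContinuousLinearMap.hasTemperateGrowth _).comp (f * g).hasTemperateGrowth

theorem hasTemperateGrowth_gaugeExp (σ : ℝ) (f : 𝓢(ℝ, ℂ)) :
    Function.HasTemperateGrowth (gaugeExp σ (toL2 f) : ℝ → ℂ) := by
  have h1 := (Complex.reCLM.hasTemperateGrowth).comp (hasTemperateGrowth_prim (star f) f)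
  have h2 := ((σ • ContinuousLinearMap.id ℝ ℝ).hasTemperateGrowth).comp h1
  have h3 := hasTemperateGrowth_cexp_mul_I.comp h2
  convert h3 using 1
  ext x
  have h4 := Complex.conj_eq_iff_re.1 (star_prim_conj (toL2 f) x)
  rw [conjL2_toL2] at h4
  rw [gaugeExp_apply, conjL2_toL2, ← h4]
  simp
  ring_nf

/-- Multiplication of `p` by the gauge factor of `f`. -/
def twist (σ : ℝ) (f p : 𝓢(ℝ, ℂ)) : 𝓢(ℝ, ℂ) :=
  SchwartzMap.smulLeftCLM ℂ (gaugeExp σ (toL2 f)) p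

variable (σ : ℝ) (f p : 𝓢(ℝ, ℂ))

@[simp] theorem twist_apply (x : ℝ) : twist σ f p x = gaugeExp σ (toL2 f) x * p x :=
  SchwartzMap.smulLeftCLM_apply_apply (hasTemperateGrowth_gaugeExp σ f) p x

theorem hasDerivAt_gaugeExp (x : ℝ) : HasDerivAt (gaugeExp σ (toL2 f) : ℝ → ℂ)
    (σ * Complex.I * (star f x * f x) * gaugeExp σ (toL2 f) x) x := by
  have h : (gaugeExp σ (toL2 f) : ℝ → ℂ) =
      fun x => Complex.exp (σ * Complex.I * prim (toL2 (star f)) (toL2 f) x) := by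
    ext x
    rw [gaugeExp_apply, conjL2_toL2]
  rw [h]
  refine (((hasDerivAt_prim (star f) f x).const_mul (σ * Complex.I)).cexp).congr_deriv ?_
  ring

theorem D_twist : D (twist σ f p) =
    twist σ f (D p + (σ * Complex.I) • (star f * f * p)) := by
  ext x
  have h : HasDerivAt (twist σ f p) (σ * Complex.I * (star f x * f x) * gaugeExp σ (toL2 f) x * p x +
      gaugeExp σ (toL2 f) x * D p x) x := by
    refine ((hasDerivAt_gaugeExp σ f x).mul (hasDerivAt p x)).congr_of_eventuallyEq
      (Eventually.of_forall fun y => ?_)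
    exact twist_apply σ f p y
  rw [(hasDerivAt (twist σ f p) x).unique h]
  simp
  ring

theorem toL2_twist : toL2 (twist σ f p) = bcfMul (gaugeExp σ (toL2 f)) (toL2 p) := by
  apply Lp.ext
  filter_upwards [coeFn_toL2 (twist σ f p), coeFn_bcfMul (gaugeExp σ (toL2 f)) (toL2 p),
    coeFn_toL2 p] with x h1 h2 h3
  rw [h1, h2, h3, twist_apply]

theorem X_twist : X (twist σ f p) = twist σ f (X p) := by
  ext x
  simp
  ring

theorem twist_mul_twist_star : twist σ f p * star (twist σ f p) = p * star p := by
  ext x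
  have h := star_gaugeExp_mul σ (toL2 f) x
  simp
  linear_combination (p x * (starRingEnd ℂ) (p x)) * h

/-- The gauge factor depends on |f|² only, and |f|² is gauge invariant; this is why opposite gauge
transforms are inverse to each other. -/
theorem toL2_eq_of_star_mul {f g : 𝓢(ℝ, ℂ)} (h : f * star f = g * star g) (σ : ℝ) :
    gaugeExp σ (toL2 f) = gaugeExp σ (toL2 g) := by
  ext x
  rw [gaugeExp_apply, gaugeExp_apply, conjL2_toL2, conjL2_toL2, prim_toL2, prim_toL2]
  congr 2
  have h1 : ∀ y, star f y * f y = star g y * g y := fun y => by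
    have := DFunLike.congr_fun h y
    simp only [mul_apply] at this
    rw [_root_.mul_comm, this, _root_.mul_comm]
  simp only [h1]

theorem twist_twist_neg : twist σ (twist (-σ) f f) (twist (-σ) f f) = f := by
  ext x
  have h := DFunLike.congr_fun (gaugeExp_neg_mul σ (toL2 f)) x
  change gaugeExp (-σ) (toL2 f) x * gaugeExp σ (toL2 f) x = 1 at h
  rw [twist_apply, toL2_eq_of_star_mul (twist_mul_twist_star (-σ) f f), twist_apply]
  linear_combination f x * h

end Sch

namespace H22

/-- The components of the gauge transform of an element of `H^{2,2}(ℝ)`. -/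
def gaugePair (σ : ℝ) (q : H22) : WithLp 1 (L2R × L2R) :=
  pair (bcfMul (gaugeExp σ (jet0 q)) (jet0 q + mom2 q),
    bcfMul (gaugeExp σ (jet0 q)) (jet2 q + (σ * Complex.I) • jet1 (cub q q (conj q)) +
      (σ * Complex.I) • bcfMul (bdd0 (conj q) * bdd0 q)
        (jet1 q + (σ * Complex.I) • jet0 (cub q q (conj q)))))

theorem lipBdd_gaugeExp (σ : ℝ) : LipBdd fun q : H22 => gaugeExp σ (jet0 q) := by
  simp only [gaugeExp, ← jet0_conj]
  have hc : LipBdd fun q : H22 => conj q := LipBdd.id.h22conj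
  have h : LipBdd fun q : H22 => prim (jet0 (conj q)) (jet0 q) :=
    LipBdd.bilin prim (hc.clm jet0) (.of_clm jet0)
  exact lipBdd_bcfExp.comp (h.smul (σ * Complex.I))

theorem lipBdd_gaugePair (σ : ℝ) : LipBdd (gaugePair σ) := by
  have hE := lipBdd_gaugeExp σ
  have hR : LipBdd fun q => cub q q (conj q) := lipBdd_cub .id .id LipBdd.id.h22conj
  have h1 : LipBdd fun q : H22 => jet0 q + mom2 q := (LipBdd.of_clm jet0).add (.of_clm mom2)
  have h2 : LipBdd fun q : H22 => jet1 q + (σ * Complex.I) • jet0 (cub q q (conj q)) :=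
    (LipBdd.of_clm jet1).add ((hR.clm jet0).smul _)
  have hc : LipBdd fun q : H22 => conj q := LipBdd.id.h22conj
  have h3 : LipBdd fun q : H22 => bdd0 (conj q) * bdd0 q := (hc.clm bdd0).mul
    (.of_clm bdd0)
  have h4 : LipBdd fun q : H22 => jet2 q + (σ * Complex.I) • jet1 (cub q q (conj q)) +
      (σ * Complex.I) • bcfMul (bdd0 (conj q) * bdd0 q)
        (jet1 q + (σ * Complex.I) • jet0 (cub q q (conj q))) :=
    ((LipBdd.of_clm jet2).add ((hR.clm jet1).smul _)).add ((LipBdd.bilin bcfMul h3 h2).smul _)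
  have h5 := (LipBdd.bilin bcfMul hE h1).prodMk (LipBdd.bilin bcfMul hE h4)
  exact LipBdd.clm pair h5

theorem gaugePair_of (σ : ℝ) (f : 𝓢(ℝ, ℂ)) : gaugePair σ (of f) = (of (Sch.twist σ f f)).1 := by
  rw [← pair_of, gaugePair]
  congr 2
  · rw [Sch.X_twist, Sch.X_twist, map_add, Sch.toL2_twist, Sch.toL2_twist, ← map_add]
    simp
  · rw [Sch.D_twist, Sch.D_twist, Sch.toL2_twist]
    simp only [conj_of, cub_of, jet0_of, jet1_of, jet2_of, bdd0_of, Sch.toB_mul, ← map_smul,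
      ← map_add, bcfMul_toB]
    congr 2
    ext x
    simp
    ring

theorem gaugePair_mem (σ : ℝ) (q : H22) : gaugePair σ q ∈ H22Submodule := by
  refine denseRange_of.induction_on (p := fun q => gaugePair σ q ∈ H22Submodule) q
    (isClosed_submodule.preimage (lipBdd_gaugePair σ).continuous) fun f => ?_
  rw [gaugePair_of]
  exact (of (Sch.twist σ f f)).2

/-- The gauge transform `q exp(iσ ∫_{-∞}^x |q|²)`. -/
def gauge (σ : ℝ) (q : H22) : H22 := ⟨gaugePair σ q, gaugePair_mem σ q⟩

theorem gauge_of (σ : ℝ) (f : 𝓢(ℝ, ℂ)) : gauge σ (of f) = of (Sch.twist σ f f) :=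
  Subtype.ext (gaugePair_of σ f)

theorem lipBdd_gauge (σ : ℝ) : LipBdd (gauge σ) := lipBdd_gaugePair σ

theorem jet0_gauge (σ : ℝ) : ∀ q, jet0 (gauge σ q) = bcfMul (gaugeExp σ (jet0 q)) (jet0 q) :=
  eq_of_schwartz (jet0.continuous.comp (lipBdd_gauge σ).continuous)
    ((lipBdd_gaugeExp σ).continuous.bcfMul (by fun_prop)) fun f => by
      rw [gauge_of, jet0_of, jet0_of, Sch.toL2_twist]

theorem gauge_gauge_neg (σ : ℝ) (f : 𝓢(ℝ, ℂ)) : gauge σ (gauge (-σ) (of f)) = of f := by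
  rw [gauge_of, gauge_of, Sch.twist_twist_neg]

end H22
end

/-! ### From the gauged equation back to DNLS -/

open MeasureTheory
open scoped SchwartzMap ContDiff
open scoped BoundedContinuousFunction

noncomputable section

open Set Filter Topology

theorem HasDerivAt.bilinC {F G H : Type*} [NormedAddCommGroup F] [NormedSpace ℂ F] [NormedSpace ℝ F]
    [IsScalarTower ℝ ℂ F] [NormedAddCommGroup G] [NormedSpace ℂ G] [NormedSpace ℝ G]
    [IsScalarTower ℝ ℂ G] [NormedAddCommGroup H] [NormedSpace ℂ H] [NormedSpace ℝ H]
    [IsScalarTower ℝ ℂ H] (B : F →L[ℂ] G →L[ℂ] H) {f : ℝ → F} {g : ℝ → G} {f' : F} {g' : G} {t : ℝ}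
    (hf : HasDerivAt f f' t) (hg : HasDerivAt g g' t) :
    HasDerivAt (fun r => B (f r) (g r)) (B (f t) g' + B f' (g t)) t := by
  have h1 := hasDerivAt_clm_of_eq_zero (T := fun r => B (f r))
    (B.continuous.continuousAt.comp hf.continuousAt) (hg.sub_const (g t)) (sub_self _)
  have h2 := hf.clmC (B.flip (g t))
  refine (h1.add h2).congr_of_eventuallyEq (Eventually.of_forall fun r => ?_)
  simp

theorem hasDerivAt_gaugeExp {q : ℝ → L2R} {q' : L2R} {t : ℝ} (σ : ℝ) (hq : HasDerivAt q q' t) :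
    HasDerivAt (fun r => gaugeExp σ (q r)) (gaugeExp σ (q t) *
      ((σ * Complex.I) • (prim (conjL2 (q t)) q' + prim (conjL2 q') (q t)))) t := by
  have h1 : HasDerivAt (fun r => conjL2 (q r)) (conjL2 q') t :=
    conjL2.hasFDerivAt.comp_hasDerivAt t hq
  have h2 := (h1.bilinC prim hq).clmC ((σ * Complex.I) • ContinuousLinearMap.id ℂ (ℝ →ᵇ ℂ))
  exact (hasFDerivAt_exp (𝕂 := ℝ)).comp_hasDerivAt t h2

namespace H22

/-- The left side is the time derivative of f exp(i∫_{-∞}^x |f|²) along the gauged equation. The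
phase contributes i times the time derivative of ∫|f|², which is the local quantity W below; the
rest is pointwise algebra. -/
theorem gauge_rate_of (f : 𝓢(ℝ, ℂ)) : bcfMul (gaugeExp 1 (jet0 (of f))) (gaugedRate (of f)) +
    bcfMul (gaugeExp 1 (jet0 (of f)) * (((1 : ℝ) * Complex.I) •
      (prim (conjL2 (jet0 (of f))) (gaugedRate (of f)) +
        prim (conjL2 (gaugedRate (of f))) (jet0 (of f))))) (jet0 (of f)) =
    Complex.I • jet2 (gauge 1 (of f)) +
      jet1 (cub (gauge 1 (of f)) (gauge 1 (of f)) (conj (gauge 1 (of f)))) := by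
  obtain ⟨F, hF⟩ : ∃ F, F = Complex.I • Sch.D (Sch.D f) -
      f * (f * star (Sch.D f + (Complex.I / 2) • (f * (f * star f)))) := ⟨_, rfl⟩
  -- The mass current: with f_t = F one has (|f|²)_t = W_x.
  obtain ⟨W, hW⟩ : ∃ W, W = Complex.I • (star f * Sch.D f - f * star (Sch.D f)) -
      (1 / 2 : ℂ) • (f * f * star f * star f) := ⟨_, rfl⟩
  have h1 : gaugedRate (of f) = Sch.toL2 F := by
    rw [gaugedRate, ← jet0_second, jet0_of, hF, Sch.second]
    simp only [jet2_of, bdd0_of, conjL2_toL2, bcfMul_toB, map_sub, map_smul]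
  have h2 : prim (Sch.toL2 (star f)) (Sch.toL2 F) + prim (Sch.toL2 (star F)) (Sch.toL2 f) =
      Sch.toB W := prim_add_eq (by
    rw [hW, hF]
    ext x
    simp
    ring)
  have h3 : Sch.twist 1 f f * (Sch.twist 1 f f * star (Sch.twist 1 f f)) =
      Sch.twist 1 f (f * (f * star f)) := by
    rw [Sch.twist_mul_twist_star]
    ext x
    simp
    ring
  rw [h1, gauge_of, conj_of, cub_of, h3, jet0_of, jet1_of, jet2_of, conjL2_toL2, conjL2_toL2, h2,
    Sch.D_twist, Sch.D_twist, Sch.D_twist, ← map_smul Sch.toB, bcfMul_mul, bcfMul_toB,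
    Sch.toL2_twist, Sch.toL2_twist, ← map_smul, ← map_add, ← map_add, ← map_smul, ← map_add]
  rw [← map_add Sch.toL2]
  congr 2
  rw [hF, hW]
  ext x
  simp
  ring_nf
  simp [Complex.I_sq]
  ring

theorem continuous_gaugedRate : Continuous gaugedRate := by
  have := lipBdd_second0.continuous
  unfold gaugedRate
  fun_prop

/-- The time derivative of a solution of the derivative nonlinear Schrödinger equation. -/
def dnlsRate (q : H22) : L2R := Complex.I • jet2 q + jet1 (cub q q (conj q))

@[fun_prop]
theorem continuous_dnlsRate : Continuous dnlsRate := by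
  unfold dnlsRate
  fun_prop

theorem gauge_rate : ∀ q : H22, bcfMul (gaugeExp 1 (jet0 q)) (gaugedRate q) +
    bcfMul (gaugeExp 1 (jet0 q) * (((1 : ℝ) * Complex.I) •
      (prim (conjL2 (jet0 q)) (gaugedRate q) + prim (conjL2 (gaugedRate q)) (jet0 q)))) (jet0 q) =
    dnlsRate (gauge 1 q) := by
  have h1 := continuous_gaugedRate
  have h2 := (lipBdd_gaugeExp 1).continuous
  have h3 := (lipBdd_gauge 1).continuous
  refine eq_of_schwartz ?_ (by fun_prop) gauge_rate_of
  fun_prop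

theorem hasDerivAt_jet0_gauge {φ : ℝ → H22} {t : ℝ}
    (h : HasDerivAt (fun s => jet0 (φ s)) (gaugedRate (φ t)) t) :
    HasDerivAt (fun s => jet0 (gauge 1 (φ s))) (dnlsRate (gauge 1 (φ t))) t := by
  have h1 := (hasDerivAt_gaugeExp 1 h).bilinC bcfMul h
  simp only [jet0_gauge]
  rwa [← gauge_rate]

end H22
end

open MeasureTheory
open scoped SchwartzMap ContDiff
open scoped BoundedContinuousFunction

noncomputable section

open Set Filter Topology

/-! ### Solutions and their uniqueness -/

theorem norm_inv_one_add_sq_le (x : ℝ) : ‖(1 + (x : ℂ) ^ 2)⁻¹‖ ≤ 1 := by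
  rw [norm_inv, H22.norm_one_add_sq]
  exact inv_le_one_of_one_le₀ (by nlinarith [sq_nonneg x])

theorem one_add_sq_ne_zero (x : ℝ) : (1 + (x : ℂ) ^ 2) ≠ 0 := by
  rw [← norm_ne_zero_iff, H22.norm_one_add_sq]
  positivity

/-- The function `(1 + x²)⁻¹`. -/
def invWeight : ℝ →ᵇ ℂ :=
  BoundedContinuousFunction.ofNormedAddCommGroup (fun x : ℝ => (1 + (x : ℂ) ^ 2)⁻¹)
    (Continuous.inv₀ (by fun_prop) one_add_sq_ne_zero) 1 norm_inv_one_add_sq_le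

theorem invWeight_apply (x : ℝ) : invWeight x = (1 + (x : ℂ) ^ 2)⁻¹ := rfl

theorem memLp_invWeight : MemLp (invWeight : ℝ → ℂ) 2 (volume : Measure ℝ) := by
  rw [memLp_two_iff_integrable_sq_norm invWeight.continuous.aestronglyMeasurable]
  refine integrable_inv_one_add_sq.mono' (by fun_prop) (Eventually.of_forall fun x => ?_)
  have h := norm_inv_one_add_sq_le x
  rw [norm_pow, norm_norm, invWeight_apply, sq]
  refine (mul_le_of_le_one_left (norm_nonneg _) h).trans ?_
  rw [norm_inv, H22.norm_one_add_sq]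

namespace H22

local notation "⟪" x ", " y "⟫" => inner ℂ x y

theorem bcfMul_invWeight_fst : ∀ q : H22, bcfMul invWeight (jet0 q + mom2 q) = jet0 q :=
  eq_of_schwartz (by fun_prop) (by fun_prop) fun f => by
    simp only [jet0_of, mom2_of, ← map_add]
    apply Lp.ext
    filter_upwards [coeFn_bcfMul invWeight (Sch.toL2 (f + Sch.X (Sch.X f))),
      Sch.coeFn_toL2 (f + Sch.X (Sch.X f)), Sch.coeFn_toL2 f] with x h1 h2 h3
    rw [h1, h2, h3, invWeight_apply]
    have := one_add_sq_ne_zero x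
    simp only [add_apply, Sch.X_apply]
    field_simp

theorem coeFn_jet0 (q : H22) : (jet0 q : ℝ → ℂ) =ᵐ[volume] q.toFun := by
  have h := coeFn_bcfMul invWeight q.1.fst
  rwa [fst_eq, bcfMul_invWeight_fst, ← fst_eq] at h

theorem toL2_eq (q : H22) : q.toL2 = jet0 q :=
  Lp.ext (q.memLp_toFun.coeFn_toLp.trans (coeFn_jet0 q).symm)

/-- Bounded functions need not lie in L². Multiplying by (1 + x²)⁻¹, which does, yields an identity
in L² between continuous functions of q, to which density applies. -/
theorem coeFn_bdd0 (q : H22) : (jet0 q : ℝ → ℂ) =ᵐ[volume] bdd0 q := by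
  have h : ∀ q : H22, bcfMul invWeight (jet0 q) = bcfMul (bdd0 q) (memLp_invWeight.toLp _) :=
    eq_of_schwartz (by fun_prop) (by fun_prop) fun f => by
      rw [jet0_of, bdd0_of]
      apply Lp.ext
      filter_upwards [coeFn_bcfMul invWeight (Sch.toL2 f), Sch.coeFn_toL2 f,
        coeFn_bcfMul (Sch.toB f) (memLp_invWeight.toLp _), memLp_invWeight.coeFn_toLp]
        with x h1 h2 h3 h4
      rw [h1, h2, h3, h4, Sch.toB_apply, _root_.mul_comm]
  have h0 := coeFn_bcfMul invWeight (jet0 q)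
  rw [h q] at h0
  filter_upwards [h0, coeFn_bcfMul (bdd0 q) (memLp_invWeight.toLp _), memLp_invWeight.coeFn_toLp]
    with x h1 h2 h3
  rw [h2, h3, _root_.mul_comm] at h1
  exact (mul_left_cancel₀ (inv_ne_zero (one_add_sq_ne_zero x)) h1).symm

/-- Pairings of q'' and x²q with Schwartz functions are pairings of q alone. -/
theorem jet0_injective {q r : H22} (h : jet0 q = jet0 r) : q = r := by
  have h2 : ∀ (f : 𝓢(ℝ, ℂ)) (q : H22), ⟪Sch.toL2 f, jet2 q⟫ = ⟪Sch.toL2 (Sch.D (Sch.D f)), jet0 q⟫ :=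
    fun f q => by
      have e1 := inner_jet1_jet1 (of f) q
      have e2 := inner_jet2_jet0 (of f) q
      rw [jet0_of] at e1
      rw [e1, neg_neg, jet2_of] at e2
      exact e2.symm
  have h3 : ∀ (f : 𝓢(ℝ, ℂ)) (q : H22),
      ⟪Sch.toL2 f, mom2 q⟫ = ⟪Sch.toL2 (Sch.X (Sch.X f)), jet0 q⟫ := fun f =>
    eq_of_schwartz (by fun_prop) (by fun_prop) fun g => by
      simp only [mom2_of, jet0_of, Sch.inner_toL2]
      congr 1
      ext x
      simp
      ring
  exact eq_iff_jet.2 ⟨h, eq_of_inner_toL2 fun f => by rw [h3, h3, h],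
    eq_of_inner_toL2 fun f => by rw [h2, h2, h]⟩

theorem integral_jet0_mul_deriv (g : 𝓢(ℝ, ℂ)) (q : H22) :
    ∫ x, jet0 q x * deriv g x = -∫ x, jet1 q x * g x := by
  have key : ∀ (h : 𝓢(ℝ, ℂ)) (p : L2R), ∫ x, p x * h x = ⟪Sch.toL2 (star h), p⟫ := fun h p => by
    rw [L2.inner_def]
    refine integral_congr_ae ?_
    filter_upwards [Sch.coeFn_toL2 (star h)] with x hx
    rw [hx]
    simp
  have h1 := inner_jet1_jet0 (of (star g)) q
  rw [jet0_of, jet1_of, Sch.D_star, ← key, ← key] at h1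
  exact h1

theorem isWeakDeriv_jet (q : H22) : IsWeakDeriv (jet0 q) (jet1 q) := fun _ h1 h2 =>
  integral_jet0_mul_deriv (h2.toSchwartzMap h1) q

theorem coeFn_jet0_cub (q : H22) : (jet0 (cub q q (conj q)) : ℝ → ℂ) =ᵐ[volume]
    fun x => ((‖q.toFun x‖ ^ 2 : ℝ) : ℂ) * q.toFun x := by
  simp only [cub, jet0_mul, jet0_conj]
  filter_upwards [coeFn_bcfMul (bdd0 q) (bcfMul (bdd0 q) (conjL2 (jet0 q))),
    coeFn_bcfMul (bdd0 q) (conjL2 (jet0 q)), coeFn_conjL2 (jet0 q), coeFn_bdd0 q, coeFn_jet0 q]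
    with x h1 h2 h3 h4 h5
  rw [h1, h2, h3, ← h4, h5, Complex.ofReal_pow, ← Complex.mul_conj']
  simp
  ring

theorem isWeakDeriv_cubic (q : H22) : IsWeakDeriv
    (fun x => ((‖q.toFun x‖ ^ 2 : ℝ) : ℂ) * q.toFun x) (jet1 (cub q q (conj q))) := by
  intro φ h1 h2
  rw [← isWeakDeriv_jet (cub q q (conj q)) φ h1 h2]
  refine integral_congr_ae ?_
  filter_upwards [coeFn_jet0_cub q] with x hx
  rw [hx]

/-- The fundamental lemma of the calculus of variations; it identifies the N of the definition of a
solution with `jet1` of the cubic. -/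
theorem eq_of_isWeakDeriv {f : ℝ → ℂ} {g h : L2R} (hg : IsWeakDeriv f g) (hh : IsWeakDeriv f h) :
    g = h := by
  have hi : ∀ k : L2R, LocallyIntegrable k volume := fun k =>
    (Lp.memLp k).locallyIntegrable (by norm_num)
  have hd := ae_eq_zero_of_integral_contDiff_smul_eq_zero (f := fun x => g x - h x)
    ((hi g).sub (hi h)) (fun φ h1 h2 => by
      have c1 : ContDiff ℝ ∞ fun x => (φ x : ℂ) := Complex.ofRealCLM.contDiff.comp h1
      have c2 : HasCompactSupport fun x => (φ x : ℂ) := h2.comp_left (g := fun y : ℝ => (y : ℂ)) rfl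
      have e := (hg _ c1 c2).symm.trans (hh _ c1 c2)
      rw [neg_inj] at e
      have i : ∀ k : L2R, Integrable fun x => k x * (φ x : ℂ) := fun k =>
        (Lp.memLp k).integrable_mul (q := 2) (c1.continuous.memLp_of_hasCompactSupport c2)
      simp only [Complex.real_smul, _root_.mul_comm (φ _ : ℂ), sub_mul]
      rw [integral_sub (i g) (i h), e, sub_self])
  apply Lp.ext
  filter_upwards [hd] with x hx
  exact sub_eq_zero.1 hx

theorem isDNLSSolution_iff {u₀ : H22} {u : ℝ → H22} : IsDNLSSolution u₀ u ↔
    Continuous u ∧ u 0 = u₀ ∧ ∀ t, HasDerivAt (fun s => jet0 (u s)) (dnlsRate (u t)) t := by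
  have hI : Complex.I * Complex.I = -1 := Complex.I_mul_I
  constructor
  · rintro ⟨h1, h2, h3⟩
    refine ⟨h1, h2, fun t => ?_⟩
    obtain ⟨ut, N, h4, h5, h6⟩ := h3 t
    simp only [toL2_eq] at h4
    rw [eq_of_isWeakDeriv h5 (isWeakDeriv_cubic (u t)), deriv2, snd_eq] at h6
    have h7 : ut = dnlsRate (u t) := by
      have h8 := congrArg (fun z : L2R => -Complex.I • z) h6
      simp only [smul_add, smul_smul, neg_mul, hI, neg_neg, one_smul] at h8
      rw [dnlsRate, ← h8]
      simp
    rwa [← h7]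
  · rintro ⟨h1, h2, h3⟩
    refine ⟨h1, h2, fun t => ⟨dnlsRate (u t), jet1 (cub (u t) (u t) (conj (u t))), ?_,
      isWeakDeriv_cubic (u t), ?_⟩⟩
    · simpa only [toL2_eq] using h3 t
    · rw [dnlsRate, deriv2, snd_eq, smul_add, smul_smul, hI]
      simp

/-- The zero-order terms in the energy identity for the difference of two solutions. -/
def diffCoeff (m d : H22) : L2R :=
  bcfMul (bdd1 m * star (bdd0 m) + bdd0 m * star (bdd1 m) +
    (1 / 8 : ℂ) • (bdd1 d * star (bdd0 d) + bdd0 d * star (bdd1 d))) (jet0 d) +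
  bcfMul (bdd0 m * bdd1 m) (conjL2 (jet0 d))

/-- In terms of the midpoint m and the difference d of u and v, |u|²u - |v|²v = 2|m|²d + m²d̄ +
(1/4)|d|²d. Paired with d in L², the terms containing d_x become total derivatives up to terms whose
derivatives sit in bounded coefficients, and i d_xx has no real part. -/
theorem re_inner_dnlsRate_sub : ∀ m d : H22,
    (⟪jet0 d, dnlsRate (m + (1 / 2 : ℂ) • d) - dnlsRate (m - (1 / 2 : ℂ) • d)⟫).re =
      (⟪jet0 d, diffCoeff m d⟫).re :=
  eq_of_schwartz₂ (by fun_prop) (by unfold diffCoeff; fun_prop) fun m d => by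
    have e1 : ∀ f : 𝓢(ℝ, ℂ), dnlsRate (of f) =
        Sch.toL2 (Complex.I • Sch.D (Sch.D f) + Sch.D (f * (f * star f))) := fun f => by
      simp only [dnlsRate, conj_of, cub_of, jet1_of, jet2_of, map_add, map_smul]
    obtain ⟨B, hB⟩ : ∃ B, B = (Sch.D m * star m + m * star (Sch.D m) +
      (1 / 8 : ℂ) • (Sch.D d * star d + d * star (Sch.D d))) * d + m * Sch.D m * star d := ⟨_, rfl⟩
    have e2 : diffCoeff (of m) (of d) = Sch.toL2 B := by
      rw [diffCoeff, hB]
      simp only [bdd0_of, bdd1_of, jet0_of, Sch.star_toB, Sch.toB_mul, conjL2_toL2]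
      rw [← map_add Sch.toB, ← map_add Sch.toB, ← map_smul Sch.toB, ← map_add Sch.toB]
      simp only [bcfMul_toB]
      rw [← map_add]
    rw [← map_smul, ← map_add, ← map_sub, e1, e1, e2, jet0_of, ← map_sub, Sch.inner_toL2,
      Sch.inner_toL2, ← sub_eq_zero, ← Complex.sub_re, ← map_sub]
    refine Sch.re_int_eq_zero (W := Complex.I • (star d * Sch.D d - d * star (Sch.D d)) +
      (2 : ℂ) • (m * star m * d * star d) + (1 / 4 : ℂ) • (d * star d * d * star d) +
      (1 / 2 : ℂ) • (m * m * star d * star d + star m * star m * d * d)) ?_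
    rw [hB]
    ext x
    simp
    ring

theorem exists_diffCoeff_le : ∃ k : H22 → H22 → ℝ, (Continuous fun p : H22 × H22 => k p.1 p.2) ∧
    ∀ m d, |(⟪jet0 d, diffCoeff m d⟫).re| ≤ k m d * ‖jet0 d‖ ^ 2 := by
  refine ⟨fun m d => ‖bdd1 m * star (bdd0 m) + bdd0 m * star (bdd1 m) +
    (1 / 8 : ℂ) • (bdd1 d * star (bdd0 d) + bdd0 d * star (bdd1 d))‖ + ‖bdd0 m * bdd1 m‖,
    by fun_prop, fun m d => ?_⟩
  refine (Complex.abs_re_le_norm _).trans ((norm_inner_le_norm _ _).trans ?_)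
  have h := norm_add_le_of_le (norm_bcfMul_le (bdd1 m * star (bdd0 m) + bdd0 m * star (bdd1 m) +
    (1 / 8 : ℂ) • (bdd1 d * star (bdd0 d) + bdd0 d * star (bdd1 d))) (jet0 d))
    (norm_bcfMul_le (bdd0 m * bdd1 m) (conjL2 (jet0 d)))
  rw [norm_conjL2, ← add_mul] at h
  rw [diffCoeff, sq, ← mul_assoc, _root_.mul_comm]
  exact mul_le_mul_of_nonneg_right h (norm_nonneg _)

/-- Both curves are continuous in `H22`, which controls q' in sup norm, so the coefficient in the
energy inequality is continuous in time and Gronwall's inequality applies to ‖u - v‖² in L². -/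
theorem eq_of_dnls {u v : ℝ → H22} (hu : Continuous u) (hv : Continuous v) (h0 : u 0 = v 0)
    (hu' : ∀ t, HasDerivAt (fun s => jet0 (u s)) (dnlsRate (u t)) t)
    (hv' : ∀ t, HasDerivAt (fun s => jet0 (v s)) (dnlsRate (v t)) t) : u = v := by
  obtain ⟨k, hk, hkb⟩ := exists_diffCoeff_le
  ext1 t
  have ht : t ∈ Ioo (-(|t| + 1)) (|t| + 1) := abs_lt.1 (lt_add_one _)
  have key := eq_zero_of_abs_deriv_le (f := fun t => ‖jet0 (u t - v t)‖ ^ 2)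
    (k := fun t => 2 * k ((1 / 2 : ℂ) • (u t + v t)) (u t - v t)) (by simp [h0])
    (fun s _ => hasDerivAt_normSq_jet0 (a := fun s => u s - v s)
      (a' := dnlsRate (u s) - dnlsRate (v s)) (by simpa only [map_sub] using (hu' s).fun_sub (hv' s)))
    ((continuous_const.mul (hk.comp (by fun_prop : Continuous fun t =>
      ((1 / 2 : ℂ) • (u t + v t), u t - v t)))).continuousOn) (fun s _ => by
        have e := re_inner_dnlsRate_sub ((1 / 2 : ℂ) • (u s + v s)) (u s - v s)
        have e1 : (1 / 2 : ℂ) • (u s + v s) + (1 / 2 : ℂ) • (u s - v s) = u s := by module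
        have e2 : (1 / 2 : ℂ) • (u s + v s) - (1 / 2 : ℂ) • (u s - v s) = v s := by module
        rw [e1, e2] at e
        rw [e, abs_mul, abs_two, abs_of_nonneg (sq_nonneg ‖jet0 (u s - v s)‖), mul_assoc]
        exact mul_le_mul_of_nonneg_left (hkb _ _) zero_le_two) t ht
  refine jet0_injective (sub_eq_zero.1 ?_)
  rw [← map_sub]
  simpa using key

end H22
end

/-! ### Extension by density and the main theorem -/

open MeasureTheory
open scoped SchwartzMap ContDiff

noncomputable section

open Set Filter Topology

namespace H22

theorem gauge_zero (σ : ℝ) : gauge σ 0 = 0 := by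
  have h := gauge_of σ 0
  have e : Sch.twist σ 0 0 = 0 := by
    ext x
    simp [Sch.twist_apply]
  rwa [e, map_zero] at h

theorem lipBdd_dnlsRate : LipBdd dnlsRate := by
  have hc : LipBdd fun q : H22 => cub q q (conj q) := lipBdd_cub .id .id LipBdd.id.h22conj
  have h2 : LipBdd fun q : H22 => jet2 q := .of_clm jet2
  exact (h2.smul Complex.I).add (hc.clm jet1)

/-- The gauged flow conjugated by the gauge transform. Both gauge maps are Lipschitz on bounded sets
and the gauged flow is bounded on bounded times, so the Lipschitz estimate survives. -/
theorem exists_flow_of : ∃ ρ : ℝ, 0 < ρ ∧ ∃ S : 𝓢(ℝ, ℂ) → ℝ → H22,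
    (∀ f, ‖of f‖ < ρ → S f 0 = of f ∧ Continuous (S f) ∧
      ∀ t, HasDerivAt (fun s => jet0 (S f s)) (dnlsRate (S f t)) t) ∧
    ∀ T : ℝ, ∃ K : ℝ, 0 ≤ K ∧ ∀ t, |t| ≤ T → (∀ f, ‖of f‖ < ρ → ‖S f t‖ ≤ K) ∧
      ∀ f g, ‖of f‖ < ρ → ‖of g‖ < ρ → ‖S f t - S g t‖ ≤ K * ‖of f - of g‖ := by
  obtain ⟨r, hr, Φ, hΦ, hK⟩ := exists_gauged_flow
  obtain ⟨C, hC, hCL⟩ := lipBdd_gauge (-1) 1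
  -- On the unit ball the inverse gauge is C-Lipschitz and fixes 0, so this radius puts the gauged
  -- data in the ball of radius r; C + 1 avoids division by zero.
  have hρ : 0 < min 1 (r / (C + 1)) := by positivity
  have hs : ∀ f, ‖of f‖ < min 1 (r / (C + 1)) → ‖of (Sch.twist (-1) f f)‖ < r := fun f hf => by
    have h1 := hCL (of f) 0 (hf.le.trans (min_le_left _ _)) (by simp)
    rw [gauge_zero, sub_zero, sub_zero, gauge_of] at h1
    have h2 := hf.trans_le (min_le_right _ _)
    rw [lt_div_iff₀ (by positivity)] at h2
    nlinarith [norm_nonneg (of f)]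
  refine ⟨_, hρ, fun f t => gauge 1 (Φ (Sch.twist (-1) f f) t), fun f hf => ?_, fun T => ?_⟩
  · obtain ⟨h1, h2, h3⟩ := hΦ _ (hs f hf)
    refine ⟨?_, (lipBdd_gauge 1).continuous.comp h2, fun t => hasDerivAt_jet0_gauge (h3 t)⟩
    simp only [h1, ← gauge_of]
    exact gauge_gauge_neg 1 f
  · obtain ⟨K, hK0, hK⟩ := hK T
    obtain ⟨C', hC', hCL'⟩ := lipBdd_gauge 1 K
    obtain ⟨B, hB⟩ := (lipBdd_gauge 1).exists_bound K
    refine ⟨max B (C' * (K * C)), le_max_of_le_right (by positivity), fun t ht => ⟨fun f hf =>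
      ((hB.2 _ ((hK t ht).1 _ (hs f hf)))).trans (le_max_left _ _), fun f g hf hg => ?_⟩⟩
    refine le_trans ?_ (mul_le_mul_of_nonneg_right (le_max_right _ _) (norm_nonneg _))
    have h1 := hCL (of f) (of g) (hf.le.trans (min_le_left _ _)) (hg.le.trans (min_le_left _ _))
    rw [gauge_of, gauge_of] at h1
    have h2 := (hK t ht).2 _ _ (hs f hf) (hs g hg)
    have h3 := hCL' _ _ ((hK t ht).1 _ (hs f hf)) ((hK t ht).1 _ (hs g hg))
    rw [mul_assoc, mul_assoc]
    exact h3.trans (mul_le_mul_of_nonneg_left (h2.trans (mul_le_mul_of_nonneg_left h1 hK0)) hC')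

theorem exists_seq_of {q : H22} {ρ : ℝ} (hq : ‖q‖ < ρ) : ∃ f : ℕ → 𝓢(ℝ, ℂ),
    (∀ n, ‖of (f n)‖ < ρ) ∧ Tendsto (fun n => of (f n)) atTop (𝓝 q) := by
  have hm : q ∈ closure (Metric.ball (0 : H22) ρ ∩ range of)  :=
    denseRange_of.open_subset_closure_inter Metric.isOpen_ball (by simpa using hq)
  obtain ⟨p, hp, hpq⟩ := mem_closure_iff_seq_limit.1 hm
  choose f hf using fun n => (hp n).2
  refine ⟨f, fun n => ?_, by simpa only [hf] using hpq⟩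
  rw [hf]
  simpa using (hp n).1

/-- The uniform Lipschitz bound makes the solutions with approximating Schwartz data converge in
`H22`, uniformly on bounded times. Their time derivatives `dnlsRate` then converge uniformly in L²,
so the limit solves the equation. -/
theorem exists_flow : ∃ ρ : ℝ, 0 < ρ ∧ ∃ S : H22 → ℝ → H22,
    (∀ q, ‖q‖ < ρ → S q 0 = q ∧ Continuous (S q) ∧
      ∀ t, HasDerivAt (fun s => jet0 (S q s)) (dnlsRate (S q t)) t) ∧
    ∀ T : ℝ, ∃ K : ℝ, 0 ≤ K ∧ ∀ t, |t| ≤ T → ∀ p q, ‖p‖ < ρ → ‖q‖ < ρ →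
      ‖S p t - S q t‖ ≤ K * ‖p - q‖ := by
  obtain ⟨ρ, hρ, S, hS, hK⟩ := exists_flow_of
  have hseq : ∀ q : H22, ∃ f : ℕ → 𝓢(ℝ, ℂ), ‖q‖ < ρ →
      (∀ n, ‖of (f n)‖ < ρ) ∧ Tendsto (fun n => of (f n)) atTop (𝓝 q) := fun q => by
    by_cases hq : ‖q‖ < ρ
    · obtain ⟨f, hf⟩ := exists_seq_of hq
      exact ⟨f, fun _ => hf⟩
    · exact ⟨0, fun h => absurd h hq⟩
  choose f hf using hseq
  have hlim : ∀ q t, ∃ y, ‖q‖ < ρ → Tendsto (fun n => S (f q n) t) atTop (𝓝 y) := fun q t => by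
    by_cases hq : ‖q‖ < ρ
    · obtain ⟨K, hK0, hK⟩ := hK |t|
      have hc : CauchySeq fun n => S (f q n) t := by
        rw [cauchySeq_iff_tendsto_dist_atTop_0]
        have h := (cauchySeq_iff_tendsto_dist_atTop_0.1 (hf q hq).2.cauchySeq).const_mul K
        rw [mul_zero] at h
        refine squeeze_zero (fun _ => dist_nonneg) (fun n => ?_) h
        rw [dist_eq_norm, dist_eq_norm]
        exact (hK t le_rfl).2 _ _ ((hf q hq).1 _) ((hf q hq).1 _)
      obtain ⟨y, hy⟩ := cauchySeq_tendsto_of_complete hc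
      exact ⟨y, fun _ => hy⟩
    · exact ⟨0, fun h => absurd h hq⟩
  choose Φ hΦ using hlim
  refine ⟨ρ, hρ, Φ, fun q hq => ?_, fun T => ?_⟩
  · have hloc : ∀ T : ℝ, ∃ K, 0 ≤ K ∧ ∀ t ∈ Ioo (-T) T, ‖Φ q t‖ ≤ K ∧
        ∀ n, ‖S (f q n) t‖ ≤ K ∧ ‖S (f q n) t - Φ q t‖ ≤ K * ‖of (f q n) - q‖ := fun T => by
      obtain ⟨K, hK0, hK⟩ := hK T
      refine ⟨K, hK0, fun t ht => ?_⟩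
      obtain ⟨h1, h2⟩ := hK t (abs_le.2 (Ioo_subset_Icc_self ht))
      refine ⟨le_of_tendsto (hΦ q t hq).norm (Eventually.of_forall fun n => h1 _ ((hf q hq).1 n)),
        fun n => ⟨h1 _ ((hf q hq).1 n), ?_⟩⟩
      exact le_of_tendsto_of_tendsto' ((hΦ q t hq).const_sub _).norm
        (((hf q hq).2.const_sub (of (f q n))).norm.const_mul K)
        fun m => h2 _ _ ((hf q hq).1 n) ((hf q hq).1 m)
    have hz : ∀ K : ℝ, Tendsto (fun n => K * ‖of (f q n) - q‖) atTop (𝓝 0) := fun K => by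
      simpa using ((hf q hq).2.sub_const q).norm.const_mul K
    have hmem : ∀ t : ℝ, t ∈ Ioo (-(|t| + 1)) (|t| + 1) := fun t => abs_lt.1 (lt_add_one _)
    refine ⟨?_, continuous_iff_continuousAt.2 fun t => ?_, fun t => ?_⟩
    · refine tendsto_nhds_unique (hΦ q 0 hq) ?_
      simpa only [fun n => (hS _ ((hf q hq).1 n)).1] using (hf q hq).2
    · obtain ⟨K, hK0, hK⟩ := hloc (|t| + 1)
      have hu : TendstoUniformlyOn (fun n s => S (f q n) s) (Φ q) atTop
          (Ioo (-(|t| + 1)) (|t| + 1)) := by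
        rw [Metric.tendstoUniformlyOn_iff]
        intro ε hε
        filter_upwards [(hz K).eventually_lt_const hε] with n hn s hs
        rw [dist_comm, dist_eq_norm]
        exact ((hK s hs).2 n).2.trans_lt hn
      exact (hu.continuousOn (Frequently.of_forall fun n =>
        (hS _ ((hf q hq).1 n)).2.1.continuousOn)).continuousAt (Ioo_mem_nhds (hmem t).1 (hmem t).2)
    · obtain ⟨K, hK0, hK⟩ := hloc (|t| + 1)
      obtain ⟨C, hC, hCL⟩ := lipBdd_dnlsRate K
      refine hasDerivAt_of_tendstoUniformlyOn (l := atTop) (f := fun n s => jet0 (S (f q n) s))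
        (f' := fun n s => dnlsRate (S (f q n) s)) (g' := fun s => dnlsRate (Φ q s)) isOpen_Ioo ?_
        (Eventually.of_forall fun n s _ => (hS _ ((hf q hq).1 n)).2.2 s)
        (fun s _ => (jet0.continuous.tendsto _).comp (hΦ q s hq)) (hmem t)
      rw [Metric.tendstoUniformlyOn_iff]
      intro ε hε
      filter_upwards [(hz (C * K)).eventually_lt_const hε] with n hn s hs
      obtain ⟨h1, h2⟩ := hK s hs
      rw [dist_comm, dist_eq_norm]
      refine ((hCL _ _ (h2 n).1 h1).trans ?_).trans_lt hn
      rw [mul_assoc]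
      exact mul_le_mul_of_nonneg_left (h2 n).2 hC
  · obtain ⟨K, hK0, hK⟩ := hK T
    refine ⟨K, hK0, fun t ht p q hp hq => ?_⟩
    exact le_of_tendsto_of_tendsto' ((hΦ p t hp).sub (hΦ q t hq)).norm
      (((hf p hp).2.sub (hf q hq).2).norm.const_mul K)
      fun n => (hK t ht).2 _ _ ((hf p hp).1 n) ((hf q hq).1 n)

end H22

theorem mainTheorem2 :
    ∃ (U : Set H22) (Φ : H22 → ℝ → H22),
      IsOpen U ∧ (0 : H22) ∈ U ∧
      (∀ u₀ ∈ U, IsDNLSSolution u₀ (Φ u₀) ∧ ∀ v : ℝ → H22, IsDNLSSolution u₀ v → v = Φ u₀) ∧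
      ContinuousOn (fun p : H22 × ℝ => Φ p.1 p.2) (U ×ˢ Set.univ) ∧
      ∀ t : ℝ, ∃ K : NNReal, LipschitzOnWith K (fun u₀ => Φ u₀ t) U := by
  obtain ⟨ρ, hρ, S, hS, hL⟩ := H22.exists_flow
  have hm : ∀ {q : H22}, q ∈ Metric.ball (0 : H22) ρ → ‖q‖ < ρ := fun h => by simpa using h
  have hLip : ∀ T : ℝ, ∃ K : NNReal, ∀ t, |t| ≤ T →
      LipschitzOnWith K (fun q => S q t) (Metric.ball (0 : H22) ρ) := fun T => by
    obtain ⟨K, hK0, hK⟩ := hL T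
    refine ⟨⟨K, hK0⟩, fun t ht => LipschitzOnWith.of_dist_le_mul fun p hp q hq => ?_⟩
    rw [dist_eq_norm, dist_eq_norm]
    exact hK t ht p q (hm hp) (hm hq)
  refine ⟨Metric.ball 0 ρ, S, Metric.isOpen_ball, Metric.mem_ball_self hρ, fun q hq => ?_, ?_,
    fun t => ?_⟩
  · obtain ⟨h1, h2, h3⟩ := hS q (hm hq)
    refine ⟨H22.isDNLSSolution_iff.2 ⟨h2, h1, h3⟩, fun v hv => ?_⟩
    obtain ⟨h4, h5, h6⟩ := H22.isDNLSSolution_iff.1 hv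
    exact H22.eq_of_dnls h4 h2 (h5.trans h1.symm) h6 h3
  · rintro ⟨q, t⟩ ⟨hq, -⟩
    obtain ⟨K, hK⟩ := hLip (|t| + 1)
    -- Joint continuity from continuity in time for each datum and a Lipschitz constant in the datum
    -- that is uniform for times near t.
    have h := continuousOn_prod_of_continuousOn_lipschitzOnWith (fun p : H22 × ℝ => S p.1 p.2)
      (s := Metric.ball 0 ρ) (t := Ioo (-(|t| + 1)) (|t| + 1)) K
      (fun q hq => (hS q (hm hq)).2.1.continuousOn)
      (fun s hs => hK s (abs_le.2 (Ioo_subset_Icc_self hs)))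
    have ht : t ∈ Ioo (-(|t| + 1)) (|t| + 1) := abs_lt.1 (lt_add_one _)
    exact (h.continuousAt (prod_mem_nhds (Metric.isOpen_ball.mem_nhds hq)
      (Ioo_mem_nhds ht.1 ht.2))).continuousWithinAt
  · obtain ⟨K, hK⟩ := hLip |t|
    exact ⟨K, hK t le_rfl⟩

end
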